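/- Let $F$ be a non-archimedean local field with ring of integers $\mathfrak o$, maximal ideal $\mathfrak p=\varpi\mathfrak o$ (with $\varpi$ a fixed generator), $q=|\mathfrak o/\mathfrak p|$, and normalized absolute value $|\cdot|$ (so $|\varpi|=q^{-1}$). Let $T_3$ be the diagonal torus and $U_3$ the group of upper triangular unipotent matrices in $\mathrm{GL}_3(F)$, and put $B_3=T_3U_3$. Let $w\in\mathrm{GL}_3(F)$ be the antidiagonal permutation matrix. Let $\psi:F\to\mathbb C^\times$ be a continuous unitary additive character that is unramified, i.e. trivial on $\mathfrak o$ but not on $\mathfrak p^{-1}$, and put $\psi(u)=\psi(x+y)$ for the matrix $u=\begin{pmatrix}1&x&z\\&1&y\\&&1\end{pmatrix}\in U_3$. Let $du=dx\,dy\,dz$ on $U_3$, where $dx,dy,dz$ give $\mathfrak o$ volume $1$. Let $\mu_1,\mu_2,\mu_3$ be quasi-characters (continuous homomorphisms to $\mathbb C^\times$) of $F^\times$, and let $I(\mu)$ be the normalized principal series of $\mathrm{GL}_3(F)$: the space of functions $f:\mathrm{GL}_3(F)\to\mathbb C$, right invariant under some open subgroup, with $$f(\mathrm{diag}(a_1,a_2,a_3)\,u\,g)=\mu_1(a_1)\mu_2(a_2)\mu_3(a_3)\,|a_1/a_3|\,f(g)\qquad(a_i\in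 F^\times,\ u\in U_3,\ g\in\mathrm{GL}_3(F)),$$ on which $\mathrm{GL}_3(F)$ acts by right translation. Assume that $I(\mu)$ is irreducible, that $\mu_1,\mu_3$ are unramified (trivial on $\mathfrak o^\times$), and that $\mu_2$ is ramified of conductor $c\ge1$, i.e. $c$ is the least integer $n\ge 1$ with $\mu_2$ trivial on $1+\mathfrak p^n$. Put $t_i=\mu_i(\varpi)$ for $i=1,3$. Let $K_c$ be the group of all $g\in\mathrm{GL}_3(F)$ such that both $g$ and $g^{-1}$ lie in $$\begin{pmatrix}\mathfrak o&\mathfrak o&\mathfrak p^{-c}\\ \mathfrak p^c&1+\mathfrak p^c&\mathfrak o\\ \mathfrak p^c&\mathfrak p^c&\mathfrak o\end{pmatrix},$$ and let $f$ be the $K_c$-invariant newform in $I(\mu)$: the function supported on $B_3K_c$ with $$f(\mathrm{diag}(a_1,a_2,a_3)\,u\,k)=\mu_1(a_1)\mu_2(a_2)\mu_3(a_3)\,|a_1/a_3|\qquad(a_i\in F^\times,\ u\in U_3,\ k\in K_c).$$ For $g\in\mathrm{GL}_3(F)$ let $$W_f(g)=\int_{U_3}^{st}f(wug)\,\psi^{-1}(u)\,du$$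 be the stable integral: for every increasing sequence $U^1\subset U^2\subset\cdots$ of compact open subgroups of $U_3$ with $\bigcup_k U^k=U_3$, the integrals $\int_{U^k}f(wug)\psi^{-1}(u)\,du$ are constant for all sufficiently large $k$, with a value $W_f(g)$ that does not depend on the sequence. Then $W_f(g)$ exists in this sense for every $g$, and: 1. $W_f(1)\ne0$. 2. For all integers $m,n\ge0$ and all $a\in\varpi^m\mathfrak o^\times$, $b\in\varpi^{-n}\mathfrak o^\times$, $$W_f(\mathrm{diag}(a,1,b))=q^{-(m+n)}(t_1t_3)^{-n}\,\frac{t_1^{m+n+1}-t_3^{m+n+1}}{t_1-t_3}\,W_f(1),$$ where for $t_1=t_3$ the quotient is read as the polynomial $\sum_{i=0}^{m+n}t_1^{i}t_3^{m+n-i}$ to which it is equal for $t_1\neq t_3$. -/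

import Mathlib

open ValuativeRel MeasureTheory Filter

namespace GLThree

section LocalField

variable {F : Type*} [Field F] [ValuativeRel F] [TopologicalSpace F] [IsNonarchimedeanLocalField F]

/-- The number `q` of elements of the residue field. -/
noncomputable def resCard (F : Type*) [Field F] [ValuativeRel F] [TopologicalSpace F]
    [IsNonarchimedeanLocalField F] : ℕ := Nat.card 𝓀[F]

/-- The normalized discrete valuation, written multiplicatively with values in `ℤᵐ⁰`:
a uniformizer has value `WithZero.exp (-1)`. -/
noncomputable def val (F : Type*) [Field F] [ValuativeRel F] [TopologicalSpace F]
    [IsNonarchimedeanLocalField F] : Valuation F (WithZero (Multiplicative ℤ)) :=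
  (valuation F).map
    (IsNonarchimedeanLocalField.valueGroupWithZeroIsoInt F :
      ValueGroupWithZero F ≃* WithZero (Multiplicative ℤ)).toMonoidWithZeroHom
    (IsNonarchimedeanLocalField.valueGroupWithZeroIsoInt F).strictMono.monotone

/-- The normalized absolute value `|x|` of a nonzero `x`: a uniformizer has absolute
value `q⁻¹`. -/
noncomputable def absF (x : Fˣ) : ℝ := (resCard F : ℝ) ^ (WithZero.log (val F (x : F)))

/-- The fractional ideal `𝔭ᵏ`, `k ∈ ℤ`. -/
def pPow (F : Type*) [Field F] [ValuativeRel F] [TopologicalSpace F]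
    [IsNonarchimedeanLocalField F] (k : ℤ) : Set F :=
  {x | val F x ≤ WithZero.exp (-k)}

/-- `ϖ` generates the maximal ideal `𝔭` of the ring of integers. -/
def IsUniformizer (ϖ : Fˣ) : Prop :=
  ∃ h : (ϖ : F) ∈ 𝒪[F], Ideal.span {(⟨(ϖ : F), h⟩ : 𝒪[F])} = 𝓂[F]

/-- The filtration of `𝔬ˣ`: `𝔬ˣ` for `n = 0` and `1 + 𝔭ⁿ` for `n ≥ 1`. -/
def unitFiltration (F : Type*) [Field F] [ValuativeRel F] [TopologicalSpace F]
    [IsNonarchimedeanLocalField F] (n : ℕ) : Set Fˣ :=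
  {x | val F (x : F) = 1 ∧ (x : F) - 1 ∈ pPow F n}

/-- A quasi-character of `Fˣ` is unramified when it is trivial on `𝔬ˣ`. -/
def IsUnramified (χ : Fˣ →ₜ* ℂˣ) : Prop := ∀ x ∈ unitFiltration F 0, χ x = 1

/-- The (exponent of the) conductor of a quasi-character: the least `n ≥ 0` such that it is
trivial on the `n`-th step of the filtration of `𝔬ˣ`. -/
noncomputable def conductor (χ : Fˣ →ₜ* ℂˣ) : ℕ :=
  sInf {n : ℕ | ∀ x ∈ unitFiltration F n, χ x = 1}

/-- An additive character is unramified when `𝔬` is the largest fractional ideal on which it is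
trivial. -/
def IsUnramifiedAddChar (ψ : AddChar F Circle) : Prop :=
  (∀ x ∈ pPow F 0, ψ x = 1) ∧ ∃ x ∈ pPow F (-1), ψ x ≠ 1

lemma pPow_add_mem {k : ℤ} {x y : F} (hx : x ∈ pPow F k) (hy : y ∈ pPow F k) :
    x + y ∈ pPow F k := (val F).map_add_le hx hy

lemma pPow_mul_mem {i j k : ℤ} (h : k ≤ i + j) {x y : F} (hx : x ∈ pPow F i)
    (hy : y ∈ pPow F j) : x * y ∈ pPow F k := by
  simp only [pPow, Set.mem_ofPred_eq, map_mul] at *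
  refine (mul_le_mul' hx hy).trans ?_
  rw [← WithZero.exp_add, WithZero.exp_le_exp]
  omega

lemma zero_mem_pPow (k : ℤ) : (0 : F) ∈ pPow F k := by simp [pPow]

lemma one_mem_pPow : (1 : F) ∈ pPow F 0 := by simp [pPow]

lemma pPow_mono {i j : ℤ} (h : j ≤ i) {x : F} (hx : x ∈ pPow F i) : x ∈ pPow F j := by
  have := pPow_mul_mem (k := j) (by omega) hx (one_mem_pPow (F := F))
  simpa using this

lemma val_eq_one_of_mul_eq_one {x y : F} (hx : x ∈ pPow F 0) (hy : y ∈ pPow F 0)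
    (h : x * y = 1) : val F x = 1 := by
  simp only [pPow, Set.mem_ofPred_eq, neg_zero, WithZero.exp_zero] at hx hy
  refine le_antisymm hx ?_
  calc (1 : WithZero (Multiplicative ℤ)) = val F x * val F y := by rw [← map_mul, h, map_one]
    _ ≤ val F x * 1 := mul_le_mul_right hy _
    _ = val F x := mul_one _

lemma absF_mul (x y : Fˣ) : absF (x * y) = absF x * absF y := by
  have hq : (resCard F : ℝ) ≠ 0 := by
    have : Nonempty 𝓀[F] := ⟨0⟩
    exact_mod_cast (Nat.card_pos (α := 𝓀[F])).ne'
  simp only [absF, Units.val_mul, map_mul]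
  rw [WithZero.log_mul (by simp) (by simp), zpow_add₀ hq]

lemma absF_eq_one {x : Fˣ} (h : val F (x : F) = 1) : absF x = 1 := by simp [absF, h]

end LocalField

section Groups

variable {F : Type*} [Field F]

/-- The diagonal matrix `diag(a₁, a₂, a₃)`. -/
def torus (a₁ a₂ a₃ : Fˣ) : GL (Fin 3) F where
  val := !![(a₁ : F), 0, 0; 0, (a₂ : F), 0; 0, 0, (a₃ : F)]
  inv := !![((a₁⁻¹ : Fˣ) : F), 0, 0; 0, ((a₂⁻¹ : Fˣ) : F), 0; 0, 0, ((a₃⁻¹ : Fˣ) : F)]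
  val_inv := by ext i j; fin_cases i <;> fin_cases j <;> simp [Matrix.mul_apply, Fin.sum_univ_three]
  inv_val := by ext i j; fin_cases i <;> fin_cases j <;> simp [Matrix.mul_apply, Fin.sum_univ_three]

/-- The upper triangular unipotent matrix with entries `x`, `y` above the diagonal and `z` in the
corner. -/
def unip (x y z : F) : GL (Fin 3) F where
  val := !![1, x, z; 0, 1, y; 0, 0, 1]
  inv := !![1, -x, x * y - z; 0, 1, -y; 0, 0, 1]
  val_inv := by
    ext i j; fin_cases i <;> fin_cases j <;> simp [Matrix.mul_apply, Fin.sum_univ_three] <;> ring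
  inv_val := by
    ext i j; fin_cases i <;> fin_cases j <;> simp [Matrix.mul_apply, Fin.sum_univ_three] <;> ring

/-- The antidiagonal permutation matrix. -/
def wLong (F : Type*) [Field F] : GL (Fin 3) F where
  val := !![0, 0, 1; 0, 1, 0; 1, 0, 0]
  inv := !![0, 0, 1; 0, 1, 0; 1, 0, 0]
  val_inv := by
    ext i j; fin_cases i <;> fin_cases j <;> simp [Matrix.mul_apply, Fin.sum_univ_three]
  inv_val := by
    ext i j; fin_cases i <;> fin_cases j <;> simp [Matrix.mul_apply, Fin.sum_univ_three]

lemma unip_mul (x y z x' y' z' : F) :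
    unip x y z * unip x' y' z' = unip (x + x') (y + y') (z + z' + x * y') := by
  ext i j; fin_cases i <;> fin_cases j <;>
    simp [unip, Matrix.mul_apply, Fin.sum_univ_three] <;> ring

lemma unip_inv (x y z : F) : (unip x y z)⁻¹ = unip (-x) (-y) (x * y - z) := by
  rw [inv_eq_iff_mul_eq_one, unip_mul]
  ext i j; fin_cases i <;> fin_cases j <;> simp [unip]

/-- The group `U₃` of upper triangular unipotent matrices. -/
def unipGroup (F : Type*) [Field F] : Subgroup (GL (Fin 3) F) where
  carrier := {g | ∃ x y z : F, g = unip x y z}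
  mul_mem' := by
    rintro _ _ ⟨x, y, z, rfl⟩ ⟨x', y', z', rfl⟩
    exact ⟨_, _, _, unip_mul ..⟩
  one_mem' := ⟨0, 0, 0, by ext i j; fin_cases i <;> fin_cases j <;> simp [unip]⟩
  inv_mem' := by
    rintro _ ⟨x, y, z, rfl⟩
    exact ⟨_, _, _, unip_inv ..⟩

/-- The coordinates `(x, y, z)` on `U₃`. -/
def unipCoord (p : F × F × F) : unipGroup F := ⟨unip p.1 p.2.1 p.2.2, _, _, _, rfl⟩

/-- The generic character of `U₃` attached to an additive character `ψ` of `F`: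
it sends the unipotent matrix with coordinates `(x, y, z)` to `ψ (x + y)`. -/
noncomputable def genericChar (ψ : AddChar F Circle) (u : unipGroup F) : ℂ :=
  (ψ ((u : GL (Fin 3) F) 0 1 + (u : GL (Fin 3) F) 1 2) : ℂ)

variable [ValuativeRel F] [TopologicalSpace F] [IsNonarchimedeanLocalField F]

/-- The set of matrices of the shape
`(𝔬, 𝔬, 𝔭⁻ⁿ; 𝔭ⁿ, 1 + 𝔭ⁿ, 𝔬; 𝔭ⁿ, 𝔭ⁿ, 𝔬)`. -/
def orderSet (F : Type*) [Field F] [ValuativeRel F] [TopologicalSpace F]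
    [IsNonarchimedeanLocalField F] (n : ℕ) : Set (Matrix (Fin 3) (Fin 3) F) :=
  {A | (A 0 0 ∈ pPow F 0 ∧ A 0 1 ∈ pPow F 0 ∧ A 0 2 ∈ pPow F (-n)) ∧
    (A 1 0 ∈ pPow F n ∧ A 1 1 - 1 ∈ pPow F n ∧ A 1 2 ∈ pPow F 0) ∧
    (A 2 0 ∈ pPow F n ∧ A 2 1 ∈ pPow F n ∧ A 2 2 ∈ pPow F 0)}

lemma orderSet_one (n : ℕ) : (1 : Matrix (Fin 3) (Fin 3) F) ∈ orderSet F n := by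
  simp [orderSet, zero_mem_pPow, one_mem_pPow]

lemma orderSet_mul {n : ℕ} {A B : Matrix (Fin 3) (Fin 3) F} (hA : A ∈ orderSet F n)
    (hB : B ∈ orderSet F n) : A * B ∈ orderSet F n := by
  obtain ⟨⟨a00, a01, a02⟩, ⟨a10, a11, a12⟩, a20, a21, a22⟩ := hA
  obtain ⟨⟨b00, b01, b02⟩, ⟨b10, b11, b12⟩, b20, b21, b22⟩ := hB
  have a11' : A 1 1 ∈ pPow F 0 := by
    simpa using pPow_add_mem (pPow_mono (by omega) a11) (one_mem_pPow (F := F))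
  have b11' : B 1 1 ∈ pPow F 0 := by
    simpa using pPow_add_mem (pPow_mono (by omega) b11) (one_mem_pPow (F := F))
  simp only [orderSet, Set.mem_ofPred_eq, Matrix.mul_apply, Fin.sum_univ_three]
  refine ⟨⟨?_, ?_, ?_⟩, ⟨?_, ?_, ?_⟩, ?_, ?_, ?_⟩
  · exact pPow_add_mem (pPow_add_mem (pPow_mul_mem (by omega) a00 b00)
      (pPow_mul_mem (by omega) a01 b10)) (pPow_mul_mem (by omega) a02 b20)
  · exact pPow_add_mem (pPow_add_mem (pPow_mul_mem (by omega) a00 b01)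
      (pPow_mul_mem (by omega) a01 b11')) (pPow_mul_mem (by omega) a02 b21)
  · exact pPow_add_mem (pPow_add_mem (pPow_mul_mem (by omega) a00 b02)
      (pPow_mul_mem (by omega) a01 b12)) (pPow_mul_mem (by omega) a02 b22)
  · exact pPow_add_mem (pPow_add_mem (pPow_mul_mem (by omega) a10 b00)
      (pPow_mul_mem (by omega) a11' b10)) (pPow_mul_mem (by omega) a12 b20)
  · have e : A 1 0 * B 0 1 + A 1 1 * B 1 1 + A 1 2 * B 2 1 - 1 =
        A 1 0 * B 0 1 + ((A 1 1 - 1) * B 1 1 + (B 1 1 - 1)) + A 1 2 * B 2 1 := by ring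
    rw [e]
    exact pPow_add_mem (pPow_add_mem (pPow_mul_mem (by omega) a10 b01)
      (pPow_add_mem (pPow_mul_mem (by omega) a11 b11') b11)) (pPow_mul_mem (by omega) a12 b21)
  · exact pPow_add_mem (pPow_add_mem (pPow_mul_mem (by omega) a10 b02)
      (pPow_mul_mem (by omega) a11' b12)) (pPow_mul_mem (by omega) a12 b22)
  · exact pPow_add_mem (pPow_add_mem (pPow_mul_mem (by omega) a20 b00)
      (pPow_mul_mem (by omega) a21 b10)) (pPow_mul_mem (by omega) a22 b20)
  · exact pPow_add_mem (pPow_add_mem (pPow_mul_mem (by omega) a20 b01)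
      (pPow_mul_mem (by omega) a21 b11')) (pPow_mul_mem (by omega) a22 b21)
  · exact pPow_add_mem (pPow_add_mem (pPow_mul_mem (by omega) a20 b02)
      (pPow_mul_mem (by omega) a21 b12)) (pPow_mul_mem (by omega) a22 b22)

/-- The group `K_n`: the invertible matrices `g` such that `g` and `g⁻¹` have the shape
`(𝔬, 𝔬, 𝔭⁻ⁿ; 𝔭ⁿ, 1 + 𝔭ⁿ, 𝔬; 𝔭ⁿ, 𝔭ⁿ, 𝔬)`. -/
def levelGroup (F : Type*) [Field F] [ValuativeRel F] [TopologicalSpace F]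
    [IsNonarchimedeanLocalField F] (n : ℕ) : Subgroup (GL (Fin 3) F) where
  carrier := {g | (g : Matrix (Fin 3) (Fin 3) F) ∈ orderSet F n ∧
    ((g⁻¹ : GL (Fin 3) F) : Matrix (Fin 3) (Fin 3) F) ∈ orderSet F n}
  mul_mem' := by
    rintro g h ⟨hg, hg'⟩ ⟨hh, hh'⟩
    refine ⟨?_, ?_⟩
    · rw [Units.val_mul]; exact orderSet_mul hg hh
    · rw [mul_inv_rev, Units.val_mul]; exact orderSet_mul hh' hg'
  one_mem' := ⟨by simpa using orderSet_one n, by simpa using orderSet_one n⟩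
  inv_mem' := by
    rintro g ⟨hg, hg'⟩
    exact ⟨hg', by rwa [inv_inv]⟩

end Groups

section PrincipalSeries

variable {F : Type*} [Field F] [ValuativeRel F] [TopologicalSpace F] [IsNonarchimedeanLocalField F]

/-- `μ₁(a₁) μ₂(a₂) μ₃(a₃) |a₁ / a₃|`. -/
noncomputable def borelWeight (μ₁ μ₂ μ₃ : Fˣ →ₜ* ℂˣ) (a₁ a₂ a₃ : Fˣ) : ℂ :=
  (μ₁ a₁ : ℂ) * (μ₂ a₂ : ℂ) * (μ₃ a₃ : ℂ) * (absF (a₁ / a₃) : ℂ)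

/-- The space of the normalized principal series `I(μ₁, μ₂, μ₃)` of `GL₃(F)`: the functions
that transform on the left under the upper triangular Borel subgroup through `borelWeight` and
are invariant on the right under some open subgroup. -/
def principalSeries (μ₁ μ₂ μ₃ : Fˣ →ₜ* ℂˣ) : Submodule ℂ (GL (Fin 3) F → ℂ) where
  carrier := {f | (∀ a₁ a₂ a₃ : Fˣ, ∀ u ∈ unipGroup F, ∀ g,
      f (torus a₁ a₂ a₃ * u * g) = borelWeight μ₁ μ₂ μ₃ a₁ a₂ a₃ * f g) ∧
    ∃ K : Subgroup (GL (Fin 3) F), IsOpen (K : Set (GL (Fin 3) F)) ∧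
      ∀ g, ∀ k ∈ K, f (g * k) = f g}
  add_mem' := by
    rintro f f' ⟨h, K, hK, hf⟩ ⟨h', K', hK', hf'⟩
    refine ⟨fun a₁ a₂ a₃ u hu g => ?_, K ⊓ K', hK.inter hK', fun g k hk => ?_⟩
    · simp only [Pi.add_apply, h a₁ a₂ a₃ u hu g, h' a₁ a₂ a₃ u hu g]; ring
    · simp only [Pi.add_apply, hf g k hk.1, hf' g k hk.2]
  zero_mem' := ⟨fun _ _ _ _ _ _ => by simp, ⊤, isOpen_univ, fun _ _ _ => rfl⟩
  smul_mem' := by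
    rintro z f ⟨h, K, hK, hf⟩
    refine ⟨fun a₁ a₂ a₃ u hu g => ?_, K, hK, fun g k hk => ?_⟩
    · simp only [Pi.smul_apply, smul_eq_mul, h a₁ a₂ a₃ u hu g]; ring
    · simp only [Pi.smul_apply, hf g k hk]

/-- The action of `GL₃(F)` on `I(μ₁, μ₂, μ₃)` by right translation, `(h • f)(g) = f (g h)`. -/
def principalSeriesRep (μ₁ μ₂ μ₃ : Fˣ →ₜ* ℂˣ) :
    Representation ℂ (GL (Fin 3) F) (principalSeries μ₁ μ₂ μ₃) where
  toFun h :=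
    { toFun := fun f => ⟨fun g => f.1 (g * h), by
        obtain ⟨f, hf, K, hK, hfK⟩ := f
        refine ⟨fun a₁ a₂ a₃ u hu g => ?_, K.comap (MulAut.conj h⁻¹).toMonoidHom, ?_, ?_⟩
        · simpa only [mul_assoc] using hf a₁ a₂ a₃ u hu (g * h)
        · refine hK.preimage ?_
          change Continuous fun x => h⁻¹ * x * h⁻¹⁻¹
          fun_prop
        · intro g k hk
          have := hfK (g * h) (h⁻¹ * k * h) (by simpa using hk)
          simpa [mul_assoc] using this⟩
      map_add' := fun _ _ => rfl
      map_smul' := fun _ _ => rfl }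
  map_one' := by ext f g; simp
  map_mul' h h' := by ext f g; simp [mul_assoc]

open Classical in
/-- The newform `f` of level `K_n`: it vanishes outside `B₃ K_n`, and
`f (diag(a₁, a₂, a₃) u k) = μ₁(a₁) μ₂(a₂) μ₃(a₃) |a₁ / a₃|` for `u ∈ U₃` and `k ∈ K_n`
(see `newform_apply`). -/
noncomputable def newform (μ₁ μ₂ μ₃ : Fˣ →ₜ* ℂˣ) (n : ℕ) (g : GL (Fin 3) F) : ℂ :=
  if h : ∃ a : Fˣ × Fˣ × Fˣ, ∃ u ∈ unipGroup F, ∃ k ∈ levelGroup F n,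
      g = torus a.1 a.2.1 a.2.2 * u * k then
    borelWeight μ₁ μ₂ μ₃ h.choose.1 h.choose.2.1 h.choose.2.2
  else 0

end PrincipalSeries

section Whittaker

variable {F : Type*} [Field F] [ValuativeRel F] [TopologicalSpace F] [IsNonarchimedeanLocalField F]

/-- An increasing sequence of compact open subgroups of `U₃` with union `U₃`. -/
structure IsExhaustion (U : ℕ → Subgroup (unipGroup F)) : Prop where
  isOpen : ∀ k, IsOpen (U k : Set (unipGroup F))
  isCompact : ∀ k, IsCompact (U k : Set (unipGroup F))
  mono : Monotone U
  exhaust : ∀ u, ∃ k, u ∈ U k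

/-- The integral of `φ` over a subgroup of `U₃`, for the measure `du = dx dy dz`. -/
noncomputable def unipIntegral [MeasurableSpace F] (dx : Measure F) (V : Subgroup (unipGroup F))
    (φ : unipGroup F → ℂ) : ℂ :=
  ∫ p in {p : F × F × F | unipCoord p ∈ V}, φ (unipCoord p) ∂(dx.prod (dx.prod dx))

/-- `φ` has the stable integral `L` over `U₃`: for every increasing sequence of compact open
subgroups that exhausts `U₃`, the integrals of `φ` over these subgroups are eventually constant,
equal to `L`. -/
def HasStableIntegral [MeasurableSpace F] (dx : Measure F) (φ : unipGroup F → ℂ) (L : ℂ) : Prop :=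
  ∀ U : ℕ → Subgroup (unipGroup F), IsExhaustion U →
    ∀ᶠ k in atTop, unipIntegral dx (U k) φ = L

/-- The stable integral of `φ` over `U₃` (meaningful when there is one). -/
noncomputable def stableIntegral [MeasurableSpace F] (dx : Measure F) (φ : unipGroup F → ℂ) : ℂ :=
  Classical.epsilon (HasStableIntegral dx φ)

/-- The function `u ↦ f (w u g) ψ⁻¹(u)` on `U₃`. -/
noncomputable def whittakerIntegrand (ψ : AddChar F Circle) (f : GL (Fin 3) F → ℂ)
    (g : GL (Fin 3) F) (u : unipGroup F) : ℂ :=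
  f (wLong F * (u : GL (Fin 3) F) * g) * (genericChar ψ u)⁻¹

/-- The Whittaker function `W_f(g)`, the stable integral of `f (w u g) ψ⁻¹(u)` over `U₃`. -/
noncomputable def whittaker [MeasurableSpace F] (dx : Measure F) (ψ : AddChar F Circle)
    (f : GL (Fin 3) F → ℂ) (g : GL (Fin 3) F) : ℂ :=
  stableIntegral dx (whittakerIntegrand ψ f g)

end Whittaker

section WellDefined

variable {F : Type*} [Field F] [ValuativeRel F] [TopologicalSpace F] [IsNonarchimedeanLocalField F]

lemma borelWeight_mul (μ₁ μ₂ μ₃ : Fˣ →ₜ* ℂˣ) (a₁ a₂ a₃ b₁ b₂ b₃ : Fˣ) :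
    borelWeight μ₁ μ₂ μ₃ (a₁ * b₁) (a₂ * b₂) (a₃ * b₃) =
      borelWeight μ₁ μ₂ μ₃ a₁ a₂ a₃ * borelWeight μ₁ μ₂ μ₃ b₁ b₂ b₃ := by
  simp only [borelWeight, map_mul, mul_div_mul_comm, absF_mul, Units.val_mul, Complex.ofReal_mul]
  ring

lemma borelWeight_eq_one {μ₁ μ₂ μ₃ : Fˣ →ₜ* ℂˣ} (h₁ : IsUnramified μ₁) (h₃ : IsUnramified μ₃)
    {n : ℕ} (h₂ : ∀ x ∈ unitFiltration F n, μ₂ x = 1) {a₁ a₂ a₃ : Fˣ} {u : GL (Fin 3) F}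
    (hu : u ∈ unipGroup F) (h : torus a₁ a₂ a₃ * u ∈ levelGroup F n) :
    borelWeight μ₁ μ₂ μ₃ a₁ a₂ a₃ = 1 := by
  obtain ⟨x, y, z, rfl⟩ := hu
  obtain ⟨hA, hB⟩ := h
  rw [mul_inv_rev, unip_inv] at hB
  have e : (torus a₁ a₂ a₃)⁻¹ = torus a₁⁻¹ a₂⁻¹ a₃⁻¹ := by
    rw [inv_eq_iff_mul_eq_one]
    ext i j; fin_cases i <;> fin_cases j <;>
      simp [torus, Matrix.mul_apply, Fin.sum_univ_three]
  rw [e] at hB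
  simp [orderSet, torus, unip] at hA hB
  have v1 : val F (a₁ : F) = 1 := val_eq_one_of_mul_eq_one hA.1.1 hB.1.1 (by simp)
  have v3 : val F (a₃ : F) = 1 := val_eq_one_of_mul_eq_one hA.2.2.2 hB.2.2.2 (by simp)
  have m0 : ∀ t : F, t - 1 ∈ pPow F n → t ∈ pPow F 0 := fun t ht => by
    simpa using pPow_add_mem (pPow_mono (by omega) ht) (one_mem_pPow (F := F))
  have v2 : val F (a₂ : F) = 1 :=
    val_eq_one_of_mul_eq_one (m0 _ hA.2.1.2.1) (m0 _ hB.2.1.2.1) (by simp)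
  have key : ∀ t : Fˣ, val F (t : F) = 1 → t ∈ unitFiltration F 0 := fun t ht => by
    refine ⟨ht, ?_⟩
    have : val F ((t : F) - 1) ≤ max (val F (t : F)) (val F 1) := (val F).map_sub _ _
    simpa [pPow, ht] using this
  have v13 : val F ((a₁ / a₃ : Fˣ) : F) = 1 := by simp [v1, v3]
  simp [borelWeight, h₁ _ (key _ v1), h₃ _ (key _ v3), h₂ _ ⟨v2, hA.2.1.2.1⟩, absF_eq_one v13]

/-- The newform is well defined. -/
lemma newform_apply {μ₁ μ₂ μ₃ : Fˣ →ₜ* ℂˣ} (h₁ : IsUnramified μ₁) (h₃ : IsUnramified μ₃)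
    {n : ℕ} (h₂ : ∀ x ∈ unitFiltration F n, μ₂ x = 1) (a₁ a₂ a₃ : Fˣ) {u k : GL (Fin 3) F}
    (hu : u ∈ unipGroup F) (hk : k ∈ levelGroup F n) :
    newform μ₁ μ₂ μ₃ n (torus a₁ a₂ a₃ * u * k) = borelWeight μ₁ μ₂ μ₃ a₁ a₂ a₃ := by
  have hex : ∃ a : Fˣ × Fˣ × Fˣ, ∃ u' ∈ unipGroup F, ∃ k' ∈ levelGroup F n,
      torus a₁ a₂ a₃ * u * k = torus a.1 a.2.1 a.2.2 * u' * k' :=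
    ⟨(a₁, a₂, a₃), u, hu, k, hk, rfl⟩
  rw [newform, dif_pos hex]
  obtain ⟨u', hu', k', hk', e⟩ := hex.choose_spec
  generalize hex.choose = a at *
  obtain ⟨b₁, b₂, b₃⟩ := a
  simp only at e ⊢
  obtain ⟨x, y, z, rfl⟩ := hu
  obtain ⟨x', y', z', rfl⟩ := hu'
  have e2 : (torus a₁ a₂ a₃ * unip x y z)⁻¹ * (torus b₁ b₂ b₃ * unip x' y' z') = k * k'⁻¹ := by
    rw [inv_mul_eq_iff_eq_mul, ← mul_assoc, e, mul_inv_cancel_right]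
  have e3 : torus a₁ a₂ a₃ * unip x y z *
      (torus (b₁ / a₁) (b₂ / a₂) (b₃ / a₃) *
        unip (x' - x * (b₂ / a₂) / (b₁ / a₁)) (y' - y * (b₃ / a₃) / (b₂ / a₂))
          (z' - x * (b₂ / a₂) / (b₁ / a₁) * (y' - y * (b₃ / a₃) / (b₂ / a₂)) -
            z * (b₃ / a₃) / (b₁ / a₁))) =
      torus b₁ b₂ b₃ * unip x' y' z' := by
    ext i j; fin_cases i <;> fin_cases j <;>
      simp [torus, unip, Matrix.mul_apply, Fin.sum_univ_three] <;> field_simp <;> ring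
  have e4 : torus (b₁ / a₁) (b₂ / a₂) (b₃ / a₃) *
        unip (x' - x * (b₂ / a₂) / (b₁ / a₁)) (y' - y * (b₃ / a₃) / (b₂ / a₂))
          (z' - x * (b₂ / a₂) / (b₁ / a₁) * (y' - y * (b₃ / a₃) / (b₂ / a₂)) -
            z * (b₃ / a₃) / (b₁ / a₁)) ∈ levelGroup F n := by
    rw [← inv_mul_eq_iff_eq_mul.mpr e3.symm, e2]
    exact mul_mem hk (inv_mem hk')
  have := borelWeight_eq_one (μ₁ := μ₁) (μ₂ := μ₂) (μ₃ := μ₃) h₁ h₃ h₂ ⟨_, _, _, rfl⟩ e4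
  have e5 := borelWeight_mul μ₁ μ₂ μ₃ a₁ a₂ a₃ (b₁ / a₁) (b₂ / a₂) (b₃ / a₃)
  rw [this, mul_one] at e5
  simpa using e5

end WellDefined

end GLThree

/-! Put r = t₁/t₃. Everything rests on an explicit computation: for |a| = q⁻ᵐ and |b| = qⁿ, the
value W(diag(a,1,b)) is t₁^(c-n) t₃^(m-c) q^(-c-m-n) times (1 - r/q) times the sum of rⁱ over 0 ≤ i
≤ m + n (`whittaker_newform_torus`). Comparison with m = n = 0 gives the formula, and W(1) ≠ 0
amounts to t₁ ≠ q t₃, which irreducibility forces.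

Existence of the stable integral: far out in U₃ the function u ↦ f(w u g) is invariant under left
translation of u by a one-parameter element with coordinate t ∈ 𝔭⁻¹, where ψ(t) ≠ 1. Such regions
contribute 0, and what remains is bounded (`exists_unipIntegral_eq`). Hence W(g) is the integral
over any large box.

Computation: after right translation by diag(ϖᶜ,1,1) the newform does not distinguish the first and
third columns. It lives on a cell described by bottom row entries and bottom minors, or on that cell
with the two columns exchanged (`newform_of_inCell`, `inCell_or_of_newform_ne_zero`). The integral
is cut along |z|. On the ball 𝔭^(m+n-c) the integrand is constant on its support. On the shell |z| =
q^(c-m-n+j), j ≥ 1, it is μ₂(1 - xy/z) times a function of |1 - xy/z|. Ramification of μ₂ reduces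
the z-integral to two conditions on |xy| (`setIntegral_shell_ramified`). The integrals over x and y
(`setIntegral_hyperbola`) then show that, relative to the ball, the shell contributes rʲ(1 - 1/q)
for j ≤ m + n, -rʲ/q for j = m + n + 1, and 0 beyond. These add up by `geom_telescope`.

Nonvanishing: if t₁ = q t₃, then μ₁ = μ₃|·|⁻¹. The intertwining integral for the second simple
reflection sends functions of I(μ₁,μ₂,μ₃) to functions that transform as in I(μ₁,μ₃,μ₂), where the
first GL₂ block has a one-dimensional subrepresentation through the determinant. The functions whose
integral is left invariant under the first simple reflection form a subrepresentation
(`midInvariants`). The newform of level c lies in it, the analogous function of level c + 1 does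
not, and so I(μ) is reducible (`not_isIrreducible_of_eq`). -/

namespace GLThree

/-! ### The valuation, the topology of F, and conductors -/

section Valuation

open WithZero Topology

variable {F : Type*} [Field F] [ValuativeRel F] [TopologicalSpace F] [IsNonarchimedeanLocalField F]

lemma mem_pPow {k : ℤ} {x : F} : x ∈ pPow F k ↔ val F x ≤ exp (-k) := Iff.rfl

lemma exists_val_eq_exp {x : F} (hx : x ≠ 0) : ∃ k : ℤ, val F x = exp k :=
  ⟨log (val F x), (exp_log ((val F).ne_zero_iff.mpr hx)).symm⟩

lemma val_eq (x : F) :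
    val F x = IsNonarchimedeanLocalField.valueGroupWithZeroIsoInt F (valuation F x) := rfl

lemma exists_unit_val (k : ℤ) : ∃ x : Fˣ, val F (x : F) = exp k := by
  obtain ⟨y, hy⟩ := (IsNonarchimedeanLocalField.valueGroupWithZeroIsoInt F).surjective (exp k)
  obtain ⟨x, rfl⟩ := ValuativeRel.valuation_surjective y
  have hx : x ≠ 0 := by
    rintro rfl
    rw [map_zero, map_zero] at hy
    exact exp_ne_zero hy.symm
  exact ⟨Units.mk0 x hx, hy⟩

lemma mem_integer_iff {x : F} : x ∈ 𝒪[F] ↔ val F x ≤ 1 := by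
  rw [val_eq, ← map_one (IsNonarchimedeanLocalField.valueGroupWithZeroIsoInt F),
    (IsNonarchimedeanLocalField.valueGroupWithZeroIsoInt F).strictMono.le_iff_le]
  rfl

lemma mem_maximalIdeal_iff {x : 𝒪[F]} : x ∈ 𝓂[F] ↔ val F (x : F) < 1 := by
  rw [IsLocalRing.mem_maximalIdeal, mem_nonunits_iff]
  rw [not_iff_comm, not_lt]
  constructor
  · intro h
    have hx : (x : F) ≠ 0 := by
      intro h0; simp [h0] at h
    have hx' : (x : F)⁻¹ ∈ 𝒪[F] := by
      rw [mem_integer_iff, map_inv₀]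
      exact inv_le_one_of_one_le₀ h
    exact IsUnit.of_mul_eq_one (⟨(x : F)⁻¹, hx'⟩ : 𝒪[F]) (Subtype.ext (mul_inv_cancel₀ hx))
  · rintro ⟨u, rfl⟩
    have h1 : val F ((u : 𝒪[F]) : F) * val F (((u⁻¹ : 𝒪[F]ˣ) : 𝒪[F]) : F) = 1 := by
      rw [← map_mul, ← Subring.coe_mul]; simp
    have h2 := mem_integer_iff.mp (((u⁻¹ : 𝒪[F]ˣ) : 𝒪[F])).2
    calc (1 : WithZero (Multiplicative ℤ)) = _ := h1.symm
      _ ≤ val F ((u : 𝒪[F]) : F) * 1 := by gcongr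
      _ = _ := mul_one _

/-- An element of value exp(-1) lies in 𝔭, hence is a multiple of ϖ and no larger than ϖ; since |ϖ|
< 1, only one value is left. -/
lemma val_uniformizer {ϖ : Fˣ} (hϖ : IsUniformizer ϖ) : val F (ϖ : F) = exp (-1) := by
  obtain ⟨h, hs⟩ := hϖ
  have h1 : val F (ϖ : F) < 1 := by
    have := mem_maximalIdeal_iff (x := (⟨(ϖ : F), h⟩ : 𝒪[F]))
    rw [← hs] at this
    exact this.mp (Ideal.subset_span rfl)
  obtain ⟨k, hk⟩ := exists_val_eq_exp ϖ.ne_zero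
  obtain ⟨y, hy⟩ := exists_unit_val (F := F) (-1)
  have hy1 : val F (y : F) < 1 := by
    rw [hy, ← exp_zero, exp_lt_exp]; omega
  have hym : (⟨(y : F), mem_integer_iff.mpr hy1.le⟩ : 𝒪[F]) ∈ 𝓂[F] := mem_maximalIdeal_iff.mpr hy1
  rw [← hs, Ideal.mem_span_singleton] at hym
  obtain ⟨z, hz⟩ := hym
  have hz' : (y : F) = ϖ * z := congrArg Subtype.val hz
  have h3 : val F (y : F) ≤ val F (ϖ : F) := by
    rw [hz', map_mul]
    calc _ ≤ val F (ϖ : F) * 1 := by gcongr; exact mem_integer_iff.mp z.2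
      _ = _ := mul_one _
  rw [hk, ← exp_zero, exp_lt_exp] at h1
  rw [hy, hk, exp_le_exp] at h3
  rw [hk]; congr 1; omega

/-- `𝔭ᵏ` as an additive subgroup. -/
def pSubgroup (F : Type*) [Field F] [ValuativeRel F] [TopologicalSpace F]
    [IsNonarchimedeanLocalField F] (k : ℤ) : AddSubgroup F where
  carrier := pPow F k
  add_mem' := pPow_add_mem
  zero_mem' := zero_mem_pPow k
  neg_mem' {x} hx := by simpa [pPow] using hx

lemma pPow_neg_mem {k : ℤ} {x : F} (hx : x ∈ pPow F k) : -x ∈ pPow F k :=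
  (pSubgroup F k).neg_mem hx

lemma pPow_sub_mem {k : ℤ} {x y : F} (hx : x ∈ pPow F k) (hy : y ∈ pPow F k) :
    x - y ∈ pPow F k :=
  (pSubgroup F k).sub_mem hx hy

lemma exists_pPow_subset {U : Set F} (hU : U ∈ 𝓝 (0 : F)) : ∃ n : ℕ, pPow F n ⊆ U := by
  obtain ⟨γ, hγ, h⟩ := (IsValuativeTopology.hasBasis_nhds_zero' F).mem_iff.mp hU
  set g := IsNonarchimedeanLocalField.valueGroupWithZeroIsoInt F γ with hg
  have hg0 : g ≠ 0 := by simpa [hg] using hγ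
  refine ⟨(1 - log g).toNat, fun x hx => h ?_⟩
  change valuation F x < γ
  rw [← (IsNonarchimedeanLocalField.valueGroupWithZeroIsoInt F).strictMono.lt_iff_lt]
  refine lt_of_le_of_lt hx ?_
  rw [← hg]
  conv_rhs => rw [← exp_log hg0]
  rw [exp_lt_exp]
  omega

lemma pPow_mem_nhds_zero (k : ℤ) : pPow F k ∈ 𝓝 (0 : F) := by
  refine (IsValuativeTopology.hasBasis_nhds_zero' F).mem_iff.mpr
    ⟨(IsNonarchimedeanLocalField.valueGroupWithZeroIsoInt F).symm (exp (-k)), by simp, ?_⟩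
  intro x hx
  rw [Set.mem_ofPred_eq,
    ← (IsNonarchimedeanLocalField.valueGroupWithZeroIsoInt F).strictMono.lt_iff_lt] at hx
  rw [mem_pPow]
  refine le_trans hx.le ?_
  simp

lemma isOpen_pPow (k : ℤ) : IsOpen (pPow F k) :=
  (pSubgroup F k).isOpen_of_mem_nhds (g := 0) (pPow_mem_nhds_zero k)

lemma isClosed_pPow (k : ℤ) : IsClosed (pPow F k) :=
  (pSubgroup F k).isClosed_of_isOpen (isOpen_pPow k)

lemma isCompact_pPow (k : ℤ) : IsCompact (pPow F k) := by
  have := IsNonarchimedeanLocalField.isCompact_closedBall F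
    ((IsNonarchimedeanLocalField.valueGroupWithZeroIsoInt F).symm (exp (-k)))
  convert this using 1
  ext x
  rw [Set.mem_ofPred_eq, mem_pPow, val_eq,
    ← (IsNonarchimedeanLocalField.valueGroupWithZeroIsoInt F).strictMono.le_iff_le]
  simp

lemma exists_mem_pPow (x : F) : ∃ n : ℕ, x ∈ pPow F (-n) := by
  by_cases hx : x = 0
  · exact ⟨0, hx ▸ zero_mem_pPow _⟩
  · obtain ⟨k, hk⟩ := exists_val_eq_exp hx
    refine ⟨k.toNat, ?_⟩
    rw [mem_pPow, hk, exp_le_exp]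
    omega

/-- The balls 𝔭ⁿ give a countable basis at 0 and the compact balls 𝔭⁻ⁿ cover F. This is what makes
the Borel structures on products of copies of F compatible. -/
lemma secondCountableTopology : SecondCountableTopology F := by
  let := IsTopologicalAddGroup.rightUniformSpace F
  have := isUniformAddGroup_of_addCommGroup (G := F)
  have hb : (𝓝 (0 : F)).HasBasis (fun _ : ℕ => True) (fun n => pPow F n) := by
    refine ⟨fun U => ⟨fun h => ?_, ?_⟩⟩
    · obtain ⟨n, hn⟩ := exists_pPow_subset h
      exact ⟨n, trivial, hn⟩
    · rintro ⟨n, -, hn⟩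
      exact mem_of_superset (pPow_mem_nhds_zero _) hn
  have : (𝓝 (0 : F)).IsCountablyGenerated := hb.isCountablyGenerated
  have := IsUniformAddGroup.uniformity_countably_generated (α := F)
  have : SigmaCompactSpace F := ⟨⟨fun n : ℕ => pPow F (-n), fun n => isCompact_pPow _, by
    ext x; simpa using exists_mem_pPow x⟩⟩
  infer_instance

lemma isClosed_singleton_zero : IsClosed ({0} : Set F) := by
  have : ({0} : Set F) = ⋂ n : ℕ, pPow F n := by
    ext x
    simp only [Set.mem_singleton_iff, Set.mem_iInter]
    refine ⟨fun h n => h ▸ zero_mem_pPow _, fun h => ?_⟩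
    by_contra hx
    obtain ⟨k, hk⟩ := exists_val_eq_exp hx
    have := h (1 - k).toNat
    rw [mem_pPow, hk, exp_le_exp] at this
    omega
  rw [this]
  exact isClosed_iInter fun n => isClosed_pPow _

lemma t2Space : T2Space F := by
  have : T1Space F := by
    refine ⟨fun x => ?_⟩
    have := isClosed_singleton_zero.preimage (f := fun y : F => y - x) (by fun_prop)
    convert this using 1
    ext y; simp [sub_eq_zero]
  infer_instance

lemma resCard_pos : 0 < resCard F := by
  have : Nonempty 𝓀[F] := ⟨0⟩
  exact Nat.card_pos

/-- No small subgroups: as long as w is within 1/2 of 1 one has |w + 1| ≥ 3/2, so squaring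
multiplies the distance to 1 by at least 3/2. -/
lemma eq_one_of_pow_near_one {z : ℂ} (h : ∀ n : ℕ, ‖z ^ n - 1‖ < 1 / 2) : z = 1 := by
  by_contra hz
  have hpos : 0 < ‖z - 1‖ := norm_pos_iff.mpr (sub_ne_zero.mpr hz)
  have growth : ∀ j : ℕ, (3 / 2 : ℝ) ^ j * ‖z - 1‖ ≤ ‖z ^ 2 ^ j - 1‖ := by
    intro j
    induction j with
    | zero => simp
    | succ j ih =>
      set w := z ^ 2 ^ j with hw
      have e : z ^ 2 ^ (j + 1) - 1 = (w + 1) * (w - 1) := by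
        rw [pow_succ 2 j, pow_mul, ← hw]; ring
      have h2 : (3 / 2 : ℝ) ≤ ‖w + 1‖ := by
        have h3 : ‖(2 : ℂ)‖ ≤ ‖w + 1‖ + ‖w - 1‖ := by
          calc ‖(2 : ℂ)‖ = ‖(w + 1) - (w - 1)‖ := by ring_nf
            _ ≤ _ := norm_sub_le _ _
        have h4 := h (2 ^ j)
        rw [← hw] at h4
        simp at h3
        linarith
      rw [e, norm_mul, pow_succ]
      calc (3 / 2 : ℝ) ^ j * (3 / 2) * ‖z - 1‖ = (3 / 2) * ((3 / 2) ^ j * ‖z - 1‖) := by ring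
        _ ≤ ‖w + 1‖ * ‖w - 1‖ := by gcongr
  obtain ⟨j, hj⟩ := pow_unbounded_of_one_lt (1 / ‖z - 1‖) (by norm_num : (1 : ℝ) < 3 / 2)
  have := (growth j).trans_lt (h (2 ^ j))
  rw [div_lt_iff₀ hpos] at hj
  linarith

lemma pow_mem_unitFiltration {n : ℕ} {x : Fˣ} (hx : x ∈ unitFiltration F n) (k : ℕ) :
    x ^ k ∈ unitFiltration F n := by
  refine ⟨by simp [hx.1], ?_⟩
  rw [Units.val_pow_eq_pow_val, ← mul_geom_sum]
  refine pPow_mul_mem (j := 0) (by omega) hx.2 ?_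
  refine (pSubgroup F 0).sum_mem fun i _ => ?_
  change _ ∈ pPow F 0
  simp [mem_pPow, hx.1]

/-- By continuity some step of the filtration is sent into the disc of radius 1/2 about 1, and that
step is closed under powers. Hence the `sInf` in `conductor` is attained and is not the default
value of an empty set. -/
lemma exists_trivial_unitFiltration (χ : Fˣ →ₜ* ℂˣ) :
    ∃ n : ℕ, ∀ x ∈ unitFiltration F n, χ x = 1 := by
  have hc : Continuous fun x : Fˣ => (χ x : ℂ) := Units.continuous_val.comp χ.continuous
  have hU : (fun x : Fˣ => (χ x : ℂ)) ⁻¹' Metric.ball 1 (1 / 2) ∈ 𝓝 (1 : Fˣ) :=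
    hc.continuousAt.preimage_mem_nhds (by simpa using Metric.ball_mem_nhds (1 : ℂ) (by norm_num : (0 : ℝ) < 1 / 2))
  rw [Units.isEmbedding_val₀.isInducing.nhds_eq_comap, mem_comap] at hU
  obtain ⟨V, hV, hVU⟩ := hU
  have hV' : (fun y : F => y + 1) ⁻¹' V ∈ 𝓝 (0 : F) := by
    refine (show Continuous fun y : F => y + 1 by fun_prop).continuousAt.preimage_mem_nhds ?_
    simpa using hV
  obtain ⟨n, hn⟩ := exists_pPow_subset hV'
  refine ⟨n, fun x hx => ?_⟩
  ext
  refine eq_one_of_pow_near_one fun k => ?_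
  have h1 := pow_mem_unitFiltration hx k
  have h2 : ((x ^ k : Fˣ) : F) ∈ V := by simpa using hn h1.2
  have h3 := hVU h2
  simpa [dist_eq_norm] using h3

lemma conductor_spec (χ : Fˣ →ₜ* ℂˣ) : ∀ x ∈ unitFiltration F (conductor χ), χ x = 1 :=
  Nat.sInf_mem (exists_trivial_unitFiltration χ)

lemma exists_ne_one_of_lt_conductor {χ : Fˣ →ₜ* ℂˣ} {n : ℕ} (h : n < conductor χ) :
    ∃ x ∈ unitFiltration F n, χ x ≠ 1 := by
  have := Nat.notMem_of_lt_sInf h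
  simpa using this

lemma unitFiltration_anti {m n : ℕ} (h : m ≤ n) : unitFiltration F n ⊆ unitFiltration F m :=
  fun _ hx => ⟨hx.1, pPow_mono (by exact_mod_cast h) hx.2⟩

lemma mem_unitFiltration_zero {x : Fˣ} (h : val F (x : F) = 1) : x ∈ unitFiltration F 0 :=
  ⟨h, pPow_sub_mem (by simp [mem_pPow, h]) (by simpa using one_mem_pPow)⟩

lemma conductor_pos {χ : Fˣ →ₜ* ℂˣ} (h : ¬ IsUnramified χ) : 0 < conductor χ := by
  rw [Nat.pos_iff_ne_zero]
  intro h0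
  have := conductor_spec χ
  rw [h0] at this
  exact h this

lemma unramified_apply {χ : Fˣ →ₜ* ℂˣ} (h : IsUnramified χ) {x : Fˣ}
    (hx : val F (x : F) = 1) : χ x = 1 := h x (mem_unitFiltration_zero hx)

lemma unramified_apply_eq {χ : Fˣ →ₜ* ℂˣ} (h : IsUnramified χ) {x y : Fˣ}
    (hx : val F (x : F) = val F (y : F)) : χ x = χ y := by
  have : χ (x / y) = 1 := unramified_apply h (by
    rw [Units.val_div_eq_div_val, map_div₀, hx, div_self]
    simp)
  rwa [map_div, div_eq_one] at this

lemma unramified_apply_exp {χ : Fˣ →ₜ* ℂˣ} (h : IsUnramified χ) {ϖ : Fˣ} (hϖ : IsUniformizer ϖ)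
    {x : Fˣ} {k : ℤ} (hx : val F (x : F) = exp k) : χ x = χ ϖ ^ (-k) := by
  rw [← map_zpow]
  refine unramified_apply_eq h ?_
  rw [hx, Units.val_zpow_eq_zpow_val, map_zpow₀, val_uniformizer hϖ, ← exp_zsmul]
  simp

end Valuation

end GLThree

namespace GLThree

/-! ### Haar measure on F: balls, shells, scaling, and vanishing integrals -/

section Measure

open WithZero Topology

variable {F : Type*} [Field F] [ValuativeRel F] [TopologicalSpace F] [IsNonarchimedeanLocalField F]

/-- The elements of absolute value `q ^ s`. -/
def shell (F : Type*) [Field F] [ValuativeRel F] [TopologicalSpace F]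
    [IsNonarchimedeanLocalField F] (s : ℤ) : Set F := {x | val F x = exp s}

lemma mem_shell {s : ℤ} {x : F} : x ∈ shell F s ↔ val F x = exp s := Iff.rfl

lemma ne_zero_of_mem_shell {s : ℤ} {x : F} (hx : x ∈ shell F s) : x ≠ 0 := by
  rintro rfl
  rw [mem_shell, map_zero] at hx
  exact exp_ne_zero hx.symm

lemma lt_exp_iff {a : WithZero (Multiplicative ℤ)} {k : ℤ} : a < exp k ↔ a ≤ exp (k - 1) := by
  by_cases ha : a = 0
  · simp [ha]
  · rw [← exp_log ha, exp_lt_exp, exp_le_exp]; omega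

lemma shell_eq (s : ℤ) : shell F s = pPow F (-s) \ pPow F (-s + 1) := by
  ext x
  rw [mem_shell, Set.mem_sdiff, mem_pPow, mem_pPow, neg_neg, show -(-s + 1) = s - 1 by ring,
    ← lt_exp_iff, not_lt]
  exact ⟨fun h => ⟨h.le, h.ge⟩, fun h => le_antisymm h.1 h.2⟩

lemma isOpen_shell (s : ℤ) : IsOpen (shell F s) := by
  rw [shell_eq]; exact (isOpen_pPow _).sdiff (isClosed_pPow _)

lemma isCompact_shell (s : ℤ) : IsCompact (shell F s) := by
  rw [shell_eq]; exact (isCompact_pPow _).diff (isOpen_pPow _)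

lemma absF_eq_zpow {a : Fˣ} {k : ℤ} (h : val F (a : F) = exp k) :
    absF a = (resCard F : ℝ) ^ k := by
  rw [absF, h, log_exp]

lemma resCard_ne_zero : (resCard F : ℝ) ≠ 0 := by exact_mod_cast resCard_pos.ne'

lemma absF_pos (a : Fˣ) : 0 < absF a := by
  have : (0 : ℝ) < resCard F := by exact_mod_cast resCard_pos
  exact zpow_pos this _

lemma absF_inv (a : Fˣ) : absF a⁻¹ = (absF a)⁻¹ := by
  refine eq_inv_of_mul_eq_one_left ?_
  rw [← absF_mul]
  simp [absF]

lemma smul_mem_pPow_iff {a : Fˣ} {s k : ℤ} (ha : val F (a : F) = exp s) {x : F} :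
    (a : F) * x ∈ pPow F (k - s) ↔ x ∈ pPow F k := by
  rw [mem_pPow, mem_pPow, map_mul, ha, show -(k - s) = s + -k by ring, exp_add]
  exact mul_le_mul_iff_right₀ (by simp [zero_lt_iff])

lemma smul_mem_shell_iff {a : Fˣ} {s k : ℤ} (ha : val F (a : F) = exp s) {x : F} :
    (a : F) * x ∈ shell F (k + s) ↔ x ∈ shell F k := by
  rw [mem_shell, mem_shell, map_mul, ha, add_comm k s, exp_add]
  exact mul_right_inj' exp_ne_zero

lemma add_mem_pPow_iff {k : ℤ} {b : F} (hb : b ∈ pPow F k) {x : F} :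
    x + b ∈ pPow F k ↔ x ∈ pPow F k :=
  (pSubgroup F k).add_mem_cancel_right hb

variable [MeasurableSpace F]

lemma measure_pPow_lt_top (dx : Measure F) [dx.IsAddHaarMeasure] (k : ℤ) :
    dx (pPow F k) < ⊤ := (isCompact_pPow k).measure_lt_top

variable [BorelSpace F]

lemma measurableSet_pPow (k : ℤ) : MeasurableSet (pPow F k) := (isOpen_pPow k).measurableSet

lemma measurableSet_shell (k : ℤ) : MeasurableSet (shell F k) := (isOpen_shell k).measurableSet

variable (dx : Measure F) [dx.IsAddHaarMeasure]

/-- The ball 𝔭ᵏ is the disjoint union of q translates of 𝔭ᵏ⁺¹, one for each residue class after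
scaling by a generator `a` of 𝔭ᵏ. -/
lemma measure_pPow_succ (k : ℤ) :
    dx (pPow F k) = resCard F * dx (pPow F (k + 1)) := by
  obtain ⟨a, ha⟩ := exists_unit_val (F := F) (-k)
  have hfin : Finite 𝓀[F] := inferInstance
  have := Fintype.ofFinite 𝓀[F]
  let rep : 𝓀[F] → F := fun c => a * ((Ideal.Quotient.mk_surjective c).choose : F)
  have hrep : ∀ c, ∃ y : 𝒪[F], Ideal.Quotient.mk 𝓂[F] y = c ∧ rep c = a * (y : F) := fun c =>
    ⟨_, (Ideal.Quotient.mk_surjective c).choose_spec, rfl⟩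
  have hU : pPow F k = ⋃ c : 𝓀[F], (fun x => -rep c + x) ⁻¹' pPow F (k + 1) := by
    ext x
    simp only [Set.mem_iUnion, Set.mem_preimage]
    constructor
    · intro hx
      have hx' : (a : F)⁻¹ * x ∈ 𝒪[F] := by
        rw [mem_integer_iff, map_mul, map_inv₀, ha, ← exp_neg, neg_neg]
        calc _ ≤ exp k * exp (-k) := by gcongr; exact hx
          _ = 1 := by rw [← exp_add]; simp
      obtain ⟨y, hy, hy'⟩ := hrep (Ideal.Quotient.mk 𝓂[F] ⟨_, hx'⟩)
      refine ⟨Ideal.Quotient.mk 𝓂[F] ⟨_, hx'⟩, ?_⟩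
      rw [Ideal.Quotient.eq, mem_maximalIdeal_iff, ← exp_zero, lt_exp_iff] at hy
      rw [hy']
      have h2 := (smul_mem_pPow_iff (k := 1) ha (x := (y : F) - (a : F)⁻¹ * x)).mpr hy
      have h3 := pPow_neg_mem h2
      rw [mul_sub, mul_inv_cancel_left₀ a.ne_zero] at h3
      rw [show k + 1 = 1 - -k by ring]
      convert h3 using 1
      ring
    · rintro ⟨c, hc⟩
      obtain ⟨y, -, hy'⟩ := hrep c
      have h1 : rep c ∈ pPow F k := by
        rw [hy']
        refine pPow_mul_mem (j := 0) (i := k) (by omega) ha.le ?_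
        simpa [mem_pPow] using mem_integer_iff.mp y.2
      simpa using pPow_add_mem (pPow_mono (by omega) hc) h1
  have hd : Pairwise (Function.onFun Disjoint
      fun c : 𝓀[F] => (fun x => -rep c + x) ⁻¹' pPow F (k + 1)) := by
    intro c d hcd
    rw [Function.onFun, Set.disjoint_left]
    intro x hx hx'
    obtain ⟨y, hy, hy'⟩ := hrep c
    obtain ⟨z, hz, hz'⟩ := hrep d
    apply hcd
    rw [← hy, ← hz]
    refine Ideal.Quotient.eq.mpr ?_
    rw [mem_maximalIdeal_iff, ← exp_zero, lt_exp_iff]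
    have h1 := pPow_sub_mem hx' hx
    rw [hy', hz', show -(a * (z : F)) + x - (-(a * (y : F)) + x) = a * ((y : F) - z) by ring,
      show k + 1 = 1 - -k by ring, smul_mem_pPow_iff ha] at h1
    exact h1
  rw [hU, measure_iUnion hd fun c => ((isOpen_pPow _).preimage (by fun_prop)).measurableSet]
  simp [measure_preimage_add, tsum_fintype, resCard, Nat.card_eq_fintype_card]

lemma real_pPow_eq (k : ℤ) :
    dx.real (pPow F k) = (resCard F : ℝ) ^ (-k) * dx.real (pPow F 0) := by
  have step : ∀ k : ℤ, dx.real (pPow F k) = resCard F * dx.real (pPow F (k + 1)) := fun k => by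
    simp [Measure.real, measure_pPow_succ dx k]
  induction k using Int.induction_on with
  | zero => simp
  | succ i ih =>
    rw [step, ← eq_inv_mul_iff_mul_eq₀ resCard_ne_zero] at ih
    rw [ih, neg_add, zpow_add₀ resCard_ne_zero]
    simp [mul_comm, mul_assoc]
  | pred i ih =>
    rw [step, sub_add_cancel, ih, neg_sub, sub_neg_eq_add, zpow_add₀ resCard_ne_zero]
    simp [mul_assoc]

variable {dx} in
lemma real_pPow (hdx : dx (pPow F 0) = 1) (k : ℤ) :
    dx.real (pPow F k) = (resCard F : ℝ) ^ (-k) := by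
  rw [real_pPow_eq]
  simp [Measure.real, hdx]

variable {dx} in
lemma real_shell (hdx : dx (pPow F 0) = 1) (k : ℤ) :
    dx.real (shell F k) = (resCard F : ℝ) ^ k * (1 - (resCard F : ℝ)⁻¹) := by
  rw [shell_eq, measureReal_sdiff (fun x hx => pPow_mono (by omega) hx) (measurableSet_pPow _)
    (measure_pPow_lt_top _ _).ne, real_pPow hdx, real_pPow hdx,
    show -(-k + 1) = k + -1 by ring, zpow_add₀ resCard_ne_zero]
  simp; ring

/-- Uniqueness of Haar measure leaves one scalar to find, and it is read off on 𝔬, whose preimage is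
a ball of known volume. -/
lemma map_mul_left_eq (a : Fˣ) :
    dx.map (fun x => (a : F) * x) = ENNReal.ofReal (absF a)⁻¹ • dx := by
  have := secondCountableTopology (F := F)
  have := t2Space (F := F)
  have hHaar : (dx.map (fun x => (a : F) * x)).IsAddHaarMeasure :=
    (ContinuousAddEquiv.mk (AddEquiv.mk' (Homeomorph.mulLeft₀ (a : F) a.ne_zero).toEquiv
      fun x y => mul_add (a : F) x y) (Homeomorph.mulLeft₀ (a : F) a.ne_zero).continuous
      (Homeomorph.mulLeft₀ (a : F) a.ne_zero).symm.continuous).isAddHaarMeasure_map dx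
  have h1 := Measure.isAddLeftInvariant_eq_smul (dx.map (fun x => (a : F) * x)) dx
  obtain ⟨s, hs⟩ := exists_val_eq_exp a.ne_zero
  set c := Measure.addHaarScalarFactor (dx.map (fun x => (a : F) * x)) dx
  have h2 : (dx.map (fun x => (a : F) * x)) (pPow F 0) = c * dx (pPow F 0) := by
    rw [h1]; rfl
  have h3 : (fun x => (a : F) * x) ⁻¹' pPow F 0 = pPow F s := by
    ext x
    have := smul_mem_pPow_iff (k := s) hs (x := x)
    rwa [sub_self] at this
  rw [Measure.map_apply (by fun_prop) (measurableSet_pPow 0), h3] at h2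
  have h4 : dx.real (pPow F s) = c * dx.real (pPow F 0) := by
    simp [Measure.real, h2]
  have hpos : 0 < dx.real (pPow F 0) :=
    ENNReal.toReal_pos ((isOpen_pPow 0).measure_pos dx ⟨0, zero_mem_pPow 0⟩).ne'
      (measure_pPow_lt_top dx 0).ne
  rw [real_pPow_eq, mul_left_inj' hpos.ne'] at h4
  rw [h1, absF_eq_zpow hs, ← zpow_neg, h4, ENNReal.ofReal_coe_nnreal]
  rfl

lemma measurableEmbedding_mul_left (a : Fˣ) : MeasurableEmbedding fun x : F => (a : F) * x :=
  (Homeomorph.mulLeft₀ (a : F) a.ne_zero).measurableEmbedding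

lemma setIntegral_mul_left (a : Fˣ) {S T : Set F} (h : ∀ x, (a : F) * x ∈ T ↔ x ∈ S)
    (φ : F → ℂ) : ∫ x in S, φ (a * x) ∂dx = ((absF a)⁻¹ : ℝ) * ∫ x in T, φ x ∂dx := by
  have h1 := (measurableEmbedding_mul_left a).setIntegral_map (μ := dx) φ T
  have h2 : (fun x => (a : F) * x) ⁻¹' T = S := by ext x; exact h x
  rw [h2] at h1
  rw [← h1, map_mul_left_eq, Measure.restrict_smul, integral_smul_measure,
    ENNReal.toReal_ofReal (inv_nonneg.mpr (absF_pos a).le)]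
  simp

lemma setIntegral_add_right (b : F) {S T : Set F} (h : ∀ x, x + b ∈ T ↔ x ∈ S)
    (φ : F → ℂ) : ∫ x in S, φ (x + b) ∂dx = ∫ x in T, φ x ∂dx := by
  have h1 := (measurePreserving_add_right dx b).setIntegral_preimage_emb
    (measurableEmbedding_addRight b) φ T
  have h2 : (fun x => x + b) ⁻¹' T = S := by ext x; exact h x
  rwa [h2] at h1

/-- An integral vanishes when its integrand is an eigenfunction, with eigenvalue `≠ 1`, for a
measure preserving transformation of the domain. -/
lemma setIntegral_eq_zero_of_eigen {α : Type*} [MeasurableSpace α] {μ : Measure α} {T : α → α}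
    (hT : MeasurePreserving T μ μ) (hT' : MeasurableEmbedding T) {S : Set α}
    (hS : MeasurableSet S) (h : ∀ x, T x ∈ S ↔ x ∈ S) {φ : α → ℂ} {c : ℂ} (hc : c ≠ 1)
    (hφ : ∀ x ∈ S, φ (T x) = c * φ x) : ∫ x in S, φ x ∂μ = 0 := by
  have h1 := hT.setIntegral_preimage_emb hT' φ S
  have h2 : T ⁻¹' S = S := by ext x; exact h x
  rw [h2, setIntegral_congr_fun hS hφ, integral_const_mul] at h1
  have h3 : (c - 1) * ∫ x in S, φ x ∂μ = 0 := by rw [sub_mul, h1]; ring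
  exact (mul_eq_zero.mp h3).resolve_left (sub_ne_zero.mpr hc)

lemma measurePreserving_mul_left {a : Fˣ} (ha : val F (a : F) = 1) :
    MeasurePreserving (fun x => (a : F) * x) dx dx := by
  refine ⟨by fun_prop, ?_⟩
  rw [map_mul_left_eq, absF_eq_one ha]
  simp

variable {dx} in
-- For k < 0 the ball contains, and is preserved by translation by, a point of 𝔭⁻¹ at which ψ is not
-- 1.
lemma setIntegral_addChar_inv (hdx : dx (pPow F 0) = 1) {ψ : AddChar F Circle}
    (hψ : IsUnramifiedAddChar ψ) (k : ℤ) :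
    ∫ x in pPow F k, ((ψ x : Circle) : ℂ)⁻¹ ∂dx = if 0 ≤ k then (resCard F : ℂ) ^ (-k) else 0 := by
  split_ifs with hk
  · rw [setIntegral_congr_fun (g := fun _ => (1 : ℂ)) (measurableSet_pPow k)
      fun x hx => by simp [hψ.1 x (pPow_mono hk hx)]]
    rw [setIntegral_const, real_pPow hdx]
    simp
  · obtain ⟨x₀, hx₀, hne⟩ := hψ.2
    have hx₀' : x₀ ∈ pPow F k := pPow_mono (by omega) hx₀
    refine setIntegral_eq_zero_of_eigen (T := fun x => x + x₀) (c := ((ψ x₀ : Circle) : ℂ)⁻¹)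
      (measurePreserving_add_right dx x₀) (measurableEmbedding_addRight x₀)
      (measurableSet_pPow k) (fun x => add_mem_pPow_iff hx₀') ?_ ?_
    · intro h
      rw [inv_eq_one] at h
      exact hne (Circle.ext (by simpa using h))
    · intro x _
      simp [AddChar.map_add_eq_mul]

/-- The substitution `w = p / z` between shells. -/
lemma setIntegral_shell_div {g : F → ℂ} {s l : ℤ} (hg : ContinuousOn g (shell F l)) {p : F}
    (hp : val F p = exp (s + l)) :
    ∫ z in shell F s, g (p / z) ∂dx =
      (resCard F : ℂ) ^ (s - l) * ∫ w in shell F l, g w ∂dx := by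
  have := secondCountableTopology (F := F)
  have := t2Space (F := F)
  have hp0 : p ≠ 0 := ne_zero_of_mem_shell hp
  set V : ℝ := dx.real (shell F 0) with hV
  have hVpos : V ≠ 0 := by
    have h1 : (1 : F) ∈ shell F 0 := by simp [mem_shell]
    exact (ENNReal.toReal_pos ((isOpen_shell 0).measure_pos dx ⟨1, h1⟩).ne'
      (isCompact_shell 0).measure_lt_top.ne).ne'
  -- The double integral of g(pu/z) over z in the shell and over units u is evaluated in both
  -- orders. Rescaling u makes the inner integral independent of z, and rescaling z makes the other
  -- one independent of u. Thus only multiplications, not the inversion itself, have to be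
  -- understood for the measure.
  have key : ∀ z ∈ shell F s, ∫ u in shell F 0, g (p * u / z) ∂dx =
      (resCard F : ℂ) ^ (-l) * ∫ w in shell F l, g w ∂dx := by
    intro z hz
    have hz0 := ne_zero_of_mem_shell hz
    have hv : val F ((Units.mk0 (p / z) (div_ne_zero hp0 hz0) : Fˣ) : F) = exp l := by
      rw [Units.val_mk0, map_div₀, hp, hz, exp_add, mul_div_cancel_left₀ _ exp_ne_zero]
    have h1 := setIntegral_mul_left dx (Units.mk0 (p / z) (div_ne_zero hp0 hz0))
      (S := shell F 0) (T := shell F l)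
      (fun x => by simpa using smul_mem_shell_iff (k := 0) hv (x := x)) g
    rw [absF_eq_zpow hv] at h1
    simp only [Units.val_mk0, div_mul_eq_mul_div] at h1
    rw [h1, zpow_neg]
    push_cast
    rfl
  have key2 : ∀ u ∈ shell F 0, ∫ z in shell F s, g (p * u / z) ∂dx =
      ∫ z in shell F s, g (p / z) ∂dx := by
    intro u hu
    have hu0 := ne_zero_of_mem_shell hu
    have hv : val F (((Units.mk0 u hu0)⁻¹ : Fˣ) : F) = exp 0 := by
      simp only [Units.val_inv_eq_inv_val, Units.val_mk0, map_inv₀, hu.out]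
      simp
    have h1 := setIntegral_mul_left dx (Units.mk0 u hu0)⁻¹
      (S := shell F s) (T := shell F s)
      (fun x => by simpa using smul_mem_shell_iff (k := s) hv (x := x)) (fun z => g (p / z))
    rw [absF_eq_zpow hv] at h1
    simp only [zpow_zero, inv_one, Complex.ofReal_one, one_mul] at h1
    rw [← h1]
    congr 1
    ext z
    congr 1
    simp only [Units.val_inv_eq_inv_val, Units.val_mk0]
    by_cases hz : z = 0
    · simp [hz]
    · field_simp
  have hint : Integrable (Function.uncurry fun z u => g (p * u / z))
      ((dx.restrict (shell F s)).prod (dx.restrict (shell F 0))) := by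
    rw [Measure.prod_restrict]
    refine ContinuousOn.integrableOn_compact ((isCompact_shell s).prod (isCompact_shell 0)) ?_
    refine hg.comp (ContinuousOn.div (by fun_prop) (by fun_prop) ?_) ?_
    · rintro ⟨z, u⟩ ⟨hz, -⟩
      exact ne_zero_of_mem_shell hz
    · rintro ⟨z, u⟩ ⟨hz, hu⟩
      simp only [mem_shell] at hz hu ⊢
      rw [map_div₀, map_mul, hp, hz, hu, exp_zero, mul_one, exp_add,
        mul_div_cancel_left₀ _ exp_ne_zero]
  have hswap := integral_integral_swap hint
  rw [setIntegral_congr_fun (measurableSet_shell s) key,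
    setIntegral_congr_fun (measurableSet_shell 0) key2, setIntegral_const, setIntegral_const,
    ← hV] at hswap
  have hVs : dx.real (shell F s) = (resCard F : ℝ) ^ s * V := by
    obtain ⟨a, ha⟩ := exists_unit_val (F := F) s
    have h1 := setIntegral_mul_left dx a (S := shell F 0) (T := shell F s)
      (fun x => by simpa using smul_mem_shell_iff (k := 0) ha (x := x)) (fun _ => 1)
    rw [setIntegral_const, setIntegral_const, absF_eq_zpow ha, ← hV] at h1
    have h2 : V = ((resCard F : ℝ) ^ s)⁻¹ * dx.real (shell F s) := by
      simp only [Complex.real_smul, mul_one] at h1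
      exact_mod_cast h1
    rw [h2, mul_inv_cancel_left₀ (zpow_ne_zero _ resCard_ne_zero)]
  have hq : (resCard F : ℂ) ≠ 0 := by exact_mod_cast resCard_pos.ne'
  have hVc : (V : ℂ) ≠ 0 := by exact_mod_cast hVpos
  simp only [hVs, Complex.real_smul] at hswap
  push_cast at hswap
  rw [sub_eq_add_neg, zpow_add₀ hq]
  apply mul_left_cancel₀ hVc
  rw [← hswap]
  ring

end Measure

end GLThree

namespace GLThree

/-! ### Integrals of a ramified character over balls and shells -/

section RamifiedIntegral

open WithZero Topology

variable {F : Type*} [Field F] [TopologicalSpace F]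

open Classical in
/-- A quasi-character, extended by `0` to `F`. -/
noncomputable def extChar (χ : Fˣ →ₜ* ℂˣ) (x : F) : ℂ :=
  if h : x = 0 then 0 else (χ (Units.mk0 x h) : ℂ)

lemma extChar_zero (χ : Fˣ →ₜ* ℂˣ) : extChar χ 0 = 0 := by simp [extChar]

lemma extChar_unit (χ : Fˣ →ₜ* ℂˣ) (x : Fˣ) : extChar χ x = χ x := by
  simp [extChar]

lemma extChar_mul (χ : Fˣ →ₜ* ℂˣ) (x y : F) :
    extChar χ (x * y) = extChar χ x * extChar χ y := by
  by_cases hx : x = 0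
  · simp [hx, extChar_zero]
  by_cases hy : y = 0
  · simp [hy, extChar_zero]
  lift x to Fˣ using Ne.isUnit hx
  lift y to Fˣ using Ne.isUnit hy
  rw [← Units.val_mul, extChar_unit, extChar_unit, extChar_unit, map_mul, Units.val_mul]

variable [ValuativeRel F] [IsNonarchimedeanLocalField F]

lemma extChar_eq_one {χ : Fˣ →ₜ* ℂˣ} {n : ℕ} (h : ∀ x ∈ unitFiltration F n, χ x = 1)
    {x : F} (hx : val F x = 1) (hx' : x - 1 ∈ pPow F n) : extChar χ x = 1 := by
  have hx0 : x ≠ 0 := by rintro rfl; simp at hx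
  lift x to Fˣ using Ne.isUnit hx0
  rw [extChar_unit, h x ⟨hx, hx'⟩, Units.val_one]

lemma val_eq_of_sub_lt {x y : F} (h : val F (x - y) < val F y) : val F x = val F y := by
  have := (val F).map_add_eq_of_lt_left h
  rwa [add_sub_cancel] at this

lemma val_eq_one_of_sub_mem {n : ℤ} (hn : 0 < n) {x : F} (hx : x - 1 ∈ pPow F n) :
    val F x = 1 := by
  have := val_eq_of_sub_lt (x := x) (y := 1) (by
    rw [map_one, ← exp_zero, lt_exp_iff]
    exact pPow_mono (j := 1) (by omega) hx)
  rwa [map_one] at this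

/-- Products of a quasi-character and a function of the valuation which vanishes near `0` are
continuous on `F`. -/
lemma continuous_extChar_mul (χ : Fˣ →ₜ* ℂˣ) {H : WithZero (Multiplicative ℤ) → ℂ} {e : ℤ}
    (hH : ∀ a ≤ exp e, H a = 0) : Continuous fun x : F => extChar χ x * H (val F x) := by
  refine continuous_iff_continuousAt.mpr fun x => ?_
  have key : ∃ k : ℤ, ∀ y : F, y - x ∈ pPow F k →
      extChar χ y * H (val F y) = extChar χ x * H (val F x) := by
    by_cases hx : x = 0
    · refine ⟨-e, fun y hy => ?_⟩
      rw [hx, sub_zero, mem_pPow, neg_neg] at hy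
      rw [hH _ hy, hx, extChar_zero]
      simp
    · obtain ⟨n, hn⟩ := exists_trivial_unitFiltration χ
      obtain ⟨k, hk⟩ := exists_val_eq_exp hx
      refine ⟨n + 1 - k, fun y hy => ?_⟩
      have h1 : y / x - 1 ∈ pPow F (n + 1) := by
        rw [show y / x - 1 = (y - x) * x⁻¹ by field_simp]
        refine pPow_mul_mem (j := k) (i := n + 1 - k) (by omega) hy ?_
        rw [mem_pPow, map_inv₀, hk, exp_neg]
      have h2 := val_eq_one_of_sub_mem (by omega) h1
      have h3 := extChar_eq_one hn h2 (pPow_mono (by omega) h1)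
      rw [← div_mul_cancel₀ y hx, extChar_mul, h3, map_mul, h2, one_mul, one_mul]
  obtain ⟨k, hk⟩ := key
  refine continuousAt_const.congr (f := fun _ => extChar χ x * H (val F x)) ?_
  have : (fun y => y - x) ⁻¹' pPow F k ∈ 𝓝 x :=
    (show Continuous fun y : F => y - x by fun_prop).continuousAt.preimage_mem_nhds
      (by simpa using pPow_mem_nhds_zero k)
  filter_upwards [this] with y hy
  exact (hk y hy).symm

variable [MeasurableSpace F] [BorelSpace F] {dx : Measure F} [dx.IsAddHaarMeasure]

/-- The map p ↦ εp + (1 - ε) multiplies 1 - p by ε, so it preserves |1 - p| and multiplies the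
integrand by χ(ε). It preserves the ball when 1 - ε ∈ 𝔭ˡ, and below the conductor such an ε can be
chosen with χ(ε) ≠ 1. -/
lemma setIntegral_pPow_ramified (hdx : dx (pPow F 0) = 1) {χ : Fˣ →ₜ* ℂˣ}
    (hχ : 0 < conductor χ) (H : WithZero (Multiplicative ℤ) → ℂ) (l : ℤ) :
    ∫ p in pPow F l, extChar χ (1 - p) * H (val F (1 - p)) ∂dx =
      if (conductor χ : ℤ) ≤ l then H 1 * (resCard F : ℂ) ^ (-l) else 0 := by
  split_ifs with hl
  · have h1 : ∀ p ∈ pPow F l, extChar χ (1 - p) * H (val F (1 - p)) = H 1 := by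
      intro p hp
      have hp' : 1 - p - 1 ∈ pPow F (conductor χ) := by
        rw [sub_sub_cancel_left]
        exact pPow_neg_mem (pPow_mono hl hp)
      have hv := val_eq_one_of_sub_mem (by exact_mod_cast hχ) hp'
      rw [hv, extChar_eq_one (conductor_spec χ) hv hp', one_mul]
    rw [setIntegral_congr_fun (measurableSet_pPow l) h1, setIntegral_const, real_pPow hdx]
    simp [mul_comm]
  -- For negative `l` the truncation to 0 is harmless: every unit ε satisfies 1 - ε ∈ 𝔬 ⊆ 𝔭ˡ.
  · obtain ⟨ε, hε, hne⟩ := exists_ne_one_of_lt_conductor (χ := χ) (n := l.toNat) (by omega)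
    have hε' : 1 - (ε : F) ∈ pPow F l := by
      rw [← neg_sub]
      exact pPow_neg_mem (pPow_mono (by omega) hε.2)
    have hT : MeasurableEmbedding fun p : F => (ε : F) * p + (1 - ε) :=
      (measurableEmbedding_addRight (1 - (ε : F))).comp (measurableEmbedding_mul_left ε)
    refine setIntegral_eq_zero_of_eigen (T := fun p => (ε : F) * p + (1 - ε)) (c := (χ ε : ℂ))
      ((measurePreserving_add_right dx (1 - (ε : F))).comp (measurePreserving_mul_left dx hε.1))
      hT (measurableSet_pPow l) (fun x => ?_) (by simpa using hne) fun p _ => ?_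
    · rw [add_mem_pPow_iff hε']
      have := smul_mem_pPow_iff (a := ε) (s := 0) (k := l) (by simpa using hε.1) (x := x)
      rwa [sub_zero] at this
    · rw [show 1 - ((ε : F) * p + (1 - ε)) = ε * (1 - p) by ring, extChar_mul, extChar_unit,
        map_mul, hε.1, one_mul, mul_assoc]

open Classical in
-- The substitution w = p/z leads to another shell, a difference of two balls, and
-- `setIntegral_pPow_ramified` applies to each. The hypothesis `hH` gives continuity at w = 1, where
-- the character is not defined. Of the radial factor only its value at 1 survives.
lemma setIntegral_shell_ramified (hdx : dx (pPow F 0) = 1) {χ : Fˣ →ₜ* ℂˣ}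
    (hχ : 0 < conductor χ) {H : WithZero (Multiplicative ℤ) → ℂ} {e : ℤ}
    (hH : ∀ a ≤ exp e, H a = 0) (s : ℤ) (p : F) :
    ∫ z in shell F s, extChar χ (1 - p / z) * H (val F (1 - p / z)) ∂dx =
      H 1 * (resCard F : ℂ) ^ s *
        ((if p ∈ pPow F (conductor χ - s) then 1 else 0) -
          (resCard F : ℂ)⁻¹ * (if p ∈ pPow F (conductor χ - s - 1) then 1 else 0)) := by
  have hq : (resCard F : ℂ) ≠ 0 := by exact_mod_cast resCard_pos.ne'
  have := t2Space (F := F)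
  by_cases hp : p = 0
  · have h1 : extChar χ (1 : F) = 1 := by
      have := extChar_unit χ 1
      simpa using this
    simp only [hp, zero_div, sub_zero, zero_mem_pPow, if_true, map_one, h1]
    rw [setIntegral_const, real_shell hdx]
    simp
    ring
  · obtain ⟨π, hπ⟩ := exists_val_eq_exp hp
    have hcont := continuous_extChar_mul χ hH
    have hcont' : Continuous fun w : F => extChar χ (1 - w) * H (val F (1 - w)) :=
      hcont.comp (by fun_prop : Continuous fun w : F => 1 - w)
    rw [setIntegral_shell_div dx (g := fun w => extChar χ (1 - w) * H (val F (1 - w)))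
      (l := π - s) hcont'.continuousOn (by rw [hπ]; congr 1; ring), shell_eq,
      setIntegral_sdiff (measurableSet_pPow _)
        (hcont'.continuousOn.integrableOn_compact (isCompact_pPow _))
        (fun x hx => pPow_mono (i := -(π - s) + 1) (by omega) hx),
      setIntegral_pPow_ramified hdx hχ, setIntegral_pPow_ramified hdx hχ]
    simp only [mem_pPow, hπ, exp_le_exp]
    have e1 : ((conductor χ : ℤ) ≤ -(π - s)) ↔ π ≤ -(conductor χ - s) := by omega
    have e2 : ((conductor χ : ℤ) ≤ -(π - s) + 1) ↔ π ≤ -(conductor χ - s - 1) := by omega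
    simp only [e1, e2]
    have e3 : (resCard F : ℂ) ^ (s - (π - s)) * (resCard F : ℂ) ^ (π - s) = (resCard F : ℂ) ^ s := by
      rw [← zpow_add₀ hq]; congr 1; ring
    have e4 : (resCard F : ℂ) ^ (s - (π - s)) * (resCard F : ℂ) ^ (π - s + -1) =
        (resCard F : ℂ) ^ s * (resCard F : ℂ)⁻¹ := by
      rw [← zpow_neg_one, ← zpow_add₀ hq, ← zpow_add₀ hq]; congr 1; ring
    rw [neg_neg, neg_add, neg_neg]
    split_ifs
    · linear_combination H 1 * e3 - H 1 * e4
    · linear_combination H 1 * e3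
    · linear_combination -H 1 * e4
    · ring

end RamifiedIntegral

end GLThree

namespace GLThree

/-! ### The integral of ψ⁻¹ over x and y under conditions on |xy| -/

section HyperbolaIntegral

open WithZero Topology

lemma continuous_addChar_inv {F : Type*} [Field F] [TopologicalSpace F]
    {ψ : AddChar F Circle} (hψ : Continuous ψ) :
    Continuous fun x => ((ψ x : Circle) : ℂ)⁻¹ :=
  Continuous.inv₀ (by fun_prop) (by simp)

variable {F : Type*} [Field F] [ValuativeRel F] [TopologicalSpace F] [IsNonarchimedeanLocalField F]

lemma resCard_ne_zero' : (resCard F : ℂ) ≠ 0 := by exact_mod_cast resCard_pos.ne'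

lemma pPow_inter (i j : ℤ) : pPow F i ∩ pPow F j = pPow F (max i j) := by
  ext x
  refine ⟨fun h => ?_, fun h => ⟨pPow_mono (le_max_left _ _) h, pPow_mono (le_max_right _ _) h⟩⟩
  rcases max_choice i j with e | e <;> rw [e]
  exacts [h.1, h.2]

variable (F) in
/-- The integral over `𝔭ᵏ` of an unramified additive character. -/
noncomputable def ballSum (k : ℤ) : ℂ := if 0 ≤ k then (resCard F : ℂ) ^ (-k) else 0

/-- The weight q⁻¹ makes consecutive ball integrals cancel, except at the radius beyond which they
drop to 0. -/
lemma ballSum_sub (k : ℤ) :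
    ballSum F k - (resCard F : ℂ)⁻¹ * ballSum F (k - 1) = if k = 0 then 1 else 0 := by
  have hq := resCard_ne_zero' (F := F)
  unfold ballSum
  rcases lt_trichotomy k 0 with h | h | h
  · rw [if_neg (by omega), if_neg (by omega), if_neg (by omega)]; simp
  · subst h; simp
  · rw [if_pos (by omega), if_pos (by omega), if_neg (by omega), ← zpow_neg_one, ← zpow_add₀ hq,
      show (-1 + -(k - 1)) = -k by ring, sub_self]

variable [MeasurableSpace F] [BorelSpace F] {dx : Measure F} [dx.IsAddHaarMeasure]

open Classical in
lemma setIntegral_mul_mem (hdx : dx (pPow F 0) = 1) {ψ : AddChar F Circle}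
    (hψ : IsUnramifiedAddChar ψ) {x : F} {κ : ℤ} (hx : val F x = exp κ) (b t : ℤ) :
    ∫ y in pPow F b, (if x * y ∈ pPow F t then 1 else 0) * ((ψ y : Circle) : ℂ)⁻¹ ∂dx =
      ballSum F (max b (t + κ)) := by
  have h1 : ∀ y : F, (if x * y ∈ pPow F t then (1 : ℂ) else 0) * ((ψ y : Circle) : ℂ)⁻¹ =
      (pPow F (t + κ)).indicator (fun y => ((ψ y : Circle) : ℂ)⁻¹) y := by
    intro y
    have hx0 : x ≠ 0 := ne_zero_of_mem_shell hx
    have := smul_mem_pPow_iff (a := Units.mk0 x hx0) (s := κ) (k := t + κ) hx (x := y)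
    rw [add_sub_cancel_right] at this
    simp only [Set.indicator_apply, ← this, Units.val_mk0]
    split_ifs <;> simp
  simp only [h1]
  rw [setIntegral_indicator (measurableSet_pPow _), pPow_inter, setIntegral_addChar_inv hdx hψ]
  rfl

lemma integrableOn_ite_mul {ψ : AddChar F Circle} (hψ : Continuous ψ) (x : F) (b t : ℤ)
    [DecidablePred (· ∈ pPow F t)] :
    IntegrableOn (fun y => (if x * y ∈ pPow F t then 1 else 0) * ((ψ y : Circle) : ℂ)⁻¹)
      (pPow F b) dx := by
  have := t2Space (F := F)
  refine ContinuousOn.integrableOn_compact (isCompact_pPow b) (Continuous.continuousOn ?_)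
  refine Continuous.mul ?_ (Continuous.inv₀ (by fun_prop) (by simp))
  refine continuous_const.if (fun a ha => ?_) continuous_const
  exfalso
  have : frontier {a | x * a ∈ pPow F t} = ∅ := by
    refine IsClopen.frontier_eq ⟨?_, ?_⟩
    · exact (isClosed_pPow t).preimage (f := fun a => x * a) (by fun_prop)
    · exact (isOpen_pPow t).preimage (f := fun a => x * a) (by fun_prop)
  rw [this] at ha
  exact ha

open Classical in
-- If x ∈ 𝔭^(t-b), both conditions hold for all y in the ball. Otherwise each condition cuts out a
-- ball in y, of consecutive radii, and by `ballSum_sub` the two contributions cancel unless |x| =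
-- q⁻ᵗ.
lemma setIntegral_hyperbola_inner (hdx : dx (pPow F 0) = 1) {ψ : AddChar F Circle}
    (hψ : Continuous ψ) (hψ' : IsUnramifiedAddChar ψ) (x : F) (b t : ℤ) :
    ∫ y in pPow F b, ((if x * y ∈ pPow F t then 1 else 0) -
        (resCard F : ℂ)⁻¹ * (if x * y ∈ pPow F (t - 1) then 1 else 0)) *
          ((ψ y : Circle) : ℂ)⁻¹ ∂dx =
      if x ∈ pPow F (t - b) then (1 - (resCard F : ℂ)⁻¹) * ballSum F b
      else if x ∈ shell F (-t) then 1 else 0 := by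
  simp only [sub_mul, mul_assoc]
  rw [integral_sub (integrableOn_ite_mul hψ x b t)
    ((integrableOn_ite_mul hψ x b (t - 1)).const_mul _), integral_const_mul]
  by_cases hx : x = 0
  · subst hx
    simp only [zero_mul, zero_mem_pPow, if_true, one_mul, setIntegral_addChar_inv hdx hψ']
    rfl
  · obtain ⟨κ, hκ⟩ := exists_val_eq_exp hx
    rw [setIntegral_mul_mem hdx hψ' hκ, setIntegral_mul_mem hdx hψ' hκ]
    simp only [mem_pPow, mem_shell, hκ, exp_le_exp, exp_inj]
    split_ifs with h1 h2
    · rw [max_eq_left (by omega), max_eq_left (by omega)]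
      ring
    · rw [max_eq_right (by omega), max_eq_right (by omega),
        show t - 1 + κ = (t + κ) - 1 by ring, ballSum_sub, if_pos (by omega)]
    · rw [max_eq_right (by omega), max_eq_right (by omega),
        show t - 1 + κ = (t + κ) - 1 by ring, ballSum_sub, if_neg (by omega)]

open Classical in
-- Here `k` is the size of the box in U₃; the value is already stable for k ≥ 1.
lemma setIntegral_hyperbola (hdx : dx (pPow F 0) = 1) {ψ : AddChar F Circle}
    (hψ : Continuous ψ) (hψ' : IsUnramifiedAddChar ψ) (m n j : ℕ) (k : ℤ)
    (hk : 1 ≤ k) :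
    ∫ x in pPow F (max (-k) (m - j)), (∫ y in pPow F (max (-k) (n - j)),
        ((if x * y ∈ pPow F (m + n - j) then 1 else 0) -
          (resCard F : ℂ)⁻¹ * (if x * y ∈ pPow F (m + n - j - 1) then 1 else 0)) *
          ((ψ y : Circle) : ℂ)⁻¹ ∂dx) * ((ψ x : Circle) : ℂ)⁻¹ ∂dx =
      if j ≤ m + n then (1 - (resCard F : ℂ)⁻¹) * (resCard F : ℂ) ^ ((j : ℤ) - m - n)
      else if j = m + n + 1 then -1 else 0 := by
  have hq := resCard_ne_zero' (F := F)
  have := t2Space (F := F)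
  simp only [setIntegral_hyperbola_inner hdx hψ hψ']
  -- For j ≤ n the y-ball lies in 𝔬 and exactly the x in 𝔭ᵐ contribute. For j > n the ball integral
  -- over y vanishes, and only the shell |x| = q^(j-m-n) is left.
  by_cases hY : (j : ℤ) ≤ n
  · have hb : max (-k) ((n : ℤ) - j) = n - j := max_eq_right (by omega)
    rw [hb, if_pos (by omega)]
    have h1 : ∀ x : F, (if x ∈ pPow F (m + n - j - (n - j)) then
          (1 - (resCard F : ℂ)⁻¹) * ballSum F (n - j)
        else if x ∈ shell F (-(m + n - j)) then 1 else 0) * ((ψ x : Circle) : ℂ)⁻¹ =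
        (pPow F m).indicator (fun x => ((1 - (resCard F : ℂ)⁻¹) * ballSum F (n - j)) *
          ((ψ x : Circle) : ℂ)⁻¹) x := by
      intro x
      rw [show (m + n - j - (n - j) : ℤ) = m by ring]
      by_cases hx : x ∈ pPow F m
      · simp [hx]
      · have : x ∉ shell F (-(m + n - j)) := fun h => hx <| by
          rw [mem_pPow, h.out, exp_le_exp]; omega
        simp [hx, this, -neg_sub]
    simp only [h1]
    rw [setIntegral_indicator (measurableSet_pPow _), pPow_inter, integral_const_mul,
      setIntegral_addChar_inv hdx hψ', max_eq_right (by omega), if_pos (by omega), ballSum,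
      if_pos (by omega), mul_assoc, ← zpow_add₀ hq]
    congr 2; ring
  · have hb : ballSum F (max (-k) ((n : ℤ) - j)) = 0 := by
      rw [ballSum, if_neg (by omega)]
    have h1 : ∀ x : F, (if x ∈ pPow F (m + n - j - max (-k) (n - j)) then
          (1 - (resCard F : ℂ)⁻¹) * ballSum F (max (-k) (n - j))
        else if x ∈ shell F (-(m + n - j)) then 1 else 0) * ((ψ x : Circle) : ℂ)⁻¹ =
        (shell F (-(m + n - j))).indicator (fun x => ((ψ x : Circle) : ℂ)⁻¹) x := by
      intro x
      rw [hb]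
      by_cases hx : x ∈ shell F (-(m + n - j))
      · have : x ∉ pPow F (m + n - j - max (-k) (n - j)) := fun h => by
          rw [mem_pPow, hx.out, exp_le_exp] at h; omega
        simp [hx, this, -neg_sub]
      · simp [hx, -neg_sub]
    simp only [h1]
    rw [setIntegral_indicator (measurableSet_shell _)]
    have hball : ∀ T : ℤ, ∫ x in shell F T, ((ψ x : Circle) : ℂ)⁻¹ ∂dx =
        ballSum F (-T) - ballSum F (-T + 1) := by
      intro T
      have hint : IntegrableOn (fun x => ((ψ x : Circle) : ℂ)⁻¹) (pPow F (-T)) dx :=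
        (continuous_addChar_inv hψ).continuousOn.integrableOn_compact (isCompact_pPow _)
      rw [shell_eq]
      refine (setIntegral_sdiff (measurableSet_pPow _) hint
        (fun x hx => pPow_mono (i := -T + 1) (by omega) hx)).trans ?_
      rw [setIntegral_addChar_inv hdx hψ', setIntegral_addChar_inv hdx hψ']
      rfl
    -- With T = j - m - n, the integral of ψ⁻¹ over |x| = q^T is q^T(1 - q⁻¹) for T ≤ 0, is -1 for T
    -- = 1, and is 0 for T ≥ 2. The box contains the shell in the first two cases; in the third the
    -- shell is inside the box or disjoint from it, with contribution 0 both times.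
    by_cases hT : (j : ℤ) ≤ m + n + 1
    · have hsub : pPow F (max (-k) (m - j)) ∩ shell F (-(m + n - j)) = shell F (-(m + n - j)) := by
        refine Set.inter_eq_right.mpr fun x hx => ?_
        rw [mem_pPow, hx.out, exp_le_exp]; omega
      rw [hsub, hball]
      split_ifs with h2 h3
      · rw [ballSum, ballSum, if_pos (by omega), if_pos (by omega), sub_mul, one_mul,
          ← zpow_neg_one, ← zpow_add₀ hq]
        congr 2 <;> ring
      · rw [ballSum, ballSum, if_neg (by omega), if_pos (by omega), h3]
        simp
      · omega
    · rw [if_neg (by omega), if_neg (by omega)]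
      by_cases hX : j - m - n ≤ min k (j - m)
      · have hsub : pPow F (max (-k) (m - j)) ∩ shell F (-(m + n - j)) =
            shell F (-(m + n - j)) := by
          refine Set.inter_eq_right.mpr fun x hx => ?_
          rw [mem_pPow, hx.out, exp_le_exp]; omega
        rw [hsub, hball, ballSum, ballSum, if_neg (by omega), if_neg (by omega), sub_zero]
      · have hsub : pPow F (max (-k) (m - j)) ∩ shell F (-(m + n - j)) = ∅ := by
          rw [← Set.disjoint_iff_inter_eq_empty, Set.disjoint_left]
          intro x hx hx'
          rw [mem_pPow, hx'.out, exp_le_exp] at hx; omega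
        rw [hsub]
        simp

end HyperbolaIntegral

end GLThree

namespace GLThree

/-! ### Support and values of the newform -/

section Newform

open WithZero Topology

variable {F : Type*} [Field F]

/-- Lower triangular unipotent matrices. -/
def lowerUnip (α β γ : F) : GL (Fin 3) F where
  val := !![1, 0, 0; α, 1, 0; β, γ, 1]
  inv := !![1, 0, 0; -α, 1, 0; α * γ - β, -γ, 1]
  val_inv := by
    ext i j; fin_cases i <;> fin_cases j <;> simp [Matrix.mul_apply, Fin.sum_univ_three]
    ring
  inv_val := by
    ext i j; fin_cases i <;> fin_cases j <;> simp [Matrix.mul_apply, Fin.sum_univ_three]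
    ring

lemma torus_mul (a₁ a₂ a₃ b₁ b₂ b₃ : Fˣ) :
    torus a₁ a₂ a₃ * torus b₁ b₂ b₃ = torus (a₁ * b₁) (a₂ * b₂) (a₃ * b₃) := by
  ext i j; fin_cases i <;> fin_cases j <;> simp [torus, Matrix.mul_apply, Fin.sum_univ_three]

lemma torus_inv (a₁ a₂ a₃ : Fˣ) : (torus a₁ a₂ a₃)⁻¹ = torus a₁⁻¹ a₂⁻¹ a₃⁻¹ := by
  rw [inv_eq_iff_mul_eq_one, torus_mul]
  ext i j; fin_cases i <;> fin_cases j <;> simp [torus]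

lemma torus_mul_unip_mul_torus (a₁ a₂ a₃ b₁ b₂ b₃ : Fˣ) (x y z : F) :
    torus a₁ a₂ a₃ * unip x y z * torus b₁ b₂ b₃ =
      torus (a₁ * b₁) (a₂ * b₂) (a₃ * b₃) * unip (x * b₂ / b₁) (y * b₃ / b₂) (z * b₃ / b₁) := by
  ext i j; fin_cases i <;> fin_cases j <;>
    simp [torus, unip, Matrix.mul_apply, Fin.sum_univ_three] <;> field_simp

lemma unip_mem (x y z : F) : unip x y z ∈ unipGroup F := ⟨x, y, z, rfl⟩

lemma mul_wLong_apply (h : GL (Fin 3) F) (i : Fin 3) :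
    (h * wLong F).val i 0 = h.val i 2 ∧ (h * wLong F).val i 1 = h.val i 1 ∧
      (h * wLong F).val i 2 = h.val i 0 := by
  refine ⟨?_, ?_, ?_⟩ <;> simp [wLong, Matrix.mul_apply, Fin.sum_univ_three]

variable [ValuativeRel F] [TopologicalSpace F] [IsNonarchimedeanLocalField F]

variable {μ₁ μ₂ μ₃ : Fˣ →ₜ* ℂˣ} {n : ℕ}

lemma exists_of_newform_ne_zero {g : GL (Fin 3) F} (h : newform μ₁ μ₂ μ₃ n g ≠ 0) :
    ∃ a₁ a₂ a₃ : Fˣ, ∃ x y z : F, ∃ k ∈ levelGroup F n, g = torus a₁ a₂ a₃ * unip x y z * k := by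
  by_contra hne
  refine h (dif_neg ?_)
  rintro ⟨a, u, ⟨x, y, z, rfl⟩, k, hk, e⟩
  exact hne ⟨_, _, _, _, _, _, k, hk, e⟩

lemma newform_mul_right {g k : GL (Fin 3) F} (hμ₁ : IsUnramified μ₁) (hμ₃ : IsUnramified μ₃)
    (hμ₂ : ∀ x ∈ unitFiltration F n, μ₂ x = 1) (hk : k ∈ levelGroup F n) :
    newform μ₁ μ₂ μ₃ n (g * k) = newform μ₁ μ₂ μ₃ n g := by
  by_cases h : newform μ₁ μ₂ μ₃ n g = 0
  · rw [h]
    by_contra h'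
    obtain ⟨a₁, a₂, a₃, x, y, z, k', hk', e⟩ := exists_of_newform_ne_zero h'
    have e2 : g = torus a₁ a₂ a₃ * unip x y z * (k' * k⁻¹) := by
      rw [← mul_assoc, ← e, mul_inv_cancel_right]
    rw [e2, newform_apply hμ₁ hμ₃ hμ₂ _ _ _ (unip_mem ..) (mul_mem hk' (inv_mem hk))] at h
    rw [e, newform_apply hμ₁ hμ₃ hμ₂ _ _ _ (unip_mem ..) hk'] at h'
    exact h' h
  · obtain ⟨a₁, a₂, a₃, x, y, z, k', hk', rfl⟩ := exists_of_newform_ne_zero h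
    rw [mul_assoc, newform_apply hμ₁ hμ₃ hμ₂ _ _ _ (unip_mem ..) hk',
      newform_apply hμ₁ hμ₃ hμ₂ _ _ _ (unip_mem ..) (mul_mem hk' hk)]

lemma borelWeight_ne_zero (a₁ a₂ a₃ : Fˣ) : borelWeight μ₁ μ₂ μ₃ a₁ a₂ a₃ ≠ 0 := by
  unfold borelWeight
  have := (absF_pos (a₁ / a₃)).ne'
  simp [this]

lemma newform_borel_mul (hμ₁ : IsUnramified μ₁) (hμ₃ : IsUnramified μ₃)
    (hμ₂ : ∀ x ∈ unitFiltration F n, μ₂ x = 1) (a₁ a₂ a₃ : Fˣ) (x y z : F) (g : GL (Fin 3) F) :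
    newform μ₁ μ₂ μ₃ n (torus a₁ a₂ a₃ * unip x y z * g) =
      borelWeight μ₁ μ₂ μ₃ a₁ a₂ a₃ * newform μ₁ μ₂ μ₃ n g := by
  have key : ∀ (a₁ a₂ a₃ : Fˣ) (x y z : F) (g : GL (Fin 3) F),
      newform μ₁ μ₂ μ₃ n g ≠ 0 → newform μ₁ μ₂ μ₃ n (torus a₁ a₂ a₃ * unip x y z * g) =
      borelWeight μ₁ μ₂ μ₃ a₁ a₂ a₃ * newform μ₁ μ₂ μ₃ n g := by
    intro a₁ a₂ a₃ x y z g h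
    obtain ⟨b₁, b₂, b₃, x', y', z', k, hk, rfl⟩ := exists_of_newform_ne_zero h
    have e : torus a₁ a₂ a₃ * unip x y z * (torus b₁ b₂ b₃ * unip x' y' z' * k) =
        torus (a₁ * b₁) (a₂ * b₂) (a₃ * b₃) *
          (unip (x * b₂ / b₁) (y * b₃ / b₂) (z * b₃ / b₁) * unip x' y' z') * k := by
      rw [← mul_assoc, ← mul_assoc, torus_mul_unip_mul_torus, mul_assoc (torus _ _ _)]
    rw [e, newform_apply hμ₁ hμ₃ hμ₂ _ _ _ (mul_mem (unip_mem ..) (unip_mem ..)) hk,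
      newform_apply hμ₁ hμ₃ hμ₂ _ _ _ (unip_mem ..) hk, borelWeight_mul]
  by_cases h : newform μ₁ μ₂ μ₃ n g = 0
  · rw [h, mul_zero]
    by_contra h'
    have h2 := key a₁⁻¹ a₂⁻¹ a₃⁻¹ (-(x * ↑a₂⁻¹ / ↑a₁⁻¹)) (-(y * ↑a₃⁻¹ / ↑a₂⁻¹))
      (x * ↑a₂⁻¹ / ↑a₁⁻¹ * (y * ↑a₃⁻¹ / ↑a₂⁻¹) - z * ↑a₃⁻¹ / ↑a₁⁻¹) _ h'
    have e : torus a₁⁻¹ a₂⁻¹ a₃⁻¹ * unip (-(x * ↑a₂⁻¹ / ↑a₁⁻¹)) (-(y * ↑a₃⁻¹ / ↑a₂⁻¹))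
      (x * ↑a₂⁻¹ / ↑a₁⁻¹ * (y * ↑a₃⁻¹ / ↑a₂⁻¹) - z * ↑a₃⁻¹ / ↑a₁⁻¹) *
        (torus a₁ a₂ a₃ * unip x y z * g) = g := by
      rw [← mul_assoc, ← mul_assoc, torus_mul_unip_mul_torus, mul_assoc (torus _ _ _), unip_mul]
      convert one_mul g
      ext i j; fin_cases i <;> fin_cases j <;>
        simp [torus, unip] <;> field_simp <;> ring
    rw [e, h] at h2
    exact mul_ne_zero (borelWeight_ne_zero _ _ _) h' h2.symm
  · exact key _ _ _ _ _ _ _ h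

lemma lowerUnip_mem {α β γ : F} (hα : α ∈ pPow F n) (hβ : β ∈ pPow F n) (hγ : γ ∈ pPow F n) :
    lowerUnip α β γ ∈ levelGroup F n := by
  have h1 : α * γ - β ∈ pPow F n := pPow_sub_mem (pPow_mul_mem (by omega) hα hγ) hβ
  have hα' := pPow_neg_mem hα
  have hγ' := pPow_neg_mem hγ
  change _ ∈ orderSet F n ∧ !![1, 0, 0; -α, 1, 0; α * γ - β, -γ, 1] ∈ orderSet F n
  simp [orderSet, lowerUnip, zero_mem_pPow, one_mem_pPow, *]

/-- Conjugating K_n by diag(d,1,1) turns its shape into (𝔬, 𝔭ⁿ, 𝔬; 𝔬, 1 + 𝔭ⁿ, 𝔬; 𝔬, 𝔭ⁿ, 𝔬), a group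
that contains w. For this reason the newform is always evaluated at `h * torus d 1 1`: there the
first and third columns of h play the same role. -/
lemma swap_mem {d : Fˣ} (hd : val F (d : F) = exp (-n : ℤ)) :
    (torus d 1 1)⁻¹ * wLong F * torus d 1 1 ∈ levelGroup F n := by
  have e : (torus d 1 1)⁻¹ * wLong F * torus d 1 1 =
      ⟨!![0, 0, (d : F)⁻¹; 0, 1, 0; d, 0, 0], !![0, 0, (d : F)⁻¹; 0, 1, 0; d, 0, 0],
        by ext i j; fin_cases i <;> fin_cases j <;> simp [Matrix.mul_apply, Fin.sum_univ_three],
        by ext i j; fin_cases i <;> fin_cases j <;>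
          simp [Matrix.mul_apply, Fin.sum_univ_three]⟩ := by
    rw [torus_inv]
    ext i j; fin_cases i <;> fin_cases j <;>
      simp [torus, wLong, Matrix.mul_apply, Fin.sum_univ_three]
  have h1 : (d : F) ∈ pPow F n := by rw [mem_pPow, hd]
  have h2 : (d : F)⁻¹ ∈ pPow F (-n) := by rw [mem_pPow, map_inv₀, hd, ← exp_neg]
  rw [e]
  change !![0, 0, (d : F)⁻¹; 0, 1, 0; (d : F), 0, 0] ∈ orderSet F n ∧
    !![0, 0, (d : F)⁻¹; 0, 1, 0; (d : F), 0, 0] ∈ orderSet F n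
  simp [orderSet, zero_mem_pPow, h1, h2]

lemma newform_swap {d : Fˣ} (hμ₁ : IsUnramified μ₁) (hμ₃ : IsUnramified μ₃)
    (hμ₂ : ∀ x ∈ unitFiltration F n, μ₂ x = 1) (hd : val F (d : F) = exp (-n : ℤ))
    (h : GL (Fin 3) F) :
    newform μ₁ μ₂ μ₃ n (h * wLong F * torus d 1 1) = newform μ₁ μ₂ μ₃ n (h * torus d 1 1) := by
  rw [← newform_mul_right hμ₁ hμ₃ hμ₂ (swap_mem hd) (g := h * torus d 1 1)]
  congr 1
  group

/-- The condition for `h` to lie in the product of the Borel subgroup and the lower triangular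
unipotent matrices with integral entries and last row congruent to `(*, 0, 1)` modulo `𝔭ⁿ`. -/
structure InCell (n : ℕ) (A : Matrix (Fin 3) (Fin 3) F) : Prop where
  corner_ne : A 2 2 ≠ 0
  minor_ne : A 1 1 * A 2 2 - A 1 2 * A 2 1 ≠ 0
  row_left : val F (A 2 0) ≤ val F (A 2 2)
  row_mid : val F (A 2 1) ≤ exp (-n : ℤ) * val F (A 2 2)
  minor_le : val F (A 1 0 * A 2 2 - A 1 2 * A 2 0) ≤ val F (A 1 1 * A 2 2 - A 1 2 * A 2 1)

/-- This is the factorization into upper and lower triangular matrices: the torus part consists of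
quotients of the successive bottom right minors det, D, r. The lower unipotent part has the entries
α, β ∈ 𝔬 and γ ∈ 𝔭ⁿ bounded by `InCell`, and passing diag(d,1,1) through it puts α and β into 𝔭ⁿ as
well. -/
lemma newform_of_inCell {d : Fˣ} (hμ₁ : IsUnramified μ₁) (hμ₃ : IsUnramified μ₃)
    (hμ₂ : ∀ x ∈ unitFiltration F n, μ₂ x = 1) (hd : val F (d : F) = exp (-n : ℤ))
    {h : GL (Fin 3) F} (hh : InCell n h.val) {δ D r : Fˣ} (hδ : (δ : F) = h.val.det)
    (hD : (D : F) = h.val 1 1 * h.val 2 2 - h.val 1 2 * h.val 2 1) (hr : (r : F) = h.val 2 2) :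
    newform μ₁ μ₂ μ₃ n (h * torus d 1 1) =
      borelWeight μ₁ μ₂ μ₃ (δ * d / D) (D / r) r := by
  set A := h.val with hA
  set α : F := (A 1 0 * A 2 2 - A 1 2 * A 2 0) / D with hα
  set β : F := A 2 0 / r with hβ
  set γ : F := A 2 1 / r with hγ
  have hr0 := r.ne_zero
  have hD0 := D.ne_zero
  have hδ0 := δ.ne_zero
  have hdmem : (d : F) ∈ pPow F n := by rw [mem_pPow, hd]
  have hα' : α ∈ pPow F 0 := by
    rw [mem_pPow, hα, map_div₀, hD, neg_zero, exp_zero]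
    exact div_le_one_of_le₀ hh.minor_le zero_le
  have hβ' : β ∈ pPow F 0 := by
    rw [mem_pPow, hβ, map_div₀, hr, neg_zero, exp_zero]
    exact div_le_one_of_le₀ hh.row_left zero_le
  have hγ' : γ ∈ pPow F n := by
    rw [mem_pPow, hγ, map_div₀, hr]
    exact div_le_of_le_mul₀ zero_le zero_le hh.row_mid
  have hk : lowerUnip (α * d) (β * d) γ ∈ levelGroup F n :=
    lowerUnip_mem (pPow_mul_mem (by omega) hα' hdmem) (pPow_mul_mem (by omega) hβ' hdmem) hγ'
  have e : h * torus d 1 1 = torus (δ * d / D) (D / r) r *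
      unip ((A 0 1 - A 0 2 * γ) * D / (δ * d)) (A 1 2 * r / D) (A 0 2 * D / (δ * d)) *
      lowerUnip (α * d) (β * d) γ := by
    rw [Matrix.det_fin_three] at hδ
    ext i j
    fin_cases i <;> fin_cases j <;>
      simp [torus, unip, lowerUnip, Matrix.mul_apply, Fin.sum_univ_three, ← hA, hα, hβ, hγ] <;>
      try field_simp
    · rw [hδ, hD, hr]; ring
    · rw [hr]; ring
    · rw [hD, hr]; ring
    · exact hr.symm
  rw [e, newform_apply hμ₁ hμ₃ hμ₂ _ _ _ (unip_mem ..) hk]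

/-- The conditions of `InCell` are homogeneous in the last row and in the bottom minors, so a Borel
factor on the left drops out and they can be tested on `r` and `s`. Since r 1 lies in 𝔭, the product
s 1 * r 2 dominates the second minor and makes it a unit. -/
lemma inCell_of_rows (hn : 0 < n) {A : Matrix (Fin 3) (Fin 3) F} {a₂ a₃ : Fˣ} {y : F}
    {r s : Fin 3 → F} (hr : ∀ j, A 2 j = a₃ * r j) (hs : ∀ j, A 1 j = a₂ * (s j + y * r j))
    (r0 : r 0 ∈ pPow F 0) (r1 : r 1 ∈ pPow F n) (r2 : val F (r 2) = 1)
    (s0 : s 0 ∈ pPow F 0) (s1 : val F (s 1) = 1) (s2 : s 2 ∈ pPow F 0) : InCell n A := by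
  have r2' : r 2 ∈ pPow F 0 := by simp [mem_pPow, r2]
  have hr2 : r 2 ≠ 0 := by rintro h; simp [h] at r2
  have e1 : A 1 1 * A 2 2 - A 1 2 * A 2 1 = a₂ * a₃ * (s 1 * r 2 - s 2 * r 1) := by
    rw [hr, hr, hs, hs]; ring
  have e2 : A 1 0 * A 2 2 - A 1 2 * A 2 0 = a₂ * a₃ * (s 0 * r 2 - s 2 * r 0) := by
    rw [hr, hr, hs, hs]; ring
  have v1 : val F (s 1 * r 2 - s 2 * r 1) = 1 := by
    have h1 : val F (s 1 * r 2) = 1 := by rw [map_mul, s1, r2, one_mul]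
    have h2 : val F (s 1 * r 2 - s 2 * r 1 - s 1 * r 2) < val F (s 1 * r 2) := by
      rw [h1, sub_sub_cancel_left, ← exp_zero, lt_exp_iff]
      have := pPow_neg_mem (pPow_mul_mem (k := 1) (by omega) s2 r1)
      exact this
    rw [val_eq_of_sub_lt h2, h1]
  have v2 : val F (s 0 * r 2 - s 2 * r 0) ≤ 1 := by
    have := pPow_sub_mem (pPow_mul_mem (k := 0) (by omega) s0 r2')
      (pPow_mul_mem (k := 0) (by omega) s2 r0)
    simpa [mem_pPow] using this
  refine ⟨?_, ?_, ?_, ?_, ?_⟩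
  · rw [hr]; exact mul_ne_zero a₃.ne_zero hr2
  · rw [e1]
    refine mul_ne_zero (mul_ne_zero a₂.ne_zero a₃.ne_zero) ?_
    rintro h
    simp [h] at v1
  · rw [hr, hr, map_mul, map_mul, r2]
    gcongr
    simpa [mem_pPow] using r0
  · rw [hr, hr, map_mul, map_mul, r2, mul_one, mul_comm]
    gcongr
    exact r1
  · rw [e1, e2, map_mul, map_mul _ (_ * _) (s 1 * _ - _), v1]
    gcongr

/-- The support of the newform. -/
lemma inCell_or_of_newform_ne_zero (hn : 0 < n) {d : Fˣ} (hd : val F (d : F) = exp (-n : ℤ))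
    {h : GL (Fin 3) F} (hne : newform μ₁ μ₂ μ₃ n (h * torus d 1 1) ≠ 0) :
    InCell n h.val ∨ InCell n (h * wLong F).val := by
  obtain ⟨a₁, a₂, a₃, x, y, z, k, ⟨hk, hk'⟩, e⟩ := exists_of_newform_ne_zero hne
  set m : Matrix (Fin 3) (Fin 3) F := (k⁻¹ : GL (Fin 3) F).val with hm
  obtain ⟨-, ⟨k10, k11, k12⟩, k20, k21, k22⟩ := hk
  obtain ⟨⟨m00, m01, m02⟩, ⟨m10, m11, m12⟩, m20, m21, m22⟩ := hk'
  have e' : h = torus a₁ a₂ a₃ * unip x y z * k * torus d⁻¹ 1 1 := by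
    rw [← e, mul_assoc, torus_mul]
    simp only [mul_inv_cancel, mul_one]
    ext i j; fin_cases i <;> fin_cases j <;> simp [torus, Matrix.mul_apply, Fin.sum_univ_three]
  have hdi : ((d⁻¹ : Fˣ) : F) ∈ pPow F (-n) := by
    rw [mem_pPow, Units.val_inv_eq_inv_val, map_inv₀, hd, ← exp_neg]
  have hsum : k.val 2 0 * m 0 2 + k.val 2 1 * m 1 2 + k.val 2 2 * m 2 2 = 1 := by
    have h1 : (k * k⁻¹).val 2 2 = 1 := by simp
    rwa [Units.val_mul, Matrix.mul_apply, Fin.sum_univ_three] at h1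
  have hv11 : val F (k.val 1 1) = 1 := val_eq_one_of_sub_mem (by omega) k11
  -- If `k 2 2` is a unit, h is in the cell. If not, the relation `hsum` forces `k 2 0` to have
  -- valuation exactly n; divided by d it becomes a unit, and exchanging the columns puts h in the
  -- cell.
  by_cases h22 : k.val 2 2 ∈ pPow F 1
  · have h20 : k.val 2 0 ∉ pPow F (n + 1) := by
      intro h20
      have : (1 : F) ∈ pPow F 1 := by
        rw [← hsum]
        exact pPow_add_mem (pPow_add_mem (pPow_mul_mem (by omega) h20 m02)
          (pPow_mul_mem (by omega) k21 m12)) (pPow_mul_mem (by omega) h22 m22)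
      rw [mem_pPow, map_one, ← exp_zero, exp_le_exp] at this
      omega
    right
    refine inCell_of_rows hn (a₂ := a₂) (a₃ := a₃) (y := y)
      (r := ![k.val 2 2, k.val 2 1, k.val 2 0 * (d⁻¹ : Fˣ)])
      (s := ![k.val 1 2, k.val 1 1, k.val 1 0 * (d⁻¹ : Fˣ)]) ?_ ?_ (by exact k22) (by exact k21)
      ?_ (by exact k12) (by exact hv11) (by exact pPow_mul_mem (by omega) k10 hdi)
    · intro j
      obtain ⟨h0, h1, h2⟩ := mul_wLong_apply h 2
      fin_cases j
      · refine h0.trans ?_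
        rw [e']; simp [torus, unip, Matrix.mul_apply, Fin.sum_univ_three, Matrix.vecMul, dotProduct]
      · refine h1.trans ?_
        rw [e']; simp [torus, unip, Matrix.mul_apply, Fin.sum_univ_three, Matrix.vecMul, dotProduct]
      · refine h2.trans ?_
        rw [e']; simp [torus, unip, Matrix.mul_apply, Fin.sum_univ_three, Matrix.vecMul, dotProduct, mul_assoc]
    · intro j
      obtain ⟨h0, h1, h2⟩ := mul_wLong_apply h 1
      fin_cases j
      · refine h0.trans ?_
        rw [e']; simp [torus, unip, Matrix.mul_apply, Fin.sum_univ_three, Matrix.vecMul, dotProduct]; ring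
      · refine h1.trans ?_
        rw [e']; simp [torus, unip, Matrix.mul_apply, Fin.sum_univ_three, Matrix.vecMul, dotProduct]; ring
      · refine h2.trans ?_
        rw [e']; simp [torus, unip, Matrix.mul_apply, Fin.sum_univ_three, Matrix.vecMul, dotProduct]; ring
    · change val F (k.val 2 0 * (d⁻¹ : Fˣ)) = 1
      have : k.val 2 0 ∈ shell F (-n) := by
        rw [shell_eq, neg_neg]; exact ⟨k20, h20⟩
      rw [map_mul, this.out, Units.val_inv_eq_inv_val, map_inv₀, hd, mul_inv_cancel₀ exp_ne_zero]
  · left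
    refine inCell_of_rows hn (a₂ := a₂) (a₃ := a₃) (y := y)
      (r := ![k.val 2 0 * (d⁻¹ : Fˣ), k.val 2 1, k.val 2 2])
      (s := ![k.val 1 0 * (d⁻¹ : Fˣ), k.val 1 1, k.val 1 2]) ?_ ?_
      (by exact pPow_mul_mem (by omega) k20 hdi) (by exact k21)
      ?_ (by exact pPow_mul_mem (by omega) k10 hdi) (by exact hv11) (by exact k12)
    · intro j
      fin_cases j <;> rw [e'] <;>
        simp [torus, unip, Matrix.mul_apply, Fin.sum_univ_three, Matrix.vecMul, dotProduct, mul_assoc]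
    · intro j
      fin_cases j <;> rw [e'] <;>
        simp [torus, unip, Matrix.mul_apply, Fin.sum_univ_three, Matrix.vecMul, dotProduct] <;> ring
    · change val F (k.val 2 2) = 1
      have : k.val 2 2 ∈ shell F 0 := by
        rw [shell_eq]; exact ⟨k22, h22⟩
      exact this

end Newform

end GLThree

namespace GLThree

/-! ### Congruence subgroups and smoothness of the newform -/

section Smooth

open WithZero Topology

variable {F : Type*} [Field F] [ValuativeRel F] [TopologicalSpace F] [IsNonarchimedeanLocalField F]

/-- `k` is congruent to `1` modulo `𝔭ᵉ`. -/
def CongrOne (e : ℤ) (k : GL (Fin 3) F) : Prop := ∀ i j, (k.val - 1) i j ∈ pPow F e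

/-- Writing k = 1 + M and k⁻¹ = 1 + B gives B = -M - MB. If an entry of B of maximal size were
larger than q⁻ᵉ, it would be strictly larger than every term on the right. -/
lemma CongrOne.inv {e : ℤ} (he : 0 < e) {k : GL (Fin 3) F} (hk : CongrOne e k) :
    CongrOne e k⁻¹ := by
  set M := k.val - 1 with hM
  set B := (k⁻¹ : GL (Fin 3) F).val - 1 with hB
  have hrel : B = -M - M * B := by
    have h1 : k.val * (k⁻¹ : GL (Fin 3) F).val = 1 := by simp
    have h2 : (1 + M) * (1 + B) = 1 := by rw [hM, hB]; simpa using h1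
    have h3 : B = (1 + M) * (1 + B) - 1 - M - M * B := by noncomm_ring
    calc B = (1 + M) * (1 + B) - 1 - M - M * B := h3
      _ = -M - M * B := by rw [h2]; noncomm_ring
  obtain ⟨⟨i₀, j₀⟩, -, hmax⟩ := Finset.exists_max_image (Finset.univ : Finset (Fin 3 × Fin 3))
    (fun p => val F (B p.1 p.2)) ⟨(0, 0), Finset.mem_univ _⟩
  have hmax' : ∀ i j, val F (B i j) ≤ val F (B i₀ j₀) := fun i j => hmax (i, j) (Finset.mem_univ _)
  have hmain : val F (B i₀ j₀) ≤ exp (-e) := by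
    by_contra hlt
    rw [not_le] at hlt
    have hterm : ∀ l, val F (M i₀ l * B l j₀) < val F (B i₀ j₀) := by
      intro l
      rw [map_mul]
      calc val F (M i₀ l) * val F (B l j₀) ≤ exp (-e) * val F (B i₀ j₀) := by
            gcongr
            exacts [hk i₀ l, hmax' l j₀]
        _ < 1 * val F (B i₀ j₀) := by
            refine mul_lt_mul_of_pos_right ?_ ((zero_le (a := exp (-e))).trans_lt hlt)
            rw [← exp_zero, exp_lt_exp]; omega
        _ = _ := one_mul _
    have h1 : B i₀ j₀ = -M i₀ j₀ - (M i₀ 0 * B 0 j₀ + M i₀ 1 * B 1 j₀ + M i₀ 2 * B 2 j₀) := by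
      conv_lhs => rw [hrel]
      simp [Matrix.mul_apply, Fin.sum_univ_three]
    have h2 : val F (B i₀ j₀) < val F (B i₀ j₀) := by
      conv_lhs => rw [h1]
      refine (val F).map_sub_lt ?_ ((val F).map_add_lt ((val F).map_add_lt
        (hterm 0) (hterm 1)) (hterm 2))
      rw [Valuation.map_neg]
      exact lt_of_le_of_lt (hk i₀ j₀) hlt
    exact lt_irrefl _ h2
  exact fun i j => (hmax' i j).trans hmain

lemma CongrOne.mem_orderSet {e : ℤ} {n : ℕ} (hn : n ≤ e) {k : GL (Fin 3) F} (hk : CongrOne e k) :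
    k.val ∈ orderSet F n := by
  have off : ∀ i j, i ≠ j → k.val i j ∈ pPow F e := fun i j hij => by
    simpa [Matrix.one_apply, hij] using hk i j
  have diag : ∀ i, k.val i i - 1 ∈ pPow F e := fun i => by
    simpa [Matrix.one_apply] using hk i i
  have diag' : ∀ i, k.val i i ∈ pPow F 0 := fun i => by
    have := pPow_add_mem (pPow_mono (by omega) (diag i)) (one_mem_pPow (F := F))
    rwa [sub_add_cancel] at this
  refine ⟨⟨diag' 0, pPow_mono ?_ (off 0 1 (by decide)), pPow_mono ?_ (off 0 2 (by decide))⟩,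
    ⟨pPow_mono ?_ (off 1 0 (by decide)), pPow_mono ?_ (diag 1),
      pPow_mono ?_ (off 1 2 (by decide))⟩, pPow_mono ?_ (off 2 0 (by decide)),
      pPow_mono ?_ (off 2 1 (by decide)), diag' 2⟩ <;> omega

lemma CongrOne.mem_levelGroup {e : ℤ} {n : ℕ} (he : 0 < e) (hn : n ≤ e) {k : GL (Fin 3) F}
    (hk : CongrOne e k) : k ∈ levelGroup F n :=
  ⟨hk.mem_orderSet hn, (hk.inv he).mem_orderSet hn⟩

lemma exists_pPow_entries (A : Matrix (Fin 3) (Fin 3) F) :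
    ∃ α : ℕ, ∀ i j, A i j ∈ pPow F (-α) := by
  choose N hN using fun i j => exists_mem_pPow (A i j)
  refine ⟨∑ i, ∑ j, N i j, fun i j => pPow_mono ?_ (hN i j)⟩
  have h1 : N i j ≤ ∑ j, N i j := Finset.single_le_sum (fun _ _ => Nat.zero_le _) (Finset.mem_univ j)
  have h2 : ∑ j, N i j ≤ ∑ i, ∑ j, N i j :=
    Finset.single_le_sum (f := fun i => ∑ j, N i j) (fun _ _ => Nat.zero_le _) (Finset.mem_univ i)
  omega

lemma exists_congrOne_conj (g : GL (Fin 3) F) :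
    ∃ α : ℕ, ∀ (e : ℤ) (k : GL (Fin 3) F), CongrOne (e + α) k → CongrOne e (g⁻¹ * k * g) := by
  obtain ⟨α, hα⟩ := exists_pPow_entries g.val
  obtain ⟨β, hβ⟩ := exists_pPow_entries (g⁻¹ : GL (Fin 3) F).val
  refine ⟨α + β, fun e k hk i j => ?_⟩
  have h1 : (g⁻¹ * k * g).val - 1 = (g⁻¹ : GL (Fin 3) F).val * (k.val - 1) * g.val := by
    have : (g⁻¹ : GL (Fin 3) F).val * g.val = 1 := by rw [← Units.val_mul]; simp
    rw [mul_sub, sub_mul, mul_one, this, Units.val_mul, Units.val_mul]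
  rw [h1]
  simp only [Matrix.mul_apply]
  refine (pSubgroup F e).sum_mem fun l _ => ?_
  refine pPow_mul_mem (i := e + α) (j := -α) (by omega) ?_ (hα l j)
  refine (pSubgroup F (e + α)).sum_mem fun l' _ => ?_
  exact pPow_mul_mem (i := -β) (by push_cast; omega) (hβ i l') (hk l' l)

lemma isOpen_orderSet (n : ℕ) : IsOpen (orderSet F n) := by
  have h : ∀ i j k, IsOpen {A : Matrix (Fin 3) (Fin 3) F | A i j ∈ pPow F k} := fun i j k =>
    (isOpen_pPow k).preimage (f := fun A : Matrix (Fin 3) (Fin 3) F => A i j) (by fun_prop)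
  have h' : ∀ i j k, IsOpen {A : Matrix (Fin 3) (Fin 3) F | A i j - 1 ∈ pPow F k} := fun i j k =>
    (isOpen_pPow k).preimage (f := fun A : Matrix (Fin 3) (Fin 3) F => A i j - 1) (by fun_prop)
  exact ((h _ _ _).inter ((h _ _ _).inter (h _ _ _))).inter
    (((h _ _ _).inter ((h' _ _ _).inter (h _ _ _))).inter
      ((h _ _ _).inter ((h _ _ _).inter (h _ _ _))))

lemma isOpen_levelGroup (n : ℕ) : IsOpen (levelGroup F n : Set (GL (Fin 3) F)) :=
  ((isOpen_orderSet n).preimage Units.continuous_val).inter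
    ((isOpen_orderSet n).preimage (Units.continuous_val.comp continuous_inv))

variable {μ₁ μ₂ μ₃ : Fˣ →ₜ* ℂˣ} {n : ℕ}

lemma newform_mem_principalSeries (hμ₁ : IsUnramified μ₁) (hμ₃ : IsUnramified μ₃)
    (hμ₂ : ∀ x ∈ unitFiltration F n, μ₂ x = 1) :
    newform μ₁ μ₂ μ₃ n ∈ principalSeries μ₁ μ₂ μ₃ := by
  refine ⟨?_, levelGroup F n, isOpen_levelGroup n,
    fun g k hk => newform_mul_right hμ₁ hμ₃ hμ₂ hk⟩
  rintro a₁ a₂ a₃ _ ⟨x, y, z, rfl⟩ g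
  exact newform_borel_mul hμ₁ hμ₃ hμ₂ _ _ _ _ _ _ _

lemma continuous_of_rightInvariant {f : GL (Fin 3) F → ℂ} {K : Subgroup (GL (Fin 3) F)}
    (hK : IsOpen (K : Set (GL (Fin 3) F))) (hf : ∀ g, ∀ k ∈ K, f (g * k) = f g) :
    Continuous f := by
  refine IsLocallyConstant.continuous ?_
  refine (IsLocallyConstant.iff_eventually_eq f).mpr fun g => ?_
  have h1 : (fun x => g⁻¹ * x) ⁻¹' (K : Set (GL (Fin 3) F)) ∈ 𝓝 g :=
    (show Continuous fun x => g⁻¹ * x by fun_prop).continuousAt.preimage_mem_nhds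
      (hK.mem_nhds (by simp [K.one_mem]))
  filter_upwards [h1] with x hx
  have := hf g _ hx
  rwa [mul_inv_cancel_left] at this

end Smooth

/-! ### Invariance of f(w u g) under translations of u far from the origin -/

section ShiftInvariance

open WithZero

variable {F : Type*} [Field F] [ValuativeRel F] [TopologicalSpace F] [IsNonarchimedeanLocalField F]

/-- A function on `GL₃(F)` which is left invariant under the unipotent group and under torus
elements congruent to `1` modulo `𝔭ᵉ`, and right invariant under matrices congruent to `1`. -/
structure IsInvariant (e : ℤ) (f : GL (Fin 3) F → ℂ) : Prop where
  unip_mul : ∀ x y z h, f (unip x y z * h) = f h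
  torus_mul : ∀ a₁ a₂ a₃ : Fˣ, (a₁ : F) - 1 ∈ pPow F e → (a₂ : F) - 1 ∈ pPow F e →
    (a₃ : F) - 1 ∈ pPow F e → ∀ h, f (torus a₁ a₂ a₃ * h) = f h
  mul_right : ∀ h k, CongrOne e k → f (h * k) = f h

lemma eq_of_mul_eq {e : ℤ} {f : GL (Fin 3) F → ℂ} (hf : IsInvariant e f) {h X : GL (Fin 3) F}
    {M : Matrix (Fin 3) (Fin 3) F} (hM : ∀ i j, M i j ∈ pPow F e)
    (hX : h.val * (1 + M) = X.val) : f X = f h := by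
  have hk : (h⁻¹ * X).val = 1 + M := by
    rw [Units.val_mul, ← hX, ← mul_assoc, ← Units.val_mul]
    simp
  have h1 := hf.mul_right h (h⁻¹ * X) fun i j => by
    rw [hk, add_sub_cancel_left]; exact hM i j
  rwa [mul_inv_cancel_left] at h1

lemma one_add_ne_zero {e : ℤ} (he : 0 < e) {δ : F} (hδ : δ ∈ pPow F e) : 1 + δ ≠ 0 := by
  intro h
  have h1 := val_eq_one_of_sub_mem (x := 1 + δ) he (by rwa [add_sub_cancel_left])
  simp [h] at h1

/-- The translation adds t times the second row of w u to the third. The rank one matrix M with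
column t c and row (0, 1, y) achieves this, because `hc` says that the third row pairs with c to 1.
Its effect on the first two rows consists of multiples of the second row, accounted for by a
unipotent and a torus factor on the left. -/
lemma invariant_shift_left {e : ℤ} (he : 0 < e) {f : GL (Fin 3) F → ℂ} (hf : IsInvariant e f)
    {x y z t : F} {c : Fin 3 → F} (hc : c 0 + x * c 1 + z * c 2 = 1)
    (hs : ∀ i, t * c i ∈ pPow F e) (hs' : ∀ i, t * c i * y ∈ pPow F e) :
    f (wLong F * unip (x + t) y (z + t * y)) = f (wLong F * unip x y z) := by
  set δ := t * c 1 + t * c 2 * y with hδ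
  have hδm : δ ∈ pPow F e := pPow_add_mem (hs 1) (hs' 2)
  have h1 := one_add_ne_zero he hδm
  rw [← eq_of_mul_eq hf (h := wLong F * unip x y z)
    (X := torus 1 (Units.mk0 _ h1) 1 * (unip (t * c 2) 0 0 * (wLong F * unip (x + t) y (z + t * y))))
    (M := Matrix.of fun i j => t * c i * (![0, 1, y] : Fin 3 → F) j),
    hf.torus_mul, hf.unip_mul]
  · simpa using zero_mem_pPow e
  · simpa using hδm
  · simpa using zero_mem_pPow e
  · intro i j
    fin_cases j
    · simpa using zero_mem_pPow e
    · simpa using hs i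
    · simpa using hs' i
  · have hc0 : c 0 = 1 - x * c 1 - z * c 2 := by rw [← hc]; ring
    ext i j; fin_cases i <;> fin_cases j <;>
      simp [torus, unip, wLong, Matrix.mul_apply, Fin.sum_univ_three, hc0] <;> (try rw [hδ]) <;> ring

/-- Now t times the first row of w u is to be added to the second. By `hc` and `hc'` the vector c
pairs to 0 with the third row and to 1 with the second. The vector s is the first row plus l times
the third; the surplus is absorbed by the unipotent group on the left, and the freedom in l serves
to keep M small when z is large. -/
lemma invariant_shift_mid {e : ℤ} (he : 0 < e) {f : GL (Fin 3) F → ℂ} (hf : IsInvariant e f)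
    {x y z t l : F} {c s : Fin 3 → F} (hc : c 0 + x * c 1 + z * c 2 = 0) (hc' : c 1 + y * c 2 = 1)
    (hs0 : s 0 = l) (hs1 : s 1 = l * x) (hs2 : s 2 = 1 + l * z)
    (hs : ∀ i j, t * c i * s j ∈ pPow F e) :
    f (wLong F * unip x (y + t) z) = f (wLong F * unip x y z) := by
  set δ := t * c 2 with hδ
  have hc0 : c 0 = - x * c 1 - z * c 2 := by linear_combination hc
  have hc1 : c 1 = 1 - y * c 2 := by linear_combination hc'
  -- δ is the trace of M.
  have hδm : δ ∈ pPow F e := by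
    have h2 : δ = t * c 0 * s 0 + t * c 1 * s 1 + t * c 2 * s 2 := by
      rw [hs0, hs1, hs2, hc0, hδ]; ring
    rw [h2]
    exact pPow_add_mem (pPow_add_mem (hs 0 0) (hs 1 1)) (hs 2 2)
  have h1 := one_add_ne_zero he hδm
  rw [← eq_of_mul_eq hf (h := wLong F * unip x y z)
    (X := torus (Units.mk0 _ h1) 1 1 * (unip 0 (t * l) (δ * l / (1 + δ)) *
      (wLong F * unip x (y + t) z)))
    (M := Matrix.of fun i j => t * c i * s j),
    hf.torus_mul, hf.unip_mul]
  · simpa using hδm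
  · simpa using zero_mem_pPow e
  · simpa using zero_mem_pPow e
  · intro i j
    exact hs i j
  · have hl : (1 + δ) * (δ * l / (1 + δ)) = δ * l := by field_simp
    generalize δ * l / (1 + δ) = v at hl
    ext i j; fin_cases i <;> fin_cases j <;>
      simp [torus, unip, wLong, Matrix.mul_apply, Fin.sum_univ_three, 
        hc0, hc1, hs0, hs1, hs2] <;>
      first
        | ring1
        | linear_combination -hl - l * hδ
        | linear_combination -x * hl - l * x * hδ
        | linear_combination -z * hl - (1 + l * z) * hδ

/-- `|a| ≥ q ^ (N + r)` and `|a| ≥ q ^ N |b|`. -/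
def Dominates (N r : ℤ) (a b : F) : Prop := exp (N + r) ≤ val F a ∧ exp N * val F b ≤ val F a

lemma Dominates.ne_zero {N r : ℤ} {a b : F} (h : Dominates N r a b) : a ≠ 0 := by
  rintro rfl
  have := h.1
  simp at this

lemma Dominates.div_mem {e r : ℤ} {a b t : F} (h : Dominates (e + r) r a b)
    (ht : t ∈ pPow F (-r)) : t / a ∈ pPow F (e + r) := by
  obtain ⟨k, hk⟩ := exists_val_eq_exp h.ne_zero
  have h1 := h.1
  rw [hk, exp_le_exp] at h1
  rw [div_eq_mul_inv]
  refine pPow_mul_mem (j := k) (by omega) ht ?_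
  rw [mem_pPow, map_inv₀, hk, exp_neg]

lemma Dominates.div_mul_mem {e r : ℤ} {a b t : F} (h : Dominates (e + r) r a b)
    (ht : t ∈ pPow F (-r)) : t / a * b ∈ pPow F e := by
  obtain ⟨k, hk⟩ := exists_val_eq_exp h.ne_zero
  have h1 : b / a ∈ pPow F (e + r) := by
    rw [mem_pPow, map_div₀, exp_neg]
    refine div_le_of_le_mul₀ zero_le zero_le ?_
    rw [inv_mul_eq_div, le_div_iff₀ (by simp), mul_comm]
    exact h.2
  rw [show t / a * b = t * (b / a) by ring]
  exact pPow_mul_mem (by omega) ht h1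

lemma invariant_left {e r : ℤ} (he : 0 < e) (hr : 0 ≤ r) {f : GL (Fin 3) F → ℂ}
    (hf : IsInvariant e f) {x y z t : F} (ht : t ∈ pPow F (-r))
    (h : Dominates (e + r) r x y ∨ Dominates (e + r) r z y) :
    f (wLong F * unip (x + t) y (z + t * y)) = f (wLong F * unip x y z) := by
  have h0 := zero_mem_pPow (F := F) e
  rcases h with h | h
  · have := h.ne_zero
    refine invariant_shift_left he hf (c := ![0, 1 / x, 0]) (by simp; field_simp) ?_ ?_
    · intro i
      fin_cases i
      · simpa using h0
      · simpa [div_eq_mul_inv] using pPow_mono (by omega) (h.div_mem ht)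
      · simpa using h0
    · intro i
      fin_cases i
      · simpa using h0
      · simpa [div_eq_mul_inv] using h.div_mul_mem ht
      · simpa using h0
  · have := h.ne_zero
    refine invariant_shift_left he hf (c := ![0, 0, 1 / z]) (by simp; field_simp) ?_ ?_
    · intro i
      fin_cases i
      · simpa using h0
      · simpa using h0
      · simpa [div_eq_mul_inv] using pPow_mono (by omega) (h.div_mem ht)
    · intro i
      fin_cases i
      · simpa using h0
      · simpa using h0
      · simpa [div_eq_mul_inv] using h.div_mul_mem ht

/-- If z is bounded or |z| ≤ |x|, the choice l = 0 already gives a small M. Otherwise l = -1/z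
removes the last entry of s and leaves -1/z and -x/z, which are integral and compensate a factor z
in c. -/
lemma invariant_mid_aux {e r : ℤ} (he : 0 < e) (hr : 0 ≤ r) {f : GL (Fin 3) F → ℂ}
    (hf : IsInvariant e f) {x y z t a : F} (ht : t ∈ pPow F (-r)) (h : Dominates (e + r) r a x)
    {c : Fin 3 → F} (hc : c 0 + x * c 1 + z * c 2 = 0) (hc' : c 1 + y * c 2 = 1)
    (hca : ∀ i, c i = 0 ∨ c i = z / a ∨ c i = - (z / a) ∨ c i = x / a ∨ c i = 1 / a) :
    f (wLong F * unip x (y + t) z) = f (wLong F * unip x y z) := by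
  have h0 := zero_mem_pPow (F := F) e
  have ha := h.ne_zero
  have h1 := h.div_mem ht
  have h1' := pPow_mono (show e ≤ e + r by omega) h1
  have h2 := h.div_mul_mem ht
  by_cases hz : z ∈ pPow F (-r) ∨ val F z ≤ val F x
  · have h3 : t / a * z ∈ pPow F e := by
      rcases hz with hz | hz
      · exact pPow_mul_mem (by omega) h1 hz
      · rw [mem_pPow, map_mul] at h2 ⊢
        refine le_trans ?_ h2
        gcongr
    have h4 : ∀ i, t * c i ∈ pPow F e := by
      intro i
      rcases hca i with h | h | h | h | h <;> rw [h]
      · simpa using h0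
      · rwa [show t * (z / a) = t / a * z by ring]
      · rw [show t * -(z / a) = -(t / a * z) by ring]; exact pPow_neg_mem h3
      · rwa [show t * (x / a) = t / a * x by ring]
      · rwa [mul_one_div]
    refine invariant_shift_mid he hf (l := 0) (s := ![0, 0, 1]) hc hc' rfl (by simp) (by simp) ?_
    intro i j
    fin_cases j
    · simpa using h0
    · simpa using h0
    · simpa using h4 i
  · rw [not_or, not_le] at hz
    obtain ⟨hz1, hz2⟩ := hz
    have hz0 : z ≠ 0 := by
      rintro rfl
      exact hz1 (zero_mem_pPow _)
    have h5 : 1 / z ∈ pPow F 0 := by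
      obtain ⟨k, hk⟩ := exists_val_eq_exp hz0
      rw [mem_pPow, neg_neg, hk, exp_le_exp] at hz1
      rw [mem_pPow, one_div, map_inv₀, hk, ← exp_neg, exp_le_exp]
      omega
    have h6 : x / z ∈ pPow F 0 := by
      rw [mem_pPow, map_div₀, neg_zero, exp_zero]
      exact div_le_one_of_le₀ hz2.le zero_le
    have h4 : ∀ i, ∀ v : F, (v = 1 ∨ v = x) → t * c i * (v / z) ∈ pPow F e := by
      have hv : ∀ v : F, (v = 1 ∨ v = x) → t / a * v ∈ pPow F e ∧ v / z ∈ pPow F 0 := by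
        rintro v (rfl | rfl)
        · exact ⟨by rwa [mul_one], h5⟩
        · exact ⟨h2, h6⟩
      intro i v hv'
      obtain ⟨hv1, hv2⟩ := hv v hv'
      rcases hca i with h | h | h | h | h <;> rw [h]
      · simpa using h0
      · rwa [show t * (z / a) * (v / z) = t / a * v by field_simp]
      · rw [show t * -(z / a) * (v / z) = -(t / a * v) by field_simp]; exact pPow_neg_mem hv1
      · rw [show t * (x / a) * (v / z) = t / a * x * (v / z) by ring]
        exact pPow_mul_mem (by omega) h2 hv2
      · rw [mul_one_div]
        exact pPow_mul_mem (by omega) h1' hv2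
    refine invariant_shift_mid he hf (l := -(1 / z)) (s := ![-(1 / z), -(x / z), 0]) hc hc' rfl
      (by simp; ring) (by simp [hz0]) ?_
    intro i j
    fin_cases j
    · simpa using pPow_neg_mem (h4 i 1 (Or.inl rfl))
    · simpa using pPow_neg_mem (h4 i x (Or.inr rfl))
    · simpa using h0

/-- The two witnesses are the solutions of the linear equations `hc`, `hc'` with c 1 = 0 and with c
0 = 0, whose denominators are y and xy - z. -/
lemma invariant_mid {e r : ℤ} (he : 0 < e) (hr : 0 ≤ r) {f : GL (Fin 3) F → ℂ}
    (hf : IsInvariant e f) {x y z t : F} (ht : t ∈ pPow F (-r))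
    (h : Dominates (e + r) r y x ∨ Dominates (e + r) r (x * y - z) x) :
    f (wLong F * unip x (y + t) z) = f (wLong F * unip x y z) := by
  rcases h with h | h
  · have := h.ne_zero
    refine invariant_mid_aux he hr hf ht h (c := ![-(z / y), 0, 1 / y]) ?_ ?_ ?_
    · simp; ring
    · simp [this]
    · intro i; fin_cases i <;> simp
  · have := h.ne_zero
    refine invariant_mid_aux he hr hf ht h (c := ![0, -(z / (x * y - z)), x / (x * y - z)]) ?_ ?_ ?_
    · simp; ring
    · simp; field_simp; ring
    · intro i; fin_cases i <;> simp

end ShiftInvariance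

end GLThree

namespace GLThree

/-! ### The regions of U₃ that contribute nothing -/

section Stable

open WithZero Topology

variable {F : Type*} [Field F] [ValuativeRel F] [TopologicalSpace F] [IsNonarchimedeanLocalField F]

lemma exists_isInvariant_newform {μ₁ μ₂ μ₃ : Fˣ →ₜ* ℂˣ} {n : ℕ} (hμ₁ : IsUnramified μ₁)
    (hμ₃ : IsUnramified μ₃) (hμ₂ : ∀ x ∈ unitFiltration F n, μ₂ x = 1) (g : GL (Fin 3) F) :
    ∃ e : ℤ, 0 < e ∧ IsInvariant e fun h => newform μ₁ μ₂ μ₃ n (h * g) := by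
  obtain ⟨α, hα⟩ := exists_congrOne_conj g
  have hone : torus (1 : Fˣ) 1 1 = 1 := by
    ext i j; fin_cases i <;> fin_cases j <;> simp [torus]
  have hunip : unip (0 : F) 0 0 = 1 := by
    ext i j; fin_cases i <;> fin_cases j <;> simp [unip]
  -- `α` is what conjugation by g costs; the remaining n + 1 is positive and large enough for the
  -- conjugate to lie in K_n.
  refine ⟨n + 1 + α, by omega, fun x y z h => ?_, fun a₁ a₂ a₃ h₁ h₂ h₃ h => ?_, fun h k hk => ?_⟩
  · have := newform_borel_mul hμ₁ hμ₃ hμ₂ 1 1 1 x y z (h * g)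
    rw [hone, one_mul, ← mul_assoc] at this
    rw [this]
    simp [borelWeight, absF]
  · have := newform_borel_mul hμ₁ hμ₃ hμ₂ a₁ a₂ a₃ 0 0 0 (h * g)
    rw [hunip, mul_one, ← mul_assoc] at this
    have v1 := val_eq_one_of_sub_mem (by omega) h₁
    have v2 := val_eq_one_of_sub_mem (by omega) h₂
    have v3 := val_eq_one_of_sub_mem (by omega) h₃
    have v13 : val F ((a₁ / a₃ : Fˣ) : F) = 1 := by simp [v1, v3]
    rw [this, borelWeight, unramified_apply hμ₁ v1, unramified_apply hμ₃ v3,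
      hμ₂ a₂ ⟨v2, pPow_mono (by omega) h₂⟩, absF_eq_one v13]
    simp
  · have h1 : h * k * g = h * g * (g⁻¹ * k * g) := by group
    rw [h1]
    exact newform_mul_right hμ₁ hμ₃ hμ₂ ((hα _ _ hk).mem_levelGroup (by omega) (by omega))

lemma continuous_unipCoord : Continuous (unipCoord : F × F × F → unipGroup F) := by
  refine Continuous.subtype_mk (Units.continuous_iff.mpr ⟨?_, ?_⟩) _
  · refine continuous_matrix fun i j => ?_
    fin_cases i <;> fin_cases j <;> simp [unip] <;> fun_prop
  · change Continuous fun p : F × F × F => !![1, -p.1, p.1 * p.2.1 - p.2.2; 0, 1, -p.2.1; 0, 0, 1]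
    refine continuous_matrix fun i j => ?_
    fin_cases i <;> fin_cases j <;> simp <;> fun_prop

/-- The coordinates of a unipotent matrix. -/
def coord (u : unipGroup F) : F × F × F := (u.1.val 0 1, u.1.val 1 2, u.1.val 0 2)

lemma continuous_coord : Continuous (coord : unipGroup F → F × F × F) := by
  have h : ∀ i j, Continuous fun u : unipGroup F => u.1.val i j := fun i j =>
    (show Continuous fun A : Matrix (Fin 3) (Fin 3) F => A i j by fun_prop).comp
      (Units.continuous_val.comp continuous_subtype_val)
  exact (h 0 1).prodMk ((h 1 2).prodMk (h 0 2))

lemma coord_unipCoord (p : F × F × F) : coord (unipCoord p) = p := by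
  simp [coord, unipCoord, unip]

lemma unipCoord_coord (u : unipGroup F) : unipCoord (coord u) = u := by
  obtain ⟨_, x, y, z, rfl⟩ := u
  simp [coord, unipCoord, unip]

lemma isCompact_preimage_unipCoord {V : Set (unipGroup F)} (hV : IsCompact V) :
    IsCompact {p : F × F × F | unipCoord p ∈ V} := by
  have : {p : F × F × F | unipCoord p ∈ V} = coord '' V := by
    ext p
    refine ⟨fun h => ⟨_, h, coord_unipCoord p⟩, ?_⟩
    rintro ⟨u, hu, rfl⟩
    simpa [unipCoord_coord] using hu
  rw [this]
  exact hV.image continuous_coord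

lemma isOpen_dominates {X : Type*} [TopologicalSpace X] (N r : ℤ) {a b : X → F}
    (ha : Continuous a) (hb : Continuous b) : IsOpen {p | Dominates N r (a p) (b p)} := by
  have : {p | Dominates N r (a p) (b p)} =
      ⋃ k : Set.Ici (N + r), (a ⁻¹' shell F k) ∩ (b ⁻¹' pPow F (N - k)) := by
    ext p
    simp only [Set.mem_ofPred_eq, Set.mem_iUnion]
    constructor
    · intro h
      obtain ⟨k, hk⟩ := exists_val_eq_exp h.ne_zero
      have h1 := h.1
      have h2 := h.2
      rw [hk, exp_le_exp] at h1
      refine ⟨⟨k, h1⟩, hk, ?_⟩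
      rw [Set.mem_preimage, mem_pPow, show -(N - k) = -N + k by ring, exp_add, exp_neg,
        le_inv_mul_iff₀ (by simp), ← hk]
      exact h2
    · rintro ⟨⟨k, h1⟩, hk, h2⟩
      rw [Set.mem_preimage, mem_pPow, show -(N - k) = -N + k by ring, exp_add, exp_neg,
        le_inv_mul_iff₀ (by simp), ← hk.out] at h2
      exact ⟨by rw [hk.out, exp_le_exp]; exact h1, h2⟩
  rw [this]
  exact isOpen_iUnion fun k => ((isOpen_shell _).preimage ha).inter ((isOpen_pPow _).preimage hb)

lemma val_add_eq_left {x y : F} (h : val F y < val F x) : val F (x + y) = val F x :=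
  (val F).map_add_eq_of_lt_left h

lemma Dominates.add_right {N r : ℤ} {a b t : F} (ht : t ∈ pPow F (-r))
    (h : Dominates N r a b) : Dominates N r a (b + t) := by
  refine ⟨h.1, ?_⟩
  rw [mem_pPow, neg_neg] at ht
  have h1 : val F (b + t) ≤ max (val F b) (val F t) := (val F).map_add b t
  rcases le_max_iff.mp h1 with h2 | h2
  · exact le_trans (by gcongr) h.2
  · refine le_trans ?_ h.1
    rw [exp_add]
    gcongr
    exact h2.trans ht

lemma Dominates.add_left {N r : ℤ} (hN : 0 < N) {a b t : F} (ht : t ∈ pPow F (-r))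
    (h : Dominates N r a b) : Dominates N r (a + t) b := by
  rw [mem_pPow, neg_neg] at ht
  have h1 : val F t < val F a := by
    refine lt_of_le_of_lt ht (lt_of_lt_of_le ?_ h.1)
    rw [exp_lt_exp]; omega
  rw [Dominates, val_add_eq_left h1]
  exact h

lemma Dominates.add_mul_left {N r : ℤ} (hr : r < N) {a b t : F}
    (ht : t ∈ pPow F (-r)) (h : Dominates N r a b) : Dominates N r (a + t * b) b := by
  rw [mem_pPow, neg_neg] at ht
  have h1 : val F (t * b) < val F a := by
    by_cases hb : b = 0
    · rw [hb, mul_zero, map_zero]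
      exact lt_of_lt_of_le (by simp) h.1
    · refine lt_of_lt_of_le ?_ h.2
      rw [map_mul]
      refine mul_lt_mul_of_pos_right (lt_of_le_of_lt ht (by rw [exp_lt_exp]; exact hr)) ?_
      simpa [zero_lt_iff] using hb
  rw [Dominates, val_add_eq_left h1]
  exact h

/-- The part of `U₃` where the integrand is invariant under left translation in the first
coordinate. -/
def regionLeft (F : Type*) [Field F] [ValuativeRel F] [TopologicalSpace F]
    [IsNonarchimedeanLocalField F] (N r : ℤ) : Set (F × F × F) :=
  {p | Dominates N r p.1 p.2.1 ∨ Dominates N r p.2.2 p.2.1}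

/-- The part of `U₃` where the integrand is invariant under left translation in the second
coordinate. -/
def regionMid (F : Type*) [Field F] [ValuativeRel F] [TopologicalSpace F]
    [IsNonarchimedeanLocalField F] (N r : ℤ) : Set (F × F × F) :=
  {p | Dominates N r p.2.1 p.1 ∨ Dominates N r (p.1 * p.2.1 - p.2.2) p.1}

lemma isOpen_regionLeft (N r : ℤ) : IsOpen (regionLeft F N r) :=
  (isOpen_dominates N r (by fun_prop) (by fun_prop)).union
    (isOpen_dominates N r (by fun_prop) (by fun_prop))

lemma isOpen_regionMid (N r : ℤ) : IsOpen (regionMid F N r) :=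
  (isOpen_dominates N r (by fun_prop) (by fun_prop)).union
    (isOpen_dominates N r (by fun_prop) (by fun_prop))

/-- Left translation by the unipotent matrix with first coordinate `t`. -/
def shiftLeft (t : F) : (F × F × F) ≃ₜ (F × F × F) where
  toFun p := (p.1 + t, p.2.1, p.2.2 + t * p.2.1)
  invFun p := (p.1 - t, p.2.1, p.2.2 - t * p.2.1)
  left_inv p := by ext <;> simp
  right_inv p := by ext <;> simp
  continuous_toFun := by fun_prop
  continuous_invFun := by fun_prop

/-- Left translation by the unipotent matrix with second coordinate `t`. -/
def shiftMid (t : F) : (F × F × F) ≃ₜ (F × F × F) where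
  toFun p := (p.1, p.2.1 + t, p.2.2)
  invFun p := (p.1, p.2.1 - t, p.2.2)
  left_inv p := by ext <;> simp
  right_inv p := by ext <;> simp
  continuous_toFun := by fun_prop
  continuous_invFun := by fun_prop

lemma unipCoord_shiftLeft (t : F) (p : F × F × F) :
    unipCoord (shiftLeft t p) = unipCoord (t, 0, 0) * unipCoord p := by
  ext1
  simp [unipCoord, shiftLeft, unip_mul, add_comm]

lemma unipCoord_shiftMid (t : F) (p : F × F × F) :
    unipCoord (shiftMid t p) = unipCoord (0, t, 0) * unipCoord p := by
  ext1
  simp [unipCoord, shiftMid, unip_mul, add_comm]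

lemma shift_mem_iff {s : F → (F × F × F) → F × F × F} {E : Set (F × F × F)} {r : ℤ}
    (hs : ∀ t p, s (-t) (s t p) = p) (h : ∀ t ∈ pPow F (-r), ∀ p ∈ E, s t p ∈ E) {t : F}
    (ht : t ∈ pPow F (-r)) (p : F × F × F) : s t p ∈ E ↔ p ∈ E := by
  refine ⟨fun hp => ?_, h t ht p⟩
  have := h (-t) (pPow_neg_mem ht) _ hp
  rwa [hs] at this

lemma shiftLeft_neg (t : F) (p : F × F × F) : shiftLeft (-t) (shiftLeft t p) = p := by
  ext <;> simp [shiftLeft]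

lemma shiftMid_neg (t : F) (p : F × F × F) : shiftMid (-t) (shiftMid t p) = p := by
  ext <;> simp [shiftMid]

variable {N r : ℤ}

lemma shiftLeft_mem_regionLeft (hN : 0 < N) (hr : r < N) {t : F} (ht : t ∈ pPow F (-r))
    (p : F × F × F) : shiftLeft t p ∈ regionLeft F N r ↔ p ∈ regionLeft F N r := by
  refine shift_mem_iff (s := fun t => shiftLeft t) shiftLeft_neg ?_ ht p
  rintro t ht ⟨x, y, z⟩ (h | h)
  · exact Or.inl (h.add_left hN ht)
  · exact Or.inr (h.add_mul_left hr ht)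

lemma shiftMid_mem_regionMid (hN : 0 < N) (hr : r < N) {t : F} (ht : t ∈ pPow F (-r))
    (p : F × F × F) : shiftMid t p ∈ regionMid F N r ↔ p ∈ regionMid F N r := by
  refine shift_mem_iff (s := fun t => shiftMid t) shiftMid_neg ?_ ht p
  rintro t ht ⟨x, y, z⟩ (h | h)
  · exact Or.inl (h.add_left hN ht)
  · refine Or.inr ?_
    have := h.add_mul_left hr ht
    change Dominates N r (x * (y + t) - z) x
    convert this using 1
    ring

/-- In `regionLeft` the coordinate y occurs only as the dominated quantity, so a small change of it
does no harm. This allows `regionLeft` to be removed before the second shift is applied. -/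
lemma shiftMid_mem_regionLeft {t : F} (ht : t ∈ pPow F (-r))
    (p : F × F × F) : shiftMid t p ∈ regionLeft F N r ↔ p ∈ regionLeft F N r := by
  refine shift_mem_iff (s := fun t => shiftMid t) shiftMid_neg ?_ ht p
  rintro t ht ⟨x, y, z⟩ (h | h)
  · exact Or.inl (h.add_right ht)
  · exact Or.inr (h.add_right ht)

/-- Outside the two regions the coordinates are bounded. -/
lemma bounded_of_notMem_regions (hN : 0 < N) (hr : 0 ≤ r) {p : F × F × F}
    (h1 : p ∉ regionLeft F N r) (h2 : p ∉ regionMid F N r) :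
    p.1 ∈ pPow F (-(3 * N + r)) ∧ p.2.1 ∈ pPow F (-(3 * N + r)) ∧ p.2.2 ∈ pPow F (-(3 * N + r)) := by
  obtain ⟨x, y, z⟩ := p
  simp only [regionLeft, regionMid, Dominates, Set.mem_ofPred_eq, not_or, not_and_or, not_le,
    lt_exp_iff] at h1 h2
  obtain ⟨hx, hz⟩ := h1
  obtain ⟨hy, hz'⟩ := h2
  have key : ∀ {a b : F} {k : ℤ}, (val F a ≤ exp (N + r - 1) ∨ val F a < exp N * val F b) →
      val F b ≤ exp k → r ≤ k → val F a ≤ exp (N + k - 1) := by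
    intro a b k h hb hk
    rcases h with h | h
    · exact h.trans (by rw [exp_le_exp]; omega)
    · rw [← lt_exp_iff, exp_add]
      exact lt_of_lt_of_le h (by gcongr)
  have dich : ∀ a : F, val F a ≤ exp r ∨ ∃ k : ℤ, r < k ∧ val F a = exp k := by
    intro a
    by_cases ha : val F a ≤ exp r
    · exact Or.inl ha
    · have ha0 : a ≠ 0 := by rintro rfl; simp at ha
      obtain ⟨k, hk⟩ := exists_val_eq_exp ha0
      rw [hk, exp_le_exp] at ha
      exact Or.inr ⟨k, by omega, hk⟩
  simp only [mem_pPow, neg_neg]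
  have fin : ∀ {kx ky : ℤ}, val F x ≤ exp kx → val F y ≤ exp ky → kx ≤ 2 * N + r →
      ky ≤ 2 * N + r → r ≤ ky → val F x ≤ exp (3 * N + r) ∧ val F y ≤ exp (3 * N + r) ∧
      val F z ≤ exp (3 * N + r) := by
    intro kx ky hkx hky h1 h2 h3
    refine ⟨hkx.trans ?_, hky.trans ?_, (key hz hky h3).trans ?_⟩ <;> rw [exp_le_exp] <;> omega
  rcases dich x with hx1 | ⟨kx, hkx, hvx⟩
  · exact fin hx1 (key hy hx1 le_rfl) (by omega) (by omega) (by omega)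
  rcases dich y with hy1 | ⟨ky, hky, hvy⟩
  · exact fin (key hx hy1 le_rfl) hy1 (by omega) (by omega) le_rfl
  have b1 := key hx hvy.le hky.le
  have b2 := key hy hvx.le hkx.le
  have b3 := key hz hvy.le hky.le
  have b4 := key hz' hvx.le hkx.le
  -- The identity xy = z + (xy - z) closes the argument: one summand is below qᴺ|y| and the other
  -- below qᴺ|x|, so |x| or |y| is below qᴺ, and `b1` or `b2` then bounds the other coordinate.
  have b5 : val F (x * y) ≤ max (val F z) (val F (x * y - z)) := by
    have := (val F).map_add z (x * y - z)
    rwa [add_sub_cancel] at this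
  rw [hvx, exp_le_exp] at b1
  rw [hvy, exp_le_exp] at b2
  rw [map_mul, hvx, hvy, ← exp_add] at b5
  refine fin hvx.le hvy.le ?_ ?_ (by omega)
  all_goals
    rcases le_max_iff.mp b5 with b6 | b6
    · have := b6.trans b3
      rw [exp_le_exp] at this
      omega
    · have := b6.trans b4
      rw [exp_le_exp] at this
      omega

end Stable

end GLThree

namespace GLThree

/-! ### The generic character and exhausting boxes in U₃ -/

section Unipotent

variable {F : Type*} [Field F]

lemma genericChar_mul (ψ : AddChar F Circle) (u v : unipGroup F) :
    genericChar ψ (u * v) = genericChar ψ u * genericChar ψ v := by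
  obtain ⟨_, x, y, z, rfl⟩ := u
  obtain ⟨_, x', y', z', rfl⟩ := v
  have : ((⟨unip x y z, _, _, _, rfl⟩ : unipGroup F) * ⟨unip x' y' z', _, _, _, rfl⟩ :
      unipGroup F).1 = unip (x + x') (y + y') (z + z' + x * y') := unip_mul ..
  simp only [genericChar, this]
  simp only [unip, Matrix.of_apply, Matrix.cons_val]
  rw [← Circle.coe_mul, ← AddChar.map_add_eq_mul]
  congr 2
  ring

lemma genericChar_unipCoord (ψ : AddChar F Circle) (p : F × F × F) :
    genericChar ψ (unipCoord p) = ψ p.1 * ψ p.2.1 := by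
  simp [genericChar, unipCoord, unip, AddChar.map_add_eq_mul]

lemma mul_mem_preimage_iff {V : Subgroup (unipGroup F)} {s : F × F × F → F × F × F}
    {v : F × F × F} (hv : unipCoord v ∈ V)
    (hs : ∀ p, unipCoord (s p) = unipCoord v * unipCoord p) (p : F × F × F) :
    s p ∈ {p | unipCoord p ∈ V} ↔ p ∈ {p : F × F × F | unipCoord p ∈ V} := by
  simp only [Set.mem_ofPred_eq, hs]
  exact V.mul_mem_cancel_left hv

lemma whittakerIntegrand_shift {ψ : AddChar F Circle} {f : GL (Fin 3) F → ℂ} {g : GL (Fin 3) F}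
    {s : F × F × F → F × F × F} {v p : F × F × F}
    (hs : unipCoord (s p) = unipCoord v * unipCoord p)
    (h : f (wLong F * (unipCoord (s p)).1 * g) = f (wLong F * (unipCoord p).1 * g)) :
    whittakerIntegrand ψ f g (unipCoord (s p)) =
      (genericChar ψ (unipCoord v))⁻¹ * whittakerIntegrand ψ f g (unipCoord p) := by
  rw [whittakerIntegrand, h, hs, genericChar_mul, whittakerIntegrand, mul_inv]
  ring

variable [ValuativeRel F] [TopologicalSpace F] [IsNonarchimedeanLocalField F]

lemma coord_mul (u v : unipGroup F) : coord (u * v) = ((coord u).1 + (coord v).1,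
    (coord u).2.1 + (coord v).2.1, (coord u).2.2 + (coord v).2.2 + (coord u).1 * (coord v).2.1) := by
  rw [← unipCoord_coord u, ← unipCoord_coord v]
  have : unipCoord (coord u) * unipCoord (coord v) = unipCoord ((coord u).1 + (coord v).1,
    (coord u).2.1 + (coord v).2.1, (coord u).2.2 + (coord v).2.2 + (coord u).1 * (coord v).2.1) :=
    Subtype.ext (unip_mul ..)
  rw [this]
  simp only [coord_unipCoord]

lemma coord_inv (u : unipGroup F) : coord u⁻¹ = (-(coord u).1, -(coord u).2.1,
    (coord u).1 * (coord u).2.1 - (coord u).2.2) := by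
  rw [← unipCoord_coord u]
  have : (unipCoord (coord u))⁻¹ = unipCoord (-(coord u).1, -(coord u).2.1,
    (coord u).1 * (coord u).2.1 - (coord u).2.2) := Subtype.ext (unip_inv ..)
  rw [this]
  simp only [coord_unipCoord]

/-- The group of unipotent matrices with coordinates in `𝔭⁻ᵏ × 𝔭⁻ᵏ × 𝔭⁻²ᵏ`. -/
def boxGroup (F : Type*) [Field F] [ValuativeRel F] [TopologicalSpace F]
    [IsNonarchimedeanLocalField F] (k : ℕ) : Subgroup (unipGroup F) where
  carrier := {u | coord u ∈ pPow F (-k) ×ˢ pPow F (-k) ×ˢ pPow F (-(2 * k))}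
  mul_mem' := by
    rintro u v ⟨h1, h2, h3⟩ ⟨h1', h2', h3'⟩
    rw [Set.mem_ofPred_eq, coord_mul]
    exact ⟨pPow_add_mem h1 h1', pPow_add_mem h2 h2',
      pPow_add_mem (pPow_add_mem h3 h3') (pPow_mul_mem (by omega) h1 h2')⟩
  one_mem' := by simp [coord, zero_mem_pPow]
  inv_mem' := by
    rintro u ⟨h1, h2, h3⟩
    rw [Set.mem_ofPred_eq, coord_inv]
    exact ⟨pPow_neg_mem h1, pPow_neg_mem h2,
      pPow_sub_mem (pPow_mul_mem (by omega) h1 h2) h3⟩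

lemma preimage_boxGroup (k : ℕ) : {p : F × F × F | unipCoord p ∈ boxGroup F k} =
    pPow F (-k) ×ˢ pPow F (-k) ×ˢ pPow F (-(2 * k)) := by
  ext p
  change coord (unipCoord p) ∈ pPow F (-k) ×ˢ pPow F (-k) ×ˢ pPow F (-(2 * k)) ↔ _
  rw [coord_unipCoord]

lemma coe_boxGroup (k : ℕ) : (boxGroup F k : Set (unipGroup F)) =
    unipCoord '' (pPow F (-k) ×ˢ pPow F (-k) ×ˢ pPow F (-(2 * k))) := by
  rw [← preimage_boxGroup]
  ext u
  refine ⟨fun h => ⟨coord u, by simpa [unipCoord_coord] using h, unipCoord_coord u⟩, ?_⟩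
  rintro ⟨p, hp, rfl⟩
  exact hp

lemma isCompact_boxGroup (k : ℕ) : IsCompact (boxGroup F k : Set (unipGroup F)) := by
  rw [coe_boxGroup]
  exact ((isCompact_pPow _).prod ((isCompact_pPow _).prod (isCompact_pPow _))).image
    continuous_unipCoord

lemma isExhaustion_boxGroup : IsExhaustion (boxGroup F) where
  isOpen k := ((isOpen_pPow (F := F) (-k)).prod ((isOpen_pPow (F := F) (-k)).prod
    (isOpen_pPow (F := F) (-(2 * k))))).preimage continuous_coord
  isCompact := isCompact_boxGroup
  mono := by
    intro k l h u hu
    exact ⟨pPow_mono (by omega) hu.1, pPow_mono (by omega) hu.2.1, pPow_mono (by omega) hu.2.2⟩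
  exhaust u := by
    obtain ⟨a, ha⟩ := exists_mem_pPow (coord u).1
    obtain ⟨b, hb⟩ := exists_mem_pPow (coord u).2.1
    obtain ⟨d, hd⟩ := exists_mem_pPow (coord u).2.2
    exact ⟨a + b + d, pPow_mono (by omega) ha, pPow_mono (by omega) hb, pPow_mono (by omega) hd⟩

lemma IsExhaustion.exists_subset {U : ℕ → Subgroup (unipGroup F)} (hU : IsExhaustion U)
    {K : Set (unipGroup F)} (hK : IsCompact K) : ∃ k, K ⊆ U k := by
  refine hK.elim_directed_cover (fun k => (U k : Set (unipGroup F))) hU.isOpen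
    (fun u _ => ?_) ?_
  · obtain ⟨k, hk⟩ := hU.exhaust u
    exact Set.mem_iUnion.mpr ⟨k, hk⟩
  · exact (show Monotone fun k => (U k : Set (unipGroup F)) from
      fun _ _ h => hU.mono h).directed_le

lemma continuous_whittakerIntegrand {ψ : AddChar F Circle} (hψ : Continuous ψ)
    {f : GL (Fin 3) F → ℂ} (hf : Continuous f) (g : GL (Fin 3) F) :
    Continuous fun p : F × F × F => whittakerIntegrand ψ f g (unipCoord p) := by
  simp only [whittakerIntegrand, genericChar_unipCoord, mul_inv]
  refine (hf.comp ?_).mul (((continuous_addChar_inv hψ).comp continuous_fst).mul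
    ((continuous_addChar_inv hψ).comp (continuous_fst.comp continuous_snd)))
  have := continuous_subtype_val.comp (continuous_unipCoord (F := F))
  exact (continuous_const.mul this).mul continuous_const

end Unipotent

/-! ### Existence of the stable integral and its evaluation on boxes -/

section StableIntegral

open WithZero Topology

variable {F : Type*} [Field F] [ValuativeRel F] [TopologicalSpace F] [IsNonarchimedeanLocalField F]
  [MeasurableSpace F] [BorelSpace F] {dx : Measure F} [dx.IsAddHaarMeasure]

lemma measurePreserving_shiftLeft (t : F) :
    MeasurePreserving (shiftLeft t) (dx.prod (dx.prod dx)) (dx.prod (dx.prod dx)) := by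
  have := secondCountableTopology (F := F)
  have h : MeasurePreserving (fun p : F × F => (p.1, p.2 + t * p.1)) (dx.prod dx)
      (dx.prod dx) := by
    refine MeasurePreserving.skew_product (g := fun y z => z + t * y) (MeasurePreserving.id dx)
      (by simp only [Function.uncurry_def]; fun_prop) (ae_of_all _ fun y => ?_)
    exact (measurePreserving_add_right dx (t * y)).map_eq
  exact (measurePreserving_add_right dx t).prod h

lemma measurePreserving_shiftMid (t : F) :
    MeasurePreserving (shiftMid t) (dx.prod (dx.prod dx)) (dx.prod (dx.prod dx)) := by
  have := secondCountableTopology (F := F)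
  exact (MeasurePreserving.id dx).prod
    ((measurePreserving_add_right dx t).prod (MeasurePreserving.id dx))

/-- Integrals over large compact open subgroups of `U₃` agree. -/
lemma exists_unipIntegral_eq {ψ : AddChar F Circle} (hψ : Continuous ψ)
    (hψ' : IsUnramifiedAddChar ψ) {f : GL (Fin 3) F → ℂ} (hfc : Continuous f) {g : GL (Fin 3) F}
    {e : ℤ} (he : 0 < e) (hf : IsInvariant e fun h => f (h * g)) :
    ∃ (L : ℂ) (R : ℕ), ∀ V : Subgroup (unipGroup F), IsOpen (V : Set (unipGroup F)) →
      IsCompact (V : Set (unipGroup F)) →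
      (∀ p : F × F × F, p.1 ∈ pPow F (-R) → p.2.1 ∈ pPow F (-R) → p.2.2 ∈ pPow F (-R) →
        unipCoord p ∈ V) → unipIntegral dx V (whittakerIntegrand ψ f g) = L := by
  have := secondCountableTopology (F := F)
  obtain ⟨t, ht, htne⟩ := hψ'.2
  have hc : ((ψ t : Circle) : ℂ)⁻¹ ≠ 1 := by
    intro h
    rw [inv_eq_one] at h
    exact htne (Circle.ext (by simpa using h))
  -- Here r = 1 because t ∈ 𝔭⁻¹, and the invariance lemmas require domination with N = e + r. The
  -- candidate for the stable value is the integral over the complement of both regions, which is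
  -- bounded.
  set A := regionLeft F (e + 1) 1
  set B := regionMid F (e + 1) 1
  refine ⟨∫ p in (A ∪ B)ᶜ, whittakerIntegrand ψ f g (unipCoord p) ∂(dx.prod (dx.prod dx)),
    (3 * (e + 1) + 1).toNat, fun V hVo hVc hV => ?_⟩
  have hRe : ((3 * (e + 1) + 1).toNat : ℤ) = 3 * (e + 1) + 1 := Int.toNat_of_nonneg (by omega)
  rw [hRe] at hV
  have hN : (0 : ℤ) < e + 1 := by omega
  have hr : (1 : ℤ) < e + 1 := by omega
  have ht' : t ∈ pPow F (-(3 * (e + 1) + 1)) := pPow_mono (by omega) ht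
  have hvl : unipCoord (t, 0, 0) ∈ V := hV _ ht' (zero_mem_pPow _) (zero_mem_pPow _)
  have hvm : unipCoord (0, t, 0) ∈ V := hV _ (zero_mem_pPow _) ht' (zero_mem_pPow _)
  have hA : MeasurableSet A := (isOpen_regionLeft _ _).measurableSet
  have hB : MeasurableSet B := (isOpen_regionMid _ _).measurableSet
  set S := {p : F × F × F | unipCoord p ∈ V}
  have hS : MeasurableSet S := (hVo.preimage continuous_unipCoord).measurableSet
  have hint : IntegrableOn (fun p => whittakerIntegrand ψ f g (unipCoord p)) S
      (dx.prod (dx.prod dx)) :=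
    (continuous_whittakerIntegrand hψ hfc g).continuousOn.integrableOn_compact'
      (isCompact_preimage_unipCoord hVc) hS
  have hSc : S \ (A ∪ B) = (A ∪ B)ᶜ := by
    ext p
    refine ⟨fun h => h.2, fun h => ⟨?_, h⟩⟩
    have h1 : p ∉ A := fun h' => h (Or.inl h')
    have h2 : p ∉ B := fun h' => h (Or.inr h')
    obtain ⟨b1, b2, b3⟩ := bounded_of_notMem_regions hN (by omega) h1 h2
    exact hV p b1 b2 b3
  have hleft := mul_mem_preimage_iff hvl (unipCoord_shiftLeft t)
  have hmid := mul_mem_preimage_iff hvm (unipCoord_shiftMid t)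
  have gl : genericChar ψ (unipCoord (t, 0, 0)) = ψ t := by simp [genericChar_unipCoord]
  have gm : genericChar ψ (unipCoord (0, t, 0)) = ψ t := by simp [genericChar_unipCoord]
  have z1 : ∫ p in S ∩ A, whittakerIntegrand ψ f g (unipCoord p) ∂(dx.prod (dx.prod dx)) = 0 := by
    refine setIntegral_eq_zero_of_eigen (measurePreserving_shiftLeft t)
      (shiftLeft t).measurableEmbedding (hS.inter hA)
      (fun p => and_congr (hleft p) (shiftLeft_mem_regionLeft hN hr ht p)) hc fun p hp => ?_
    rw [whittakerIntegrand_shift (unipCoord_shiftLeft t p), gl]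
    exact invariant_left he (by omega) hf ht hp.2
  -- The second shift preserves S, A and B, hence also the part of B that is left after the removal
  -- of A.
  have z2 : ∫ p in (S \ A) ∩ B, whittakerIntegrand ψ f g (unipCoord p)
      ∂(dx.prod (dx.prod dx)) = 0 := by
    refine setIntegral_eq_zero_of_eigen (measurePreserving_shiftMid t)
      (shiftMid t).measurableEmbedding ((hS.diff hA).inter hB)
      (fun p => and_congr (and_congr (hmid p) (not_congr (shiftMid_mem_regionLeft ht p)))
        (shiftMid_mem_regionMid hN hr ht p)) hc fun p hp => ?_
    rw [whittakerIntegrand_shift (unipCoord_shiftMid t p), gm]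
    exact invariant_mid he (by omega) hf ht hp.2
  rw [unipIntegral, ← integral_inter_add_sdiff hA hint, z1, zero_add,
    ← integral_inter_add_sdiff hB (hint.mono_set Set.sdiff_subset), z2, zero_add, Set.sdiff_sdiff, hSc]

/-- The stable integral exists. -/
lemma hasStableIntegral_whittaker {ψ : AddChar F Circle} (hψ : Continuous ψ)
    (hψ' : IsUnramifiedAddChar ψ) {f : GL (Fin 3) F → ℂ} (hfc : Continuous f) {g : GL (Fin 3) F}
    {e : ℤ} (he : 0 < e) (hf : IsInvariant e fun h => f (h * g)) :
    HasStableIntegral dx (whittakerIntegrand ψ f g) (whittaker dx ψ f g) := by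
  refine Classical.epsilon_spec (p := HasStableIntegral dx (whittakerIntegrand ψ f g)) ?_
  obtain ⟨L, R, hL⟩ := exists_unipIntegral_eq (dx := dx) hψ hψ' hfc he hf
  refine ⟨L, fun U hU => ?_⟩
  obtain ⟨k₀, hk₀⟩ := hU.exists_subset (isCompact_boxGroup R)
  filter_upwards [eventually_ge_atTop k₀] with k hk
  refine hL _ (hU.isOpen k) (hU.isCompact k) fun p h1 h2 h3 => hU.mono hk (hk₀ ?_)
  have : p ∈ {p : F × F × F | unipCoord p ∈ boxGroup F R} := by
    rw [preimage_boxGroup]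
    exact ⟨h1, h2, pPow_mono (by omega) h3⟩
  exact this

lemma hasStableIntegral_newform {ψ : AddChar F Circle} (hψ : Continuous ψ)
    (hψ' : IsUnramifiedAddChar ψ) {μ₁ μ₂ μ₃ : Fˣ →ₜ* ℂˣ} {n : ℕ} (hμ₁ : IsUnramified μ₁)
    (hμ₃ : IsUnramified μ₃) (hμ₂ : ∀ x ∈ unitFiltration F n, μ₂ x = 1) (g : GL (Fin 3) F) :
    HasStableIntegral dx (whittakerIntegrand ψ (newform μ₁ μ₂ μ₃ n) g)
      (whittaker dx ψ (newform μ₁ μ₂ μ₃ n) g) := by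
  obtain ⟨e, he, hf⟩ := exists_isInvariant_newform hμ₁ hμ₃ hμ₂ g
  exact hasStableIntegral_whittaker hψ hψ'
    (continuous_of_rightInvariant (isOpen_levelGroup n)
      fun g k hk => newform_mul_right hμ₁ hμ₃ hμ₂ hk) he hf

/-- The Whittaker function is the integral over every large box. -/
lemma eventually_whittaker_newform {ψ : AddChar F Circle} (hψ : Continuous ψ)
    (hψ' : IsUnramifiedAddChar ψ) {μ₁ μ₂ μ₃ : Fˣ →ₜ* ℂˣ} {n : ℕ} (hμ₁ : IsUnramified μ₁)
    (hμ₃ : IsUnramified μ₃) (hμ₂ : ∀ x ∈ unitFiltration F n, μ₂ x = 1) (g : GL (Fin 3) F) :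
    ∀ᶠ k : ℕ in atTop, whittaker dx ψ (newform μ₁ μ₂ μ₃ n) g =
      ∫ p in pPow F (-k) ×ˢ pPow F (-k) ×ˢ pPow F (-(2 * k)),
        whittakerIntegrand ψ (newform μ₁ μ₂ μ₃ n) g (unipCoord p) ∂(dx.prod (dx.prod dx)) := by
  filter_upwards [hasStableIntegral_newform (dx := dx) hψ hψ' hμ₁ hμ₃ hμ₂ g _
    isExhaustion_boxGroup] with k hk
  rw [← hk, unipIntegral, preimage_boxGroup]

lemma setIntegral_prod_prod {Φ : F × F × F → ℂ} (hΦ : Continuous Φ) {X Y Z : Set F}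
    (hX : IsCompact X) (hY : IsCompact Y) (hZ : IsCompact Z) :
    ∫ p in X ×ˢ Y ×ˢ Z, Φ p ∂(dx.prod (dx.prod dx)) =
      ∫ x in X, ∫ y in Y, ∫ z in Z, Φ (x, y, z) ∂dx ∂dx ∂dx := by
  have := secondCountableTopology (F := F)
  have := t2Space (F := F)
  rw [setIntegral_prod]
  · refine setIntegral_congr_fun hX.measurableSet fun x _ => ?_
    exact setIntegral_prod _ ((hΦ.comp (by fun_prop : Continuous fun p : F × F =>
      (x, p))).continuousOn.integrableOn_compact (hY.prod hZ))
  · exact hΦ.continuousOn.integrableOn_compact (hX.prod (hY.prod hZ))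

/-- Decomposition of a ball in the last coordinate into a smaller ball and shells. -/
lemma setIntegral_prod_shells {Φ : F × F × F → ℂ} (hΦ : Continuous Φ) {X Y : Set F}
    (hX : IsCompact X) (hY : IsCompact Y) (a : ℤ) (J : ℕ) :
    ∫ p in X ×ˢ Y ×ˢ pPow F (a - J), Φ p ∂(dx.prod (dx.prod dx)) =
      ∫ p in X ×ˢ Y ×ˢ pPow F a, Φ p ∂(dx.prod (dx.prod dx)) +
        ∑ j ∈ Finset.range J,
          ∫ p in X ×ˢ Y ×ˢ shell F (j + 1 - a), Φ p ∂(dx.prod (dx.prod dx)) := by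
  have := secondCountableTopology (F := F)
  have := t2Space (F := F)
  induction J with
  | zero => simp
  | succ J ih =>
    have hu : X ×ˢ Y ×ˢ pPow F (a - (J + 1 : ℕ)) =
        (X ×ˢ Y ×ˢ pPow F (a - J)) ∪ X ×ˢ Y ×ˢ shell F (J + 1 - a) := by
      rw [← Set.prod_union, ← Set.prod_union, shell_eq]
      congr 2
      rw [show -((J : ℤ) + 1 - a) = a - (J + 1 : ℕ) by push_cast; ring,
        show (a - (J + 1 : ℕ) : ℤ) + 1 = a - J by push_cast; ring, Set.union_sdiff_cancel]
      exact fun x hx => pPow_mono (by omega) hx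
    have hd : Disjoint (X ×ˢ Y ×ˢ pPow F (a - J)) (X ×ˢ Y ×ˢ shell F (J + 1 - a)) := by
      rw [shell_eq, show -((J : ℤ) + 1 - a) + 1 = a - J by ring]
      exact Set.Disjoint.set_prod_right (Set.Disjoint.set_prod_right Set.disjoint_sdiff_right _ _) _ _
    rw [hu, setIntegral_union hd, ih, Finset.sum_range_succ, add_assoc]
    · exact (hX.prod (hY.prod (isCompact_shell _))).measurableSet
    · exact hΦ.continuousOn.integrableOn_compact (hX.prod (hY.prod (isCompact_pPow _)))
    · exact hΦ.continuousOn.integrableOn_compact (hX.prod (hY.prod (isCompact_shell _)))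

end StableIntegral

end GLThree

namespace GLThree

/-! ### The newform along w u diag(a,1,b): the ball in z -/

section Values

open WithZero Topology

variable {F : Type*} [Field F]

lemma wLong_mul_unip_mul_torus_val (x y z : F) (a b : Fˣ) :
    (wLong F * unip x y z * torus a 1 b).val = !![0, 0, (b : F); 0, 1, y * b; (a : F), x, z * b] := by
  ext i j; fin_cases i <;> fin_cases j <;>
    simp [wLong, unip, torus, Matrix.mul_apply, Fin.sum_univ_three]

variable [ValuativeRel F] [TopologicalSpace F] [IsNonarchimedeanLocalField F]

variable {μ₁ μ₂ μ₃ : Fˣ →ₜ* ℂˣ} {c : ℕ} {x y z : F} {A b ϖ : Fˣ} {m n : ℤ}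

/-- `A` stands for a/ϖᶜ: the factor diag(ϖᶜ,1,1) is split off, as `newform_swap` and the description
of the support require. -/
lemma inCell_wLong_iff (hA : val F (A : F) = exp (c - m)) (hb : val F (b : F) = exp n) :
    InCell c (wLong F * unip x y z * torus A 1 b * wLong F).val ↔
      z ∈ pPow F (m + n - c) ∧ x ∈ pPow F m ∧ y ∈ pPow F n := by
  have h := mul_wLong_apply (wLong F * unip x y z * torus A 1 b)
  rw [wLong_mul_unip_mul_torus_val] at h
  have e1 : val F (z * b) ≤ val F (A : F) ↔ z ∈ pPow F (m + n - c) := by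
    rw [map_mul, hA, hb, mem_pPow, show (c - m : ℤ) = -(m + n - c) + n by ring, exp_add]
    exact mul_le_mul_iff_left₀ (by simp [zero_lt_iff])
  have e2 : val F x ≤ exp (-c : ℤ) * val F (A : F) ↔ x ∈ pPow F m := by
    rw [hA, ← exp_add, mem_pPow, show (-c + (c - m) : ℤ) = -m by ring]
  have e3 : val F (y * b * A) ≤ val F (A : F) ↔ y ∈ pPow F n := by
    rw [map_mul, map_mul, hA, hb, mem_pPow]
    conv_lhs => rhs; rw [show (c - m : ℤ) = -n + n + (c - m) by ring, exp_add, exp_add]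
    rw [mul_le_mul_iff_left₀ (by simp [zero_lt_iff]), mul_le_mul_iff_left₀ (by simp [zero_lt_iff])]
  rw [← e1, ← e2, ← e3]
  constructor
  · rintro ⟨-, -, h1, h2, h3⟩
    simp only [h] at h1 h2 h3
    simp at h1 h2 h3
    exact ⟨by simpa using h1, h2, by simpa using h3⟩
  · rintro ⟨h1, h2, h3⟩
    constructor <;> simp only [h] <;> simp
    · simpa using h1
    · simpa using h2
    · simpa using h3

/-- The second minor equals b z (1 - xy/z); this is where the argument 1 - xy/z of μ₂ comes from. -/
lemma inCell_iff (hA : val F (A : F) = exp (c - m)) (hb : val F (b : F) = exp n) (hz : z ≠ 0) :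
    InCell c (wLong F * unip x y z * torus A 1 b).val ↔
      (A : F) / b / z ∈ pPow F 0 ∧ x / z ∈ pPow F (c - n) ∧ 1 - x * y / z ≠ 0 ∧
        val F y * exp (c - m) ≤ val F z * val F (1 - x * y / z) := by
  have hb0 := b.ne_zero
  have hvz : 0 < val F z := by simpa [zero_lt_iff] using hz
  have e0 : z * b - y * b * x = b * (z * (1 - x * y / z)) := by field_simp
  have e1 : val F (A : F) ≤ val F (z * b) ↔ (A : F) / b / z ∈ pPow F 0 := by
    rw [mem_pPow, div_div, map_div₀, mul_comm (b : F), div_le_iff₀ (by simp [hb0, hz, zero_lt_iff])]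
    simp
  have e2 : val F x ≤ exp (-c : ℤ) * val F (z * b) ↔ x / z ∈ pPow F (c - n) := by
    rw [mem_pPow, map_div₀, div_le_iff₀ hvz, map_mul, hb, show (-(c - n) : ℤ) = -c + n by ring,
      exp_add, mul_assoc, mul_comm (val F z)]
  have e3 : val F (y * b * A) ≤ val F (z * b - y * b * x) ↔
      val F y * exp (c - m) ≤ val F z * val F (1 - x * y / z) := by
    rw [e0, map_mul, map_mul, map_mul, map_mul, hA, mul_comm (val F y), mul_assoc]
    exact mul_le_mul_iff_right₀ (by simp [zero_lt_iff])
  have e4 : z * b - y * b * x ≠ 0 ↔ 1 - x * y / z ≠ 0 := by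
    rw [e0]; simp [hz]
  rw [← e1, ← e2, ← e3, ← e4, wLong_mul_unip_mul_torus_val]
  constructor
  · rintro ⟨-, h0, h1, h2, h3⟩
    simp at h0 h1 h2 h3
    exact ⟨by simpa using h1, by simpa using h2, by simpa using h0, by simpa using h3⟩
  · rintro ⟨h1, h2, h0, h3⟩
    constructor <;> simp
    · exact hz
    · simpa using h0
    · simpa using h1
    · simpa using h2
    · simpa using h3

lemma wLong_mul_torus_eq {a d : Fˣ} (x y z : F) : wLong F * unip x y z * torus a 1 b =
    wLong F * unip x y z * torus (a / d) 1 b * torus d 1 1 := by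
  rw [mul_assoc _ (torus (a / d) 1 b), torus_mul]
  simp

lemma val_uniformizer_pow (hϖ : IsUniformizer ϖ) :
    val F ((ϖ ^ c : Fˣ) : F) = exp (-c : ℤ) := by
  simp [val_uniformizer hϖ, ← exp_nsmul]

lemma val_div_pow (hϖ : IsUniformizer ϖ) {a : Fˣ} (ha : val F (a : F) = exp (-m)) :
    val F ((a / ϖ ^ c : Fˣ) : F) = exp (c - m) := by
  rw [Units.val_div_eq_div_val, map_div₀, ha, val_uniformizer_pow hϖ, ← exp_sub]
  congr 1; ring

open Classical in
-- For z in this ball the column-swapped cell decides. The unswapped cell meets the ball only in |z|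
-- = q^(c-m-n), and there it implies the same conditions on x and y.
lemma newform_ball (hϖ : IsUniformizer ϖ) (hμ₁ : IsUnramified μ₁) (hμ₃ : IsUnramified μ₃)
    (hμ₂ : ∀ x ∈ unitFiltration F c, μ₂ x = 1) (hc : 0 < c) {a : Fˣ}
    (ha : val F (a : F) = exp (-m)) (hb : val F (b : F) = exp n) (hz : z ∈ pPow F (m + n - c)) :
    newform μ₁ μ₂ μ₃ c (wLong F * unip x y z * torus a 1 b) =
      if x ∈ pPow F m ∧ y ∈ pPow F n then
        (μ₁ ϖ : ℂ) ^ (c - n) * (μ₃ ϖ : ℂ) ^ (m - c) * (resCard F : ℂ) ^ (m + n - 2 * c)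
      else 0 := by
  have hd := val_uniformizer_pow (c := c) hϖ
  have hA := val_div_pow (c := c) hϖ ha
  rw [wLong_mul_torus_eq (d := ϖ ^ c)]
  set A : Fˣ := a / ϖ ^ c with hAdef
  split_ifs with hxy
  · rw [← newform_swap hμ₁ hμ₃ hμ₂ hd]
    have h := mul_wLong_apply (wLong F * unip x y z * torus A 1 b)
    rw [wLong_mul_unip_mul_torus_val] at h
    rw [newform_of_inCell hμ₁ hμ₃ hμ₂ hd ((inCell_wLong_iff hA hb).mpr ⟨hz, hxy⟩)
      (δ := b * A) (D := A) (r := A)]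
    · have v1 : val F ((b * A * ϖ ^ c / A : Fˣ) : F) = exp (n - c) := by
        rw [mul_right_comm, mul_div_assoc, div_self', mul_one, Units.val_mul, map_mul, hb, hd,
          ← exp_add]
        rfl
      have v2 : val F ((b * A * ϖ ^ c / A / A : Fˣ) : F) = exp (m + n - 2 * c) := by
        rw [Units.val_div_eq_div_val, map_div₀, v1, hA, ← exp_sub]
        congr 1; ring
      rw [borelWeight, absF_eq_zpow v2, unramified_apply_exp hμ₁ hϖ v1,
        unramified_apply_exp hμ₃ hϖ hA]
      simp
    · rw [Matrix.det_fin_three]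
      simp only [h]
      simp
    · simp only [h]
      simp
    · simp only [h]
      simp
  · by_contra hne
    rcases inCell_or_of_newform_ne_zero hc hd hne with h | h
    · have hz0 : z ≠ 0 := by
        rintro rfl
        have := h.corner_ne
        rw [wLong_mul_unip_mul_torus_val] at this
        simp at this
      obtain ⟨h1, h2, -, h3⟩ := (inCell_iff hA hb hz0).mp h
      obtain ⟨kz, hkz⟩ := exists_val_eq_exp hz0
      have hx' : val F x ≤ exp (kz - (c - n)) := by
        rw [mem_pPow, map_div₀, div_le_iff₀ (by simp [zero_lt_iff, hz0]), hkz, ← exp_add] at h2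
        exact h2.trans (by rw [exp_le_exp]; omega)
      rw [mem_pPow, map_div₀, map_div₀, hA, hb, hkz, ← exp_sub, ← exp_sub, exp_le_exp] at h1
      rw [mem_pPow, hkz, exp_le_exp] at hz
      have hkz' : kz = c - m - n := by omega
      refine hxy ⟨?_, ?_⟩
      · rw [mem_pPow]
        exact hx'.trans (by rw [exp_le_exp]; omega)
      · rw [← map_mul, mul_sub, mul_one, mul_div_cancel₀ _ hz0] at h3
        by_cases hy0 : y = 0
        · rw [hy0]; exact zero_mem_pPow _
        obtain ⟨ky, hky⟩ := exists_val_eq_exp hy0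
        have h4 := h3.trans ((val F).map_sub z (x * y))
        rw [hky, hkz, ← exp_add] at h4
        rcases le_max_iff.mp h4 with h5 | h5
        · rw [exp_le_exp] at h5
          rw [mem_pPow, hky, exp_le_exp]; omega
        · have h6 : val F (x * y) ≤ exp (kz - (c - n) + ky) := by
            rw [map_mul, exp_add, hky]; gcongr
          have := h5.trans h6
          rw [exp_le_exp] at this
          omega
    · exact hxy ((inCell_wLong_iff hA hb).mp h).2

end Values

end GLThree

namespace GLThree

/-! ### The newform along w u diag(a,1,b): the shells in z -/

section Shell

open WithZero Topology

variable {F : Type*} [Field F] [ValuativeRel F] [TopologicalSpace F] [IsNonarchimedeanLocalField F]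

variable {μ₁ μ₂ μ₃ : Fˣ →ₜ* ℂˣ} {c : ℕ} {x y z : F} {A b ϖ : Fˣ} {m n j : ℤ}

lemma inCell_shell_iff (hA : val F (A : F) = exp (c - m)) (hb : val F (b : F) = exp n)
    (hj : 0 < j) (hz : z ∈ shell F (c - m - n + j)) :
    InCell c (wLong F * unip x y z * torus A 1 b).val ↔
      x ∈ pPow F (m - j) ∧ 1 - x * y / z ≠ 0 ∧
        val F y * exp (n - j) ≤ val F (1 - x * y / z) := by
  rw [inCell_iff hA hb (ne_zero_of_mem_shell hz)]
  rw [mem_shell] at hz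
  have e1 : (A : F) / b / z ∈ pPow F 0 := by
    rw [mem_pPow, map_div₀, map_div₀, hA, hb, hz, ← exp_sub, ← exp_sub, exp_le_exp]
    omega
  have e2 : x / z ∈ pPow F (c - n) ↔ x ∈ pPow F (m - j) := by
    rw [mem_pPow, map_div₀, hz, div_le_iff₀ (by simp [zero_lt_iff]), ← exp_add, mem_pPow,
      show (-(c - n) + (c - m - n + j) : ℤ) = -(m - j) by ring]
  have e3 : val F y * exp (c - m) ≤ val F z * val F (1 - x * y / z) ↔
      val F y * exp (n - j) ≤ val F (1 - x * y / z) := by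
    rw [hz, show (c - m : ℤ) = (n - j) + (c - m - n + j) by ring, exp_add, ← mul_assoc,
      mul_comm _ (val F (1 - x * y / z)), show (n - j + (c - m - n + j) - n + j : ℤ) =
        c - m - n + j + (n - n) + (j - j) by ring]
    simp only [sub_self, add_zero]
    exact mul_le_mul_iff_left₀ (by simp [zero_lt_iff])
  rw [e2, e3]
  exact and_iff_right e1

/-- If |1 - xy/z| were below q⁻ʲ, then |xy| = |z|, so |y| ≥ q^(c-n), and the minor condition would
give |1 - xy/z| ≥ q^(c-j). The bound makes the first condition in `cellWeight` automatic on the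
cell. That condition is there so that the weight vanishes near 0 even for y = 0, as continuity
demands. -/
lemma exp_le_val_of_cell (hj : 0 < j) (hz : z ∈ shell F (c - m - n + j))
    (hx : x ∈ pPow F (m - j)) (h : val F y * exp (n - j) ≤ val F (1 - x * y / z)) :
    exp (-j) ≤ val F (1 - x * y / z) := by
  by_contra! hlt
  have hlt1 : val F (1 - x * y / z) < val F (1 : F) := by
    rw [map_one, ← exp_zero]
    exact hlt.trans (by rw [exp_lt_exp]; omega)
  have h1 : val F (x * y / z) = 1 := by
    rw [← (val F).map_one]
    refine val_eq_of_sub_lt ?_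
    rwa [(val F).map_sub_swap]
  rw [map_div₀, hz.out, div_eq_one_iff_eq (by simp), map_mul] at h1
  have h2 : exp (c - m - n + j) ≤ exp (-(m - j)) * val F y := by
    rw [← h1]; gcongr; exact hx
  have h3 : exp (c - n) ≤ val F y := by
    rw [show (c - m - n + j : ℤ) = -(m - j) + (c - n) by ring, exp_add] at h2
    exact (mul_le_mul_iff_right₀ (by simp [zero_lt_iff])).mp h2
  have h4 : exp (c - n) * exp (n - j) ≤ val F (1 - x * y / z) := le_trans (by gcongr) h
  rw [← exp_add] at h4
  have := h4.trans_lt hlt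
  rw [exp_lt_exp] at this
  omega

open Classical in
/-- The radial factor of the newform on a shell. -/
noncomputable def cellWeight (y : F) (n j : ℤ) (s : ℂ) (v : WithZero (Multiplicative ℤ)) : ℂ :=
  if exp (-j) ≤ v ∧ val F y * exp (n - j) ≤ v then s ^ log v else 0

open Classical in
-- By `setIntegral_shell_ramified` this is the only value of the weight that survives the
-- integration over z.
lemma cellWeight_one (hj : 0 < j) (s : ℂ) :
    cellWeight y n j s 1 = if y ∈ pPow F (n - j) then 1 else 0 := by
  have h1 : exp (-j) ≤ (1 : WithZero (Multiplicative ℤ)) := by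
    rw [← exp_zero, exp_le_exp]; omega
  have h2 : val F y * exp (n - j) ≤ 1 ↔ y ∈ pPow F (n - j) := by
    rw [mem_pPow, ← exp_zero, show (0 : ℤ) = -(n - j) + (n - j) by ring, exp_add]
    exact mul_le_mul_iff_left₀ (by simp [zero_lt_iff])
  simp only [cellWeight, h1, h2, true_and, log_one, zpow_zero]

open Classical in
-- Outside the ball the swapped cell is excluded by |z|. On the unswapped one the middle torus entry
-- D/r is 1 - xy/z, which goes into μ₂, while μ₁ and the modulus contribute a power of t₁/q with
-- exponent log|1 - xy/z|.
lemma newform_shell (hϖ : IsUniformizer ϖ) (hμ₁ : IsUnramified μ₁) (hμ₃ : IsUnramified μ₃)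
    (hμ₂ : ∀ x ∈ unitFiltration F c, μ₂ x = 1) (hc : 0 < c) {a : Fˣ}
    (ha : val F (a : F) = exp (-m)) (hb : val F (b : F) = exp n) (hj : 0 < j)
    (hz : z ∈ shell F (c - m - n + j)) :
    newform μ₁ μ₂ μ₃ c (wLong F * unip x y z * torus a 1 b) =
      if x ∈ pPow F (m - j) then
        (μ₁ ϖ : ℂ) ^ (c + j - n) * (μ₃ ϖ : ℂ) ^ (m - c - j) *
          (resCard F : ℂ) ^ (m + n - 2 * c - 2 * j) *
          (extChar μ₂ (1 - x * y / z) *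
            cellWeight y n j ((μ₁ ϖ : ℂ) / resCard F) (val F (1 - x * y / z)))
      else 0 := by
  have hd := val_uniformizer_pow (c := c) hϖ
  have hA := val_div_pow (c := c) hϖ ha
  have hq := resCard_ne_zero' (F := F)
  rw [wLong_mul_torus_eq (d := ϖ ^ c)]
  set A : Fˣ := a / ϖ ^ c with hAdef
  have hz0 := ne_zero_of_mem_shell hz
  have hiff := inCell_shell_iff (x := x) (y := y) hA hb hj hz
  by_cases hcell : InCell c (wLong F * unip x y z * torus A 1 b).val
  · obtain ⟨hx, hρ, hy⟩ := hiff.mp hcell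
    have hvρ := exp_le_val_of_cell hj hz hx hy
    rw [if_pos hx, cellWeight, if_pos ⟨hvρ, hy⟩]
    obtain ⟨i, hi⟩ := exists_val_eq_exp hρ
    set ρ : F := 1 - x * y / z with hρdef
    set r : Fˣ := Units.mk0 z hz0 * b
    set P : Fˣ := Units.mk0 ρ hρ
    rw [newform_of_inCell hμ₁ hμ₃ hμ₂ hd hcell (δ := -(A * b)) (D := P * r) (r := r)]
    · have vr : val F (r : F) = exp (c - m + j) := by
        simp only [r, Units.val_mul, Units.val_mk0, map_mul, hz.out, hb, ← exp_add]
        congr 1; ring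
      have vP : val F (P : F) = exp i := hi
      have v1 : val F ((-(A * b) * ϖ ^ c / (P * r) : Fˣ) : F) = exp (n - c - j - i) := by
        rw [Units.val_div_eq_div_val, Units.val_mul, Units.val_mul, Units.val_neg, map_div₀,
          map_mul, (val F).map_neg, Units.val_mul, map_mul, map_mul, vr, hA, hb, hd, vP,
          ← exp_add, ← exp_add, ← exp_add, ← exp_sub]
        congr 1; ring
      have v2 : val F ((-(A * b) * ϖ ^ c / (P * r) / r : Fˣ) : F) =
          exp (m + n - 2 * c - 2 * j - i) := by
        rw [Units.val_div_eq_div_val, map_div₀, v1, vr, ← exp_sub]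
        congr 1; ring
      have e : P * r / r = P := by simp
      rw [borelWeight, absF_eq_zpow v2, unramified_apply_exp hμ₁ hϖ v1,
        unramified_apply_exp hμ₃ hϖ vr, e, hi, log_exp, ← extChar_unit μ₂ P]
      have t1 : (μ₁ ϖ : ℂ) ≠ 0 := Units.ne_zero _
      simp only [Units.val_zpow_eq_zpow_val, Complex.ofReal_zpow, Complex.ofReal_natCast, P,
        Units.val_mk0]
      rw [show (-(n - c - j - i) : ℤ) = (c + j - n) + i by ring, zpow_add₀ t1,
        show (-(c - m + j) : ℤ) = m - c - j by ring, div_zpow, zpow_sub₀ hq _ i]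
      field_simp
    · rw [wLong_mul_unip_mul_torus_val, Matrix.det_fin_three]
      simp
      ring
    · rw [wLong_mul_unip_mul_torus_val]
      simp [P, r, ρ]
      field_simp
    · rw [wLong_mul_unip_mul_torus_val]
      simp [r]
  · have h0 : newform μ₁ μ₂ μ₃ c
        (wLong F * unip x y z * torus A 1 b * torus (ϖ ^ c) 1 1) = 0 := by
      by_contra hne
      rcases inCell_or_of_newform_ne_zero hc hd hne with h | h
      · exact hcell h
      · have := ((inCell_wLong_iff hA hb).mp h).1
        rw [mem_pPow, hz.out, exp_le_exp] at this
        omega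
    rw [h0]
    split_ifs with hx
    · by_cases hρ : 1 - x * y / z = 0
      · simp [hρ, extChar_zero]
      · have : ¬ val F y * exp (n - j) ≤ val F (1 - x * y / z) := fun h =>
          hcell (hiff.mpr ⟨hx, hρ, h⟩)
        rw [cellWeight, if_neg fun h => this h.2, mul_zero, mul_zero]
    · rfl

end Shell

end GLThree

namespace GLThree

/-! ### The Whittaker function on the torus -/

section Formula

open WithZero Topology

variable {F : Type*} [Field F] [ValuativeRel F] [TopologicalSpace F] [IsNonarchimedeanLocalField F]
  [MeasurableSpace F] [BorelSpace F] {dx : Measure F} [dx.IsAddHaarMeasure]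

variable {μ₁ μ₂ μ₃ : Fˣ →ₜ* ℂˣ} {c m n : ℕ} {ψ : AddChar F Circle} {a b ϖ : Fˣ}

lemma continuous_newform_integrand (hψ : Continuous ψ) (hμ₁ : IsUnramified μ₁)
    (hμ₃ : IsUnramified μ₃) (hμ₂ : ∀ x ∈ unitFiltration F c, μ₂ x = 1) (g : GL (Fin 3) F) :
    Continuous fun p : F × F × F =>
      whittakerIntegrand ψ (newform μ₁ μ₂ μ₃ c) g (unipCoord p) :=
  continuous_whittakerIntegrand hψ (continuous_of_rightInvariant (isOpen_levelGroup c)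
      fun _ _ hk => newform_mul_right hμ₁ hμ₃ hμ₂ hk) g

lemma setIntegral_pPow_ite (k l : ℤ) (φ : F → ℂ) [DecidablePred (· ∈ pPow F l)] :
    ∫ x in pPow F k, (if x ∈ pPow F l then φ x else 0) ∂dx = ∫ x in pPow F (max k l), φ x ∂dx := by
  have h : ∀ x, (if x ∈ pPow F l then φ x else 0) = (pPow F l).indicator φ x := fun x => by
    rw [Set.indicator_apply]
  simp only [h]
  rw [setIntegral_indicator (measurableSet_pPow _), pPow_inter]

lemma whittakerIntegrand_unipCoord (f : GL (Fin 3) F → ℂ) (g : GL (Fin 3) F) (x y z : F) :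
    whittakerIntegrand ψ f g (unipCoord (x, y, z)) =
      f (wLong F * unip x y z * g) * (((ψ x : Circle) : ℂ)⁻¹ * ((ψ y : Circle) : ℂ)⁻¹) := by
  rw [whittakerIntegrand, genericChar_unipCoord, mul_inv]
  rfl

open Classical in
-- Since m, n ≥ 0, the character is trivial on the support x ∈ 𝔭ᵐ, y ∈ 𝔭ⁿ, and the integral is a
-- constant times a volume.
lemma integral_newform_ball (hdx : dx (pPow F 0) = 1) (hϖ : IsUniformizer ϖ)
    (hψ : Continuous ψ) (hψ' : IsUnramifiedAddChar ψ)
    (hμ₁ : IsUnramified μ₁) (hμ₃ : IsUnramified μ₃)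
    (hμ₂ : ∀ x ∈ unitFiltration F c, μ₂ x = 1) (hc : 0 < c)
    (ha : val F (a : F) = exp (-m : ℤ)) (hb : val F (b : F) = exp (n : ℤ)) (k : ℕ) :
    ∫ p in pPow F (-k) ×ˢ pPow F (-k) ×ˢ pPow F (m + n - c),
        whittakerIntegrand ψ (newform μ₁ μ₂ μ₃ c) (torus a 1 b) (unipCoord p)
          ∂(dx.prod (dx.prod dx)) =
      (μ₁ ϖ : ℂ) ^ ((c : ℤ) - n) * (μ₃ ϖ : ℂ) ^ ((m : ℤ) - c) *
        (resCard F : ℂ) ^ (-(c : ℤ) - m - n) := by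
  have hq := resCard_ne_zero' (F := F)
  set C : ℂ := (μ₁ ϖ : ℂ) ^ ((c : ℤ) - n) * (μ₃ ϖ : ℂ) ^ ((m : ℤ) - c) *
    (resCard F : ℂ) ^ ((m : ℤ) + n - 2 * c)
  rw [setIntegral_prod_prod (continuous_newform_integrand hψ hμ₁ hμ₃ hμ₂ _) (isCompact_pPow _)
    (isCompact_pPow _) (isCompact_pPow _)]
  have h1 : ∀ x y : F, ∫ z in pPow F (m + n - c),
      whittakerIntegrand ψ (newform μ₁ μ₂ μ₃ c) (torus a 1 b) (unipCoord (x, y, z)) ∂dx =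
      if x ∈ pPow F m then (if y ∈ pPow F n then
        (resCard F : ℂ) ^ (-(m + n - c : ℤ)) * C * ((ψ x : Circle) : ℂ)⁻¹ * ((ψ y : Circle) : ℂ)⁻¹
          else 0) else 0 := by
    intro x y
    rw [setIntegral_congr_fun (g := fun _ => (if x ∈ pPow F m ∧ y ∈ pPow F n then C else 0) *
      (((ψ x : Circle) : ℂ)⁻¹ * ((ψ y : Circle) : ℂ)⁻¹)) (measurableSet_pPow _),
      setIntegral_const, real_pPow hdx]
    · by_cases hx : x ∈ pPow F m <;> by_cases hy : y ∈ pPow F n <;> simp [hx, hy]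
      ring
    · intro z hz
      simp only [whittakerIntegrand_unipCoord]
      rw [newform_ball hϖ hμ₁ hμ₃ hμ₂ hc ha hb hz]
  have h2 : ∀ x : F, ∫ y in pPow F (-k), (if x ∈ pPow F m then (if y ∈ pPow F n then
        (resCard F : ℂ) ^ (-(m + n - c : ℤ)) * C * ((ψ x : Circle) : ℂ)⁻¹ * ((ψ y : Circle) : ℂ)⁻¹
          else 0) else 0) ∂dx = if x ∈ pPow F m then (resCard F : ℂ) ^ (-(m + n - c : ℤ)) * C *
          (resCard F : ℂ) ^ (-n : ℤ) * ((ψ x : Circle) : ℂ)⁻¹ else 0 := by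
    intro x
    split_ifs with hx
    · rw [setIntegral_pPow_ite, integral_const_mul, setIntegral_addChar_inv hdx hψ',
        max_eq_right (by omega), if_pos (by omega)]
      ring
    · simp
  simp only [h1, h2]
  rw [setIntegral_pPow_ite, integral_const_mul, setIntegral_addChar_inv hdx hψ',
        max_eq_right (by omega), if_pos (by omega)]
  simp only [C, mul_assoc, ← zpow_add₀ hq]
  rw [mul_left_comm]
  congr 1
  rw [mul_left_comm, ← zpow_add₀ hq]
  congr 2
  ring

open Classical in
-- The z-integral is `setIntegral_shell_ramified` at p = xy, and the remaining one is
-- `setIntegral_hyperbola`. The constant is arranged so that the value of `integral_newform_ball` is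
-- a common factor of all shells.
lemma integral_newform_shell (hdx : dx (pPow F 0) = 1) (hϖ : IsUniformizer ϖ)
    (hψ : Continuous ψ) (hψ' : IsUnramifiedAddChar ψ)
    (hμ₁ : IsUnramified μ₁) (hμ₃ : IsUnramified μ₃)
    (hμ₂ : c = conductor μ₂) (hc : 0 < c)
    (ha : val F (a : F) = exp (-m : ℤ)) (hb : val F (b : F) = exp (n : ℤ)) {k j : ℕ} (hk : 0 < k)
    (hj : 0 < j) :
    ∫ p in pPow F (-k) ×ˢ pPow F (-k) ×ˢ shell F (c - m - n + j),
        whittakerIntegrand ψ (newform μ₁ μ₂ μ₃ c) (torus a 1 b) (unipCoord p)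
          ∂(dx.prod (dx.prod dx)) =
      (μ₁ ϖ : ℂ) ^ ((c : ℤ) - n) * (μ₃ ϖ : ℂ) ^ ((m : ℤ) - c) *
        (resCard F : ℂ) ^ (-(c : ℤ) - m - n) * ((μ₁ ϖ : ℂ) / (μ₃ ϖ : ℂ)) ^ j *
        (if j ≤ m + n then 1 - (resCard F : ℂ)⁻¹
          else if j = m + n + 1 then -(resCard F : ℂ)⁻¹ else 0) := by
  have hq := resCard_ne_zero' (F := F)
  have t1 : (μ₁ ϖ : ℂ) ≠ 0 := Units.ne_zero _
  have t3 : (μ₃ ϖ : ℂ) ≠ 0 := Units.ne_zero _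
  have hj' : (0 : ℤ) < j := by omega
  have htriv : ∀ x ∈ unitFiltration F c, μ₂ x = 1 := hμ₂ ▸ conductor_spec μ₂
  set C : ℂ := (μ₁ ϖ : ℂ) ^ ((c : ℤ) + j - n) * (μ₃ ϖ : ℂ) ^ ((m : ℤ) - c - j) *
    (resCard F : ℂ) ^ ((m : ℤ) + n - 2 * c - 2 * j) with hC
  set s : ℤ := c - m - n + j with hs
  rw [setIntegral_prod_prod (continuous_newform_integrand hψ hμ₁ hμ₃ htriv _) (isCompact_pPow _)
    (isCompact_pPow _) (isCompact_shell _)]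
  have h1 : ∀ x y : F, ∫ z in shell F s,
      whittakerIntegrand ψ (newform μ₁ μ₂ μ₃ c) (torus a 1 b) (unipCoord (x, y, z)) ∂dx =
      if x ∈ pPow F (m - j) then (if y ∈ pPow F (n - j) then
        C * (resCard F : ℂ) ^ s * ((ψ x : Circle) : ℂ)⁻¹ *
        (((if x * y ∈ pPow F (m + n - j) then 1 else 0) -
          (resCard F : ℂ)⁻¹ * (if x * y ∈ pPow F (m + n - j - 1) then 1 else 0)) *
            ((ψ y : Circle) : ℂ)⁻¹)
          else 0) else 0 := by
    intro x y
    by_cases hx : x ∈ pPow F (m - j)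
    · rw [setIntegral_congr_fun (g := fun z => (C *
        (((ψ x : Circle) : ℂ)⁻¹ * ((ψ y : Circle) : ℂ)⁻¹)) *
        (extChar μ₂ (1 - x * y / z) *
            cellWeight y n j ((μ₁ ϖ : ℂ) / resCard F) (val F (1 - x * y / z))))
            (measurableSet_shell _), integral_const_mul,
        setIntegral_shell_ramified hdx (hμ₂ ▸ hc) (e := -j - 1), cellWeight_one hj', ← hμ₂,
        show (c - s : ℤ) = m + n - j by rw [hs]; ring, if_pos hx]
      · by_cases hy : y ∈ pPow F (n - j)
        · simp only [hy, if_true]; ring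
        · simp [hy]
      · intro v hv
        rw [cellWeight, if_neg]
        rintro ⟨h, -⟩
        have := h.trans hv
        rw [exp_le_exp] at this
        omega
      · intro z hz
        simp only [whittakerIntegrand_unipCoord]
        rw [newform_shell hϖ hμ₁ hμ₃ htriv hc ha hb hj' hz, if_pos hx]
        ring
    · rw [setIntegral_congr_fun (g := fun _ => 0) (measurableSet_shell _)]
      · simp [hx]
      · intro z hz
        simp only [whittakerIntegrand_unipCoord]
        rw [newform_shell hϖ hμ₁ hμ₃ htriv hc ha hb hj' hz, if_neg hx, zero_mul]
  have h2 : ∀ x : F, ∫ y in pPow F (-k), (if x ∈ pPow F (m - j) then (if y ∈ pPow F (n - j) then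
        C * (resCard F : ℂ) ^ s * ((ψ x : Circle) : ℂ)⁻¹ *
        (((if x * y ∈ pPow F (m + n - j) then 1 else 0) -
          (resCard F : ℂ)⁻¹ * (if x * y ∈ pPow F (m + n - j - 1) then 1 else 0)) *
            ((ψ y : Circle) : ℂ)⁻¹)
          else 0) else 0) ∂dx = if x ∈ pPow F (m - j) then C * (resCard F : ℂ) ^ s *
          ((∫ y in pPow F (max (-k) (n - j)),
        ((if x * y ∈ pPow F (m + n - j) then 1 else 0) -
          (resCard F : ℂ)⁻¹ * (if x * y ∈ pPow F (m + n - j - 1) then 1 else 0)) *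
          ((ψ y : Circle) : ℂ)⁻¹ ∂dx) * ((ψ x : Circle) : ℂ)⁻¹) else 0 := by
    intro x
    split_ifs with hx
    · rw [setIntegral_pPow_ite, integral_const_mul]
      ring
    · simp
  simp only [h1, h2]
  rw [setIntegral_pPow_ite, integral_const_mul,
    setIntegral_hyperbola hdx hψ hψ' m n j k (by omega), hC, hs]
  rw [show ((c : ℤ) + j - n) = (c - n) + j by ring, show ((m : ℤ) - c - j) = m - c - j by ring,
    zpow_add₀ t1, zpow_sub₀ t3 _ (j : ℤ), div_pow, zpow_natCast, zpow_natCast]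
  have e1 : ∀ u : ℂ, (resCard F : ℂ) ^ ((m : ℤ) + n - 2 * c - 2 * j) *
      (resCard F : ℂ) ^ ((c : ℤ) - m - n + j) * u = (resCard F : ℂ) ^ (-(c : ℤ) - m - n) *
        ((resCard F : ℂ) ^ ((m : ℤ) + n - j) * u) := by
    intro u
    rw [← mul_assoc, ← zpow_add₀ hq, ← zpow_add₀ hq]
    congr 2
    ring
  have e2 : (resCard F : ℂ) ^ ((m : ℤ) + n - j) *
      (if j ≤ m + n then (1 - (resCard F : ℂ)⁻¹) * (resCard F : ℂ) ^ ((j : ℤ) - m - n)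
      else if j = m + n + 1 then -1 else 0) = (if j ≤ m + n then 1 - (resCard F : ℂ)⁻¹
          else if j = m + n + 1 then -(resCard F : ℂ)⁻¹ else 0) := by
    split_ifs with h1 h2
    · rw [mul_left_comm, ← zpow_add₀ hq, show ((m : ℤ) + n - j + (j - m - n)) = 0 by ring]
      simp
    · rw [h2, show ((m : ℤ) + n - (m + n + 1 : ℕ)) = -1 by push_cast; ring]
      simp
    · simp
  rw [← e2]
  have := e1 (if j ≤ m + n then (1 - (resCard F : ℂ)⁻¹) * (resCard F : ℂ) ^ ((j : ℤ) - m - n)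
      else if j = m + n + 1 then -1 else 0)
  linear_combination ((μ₁ ϖ : ℂ) ^ ((c : ℤ) - n) * (μ₁ ϖ : ℂ) ^ j *
    ((μ₃ ϖ : ℂ) ^ ((m : ℤ) - c) / (μ₃ ϖ : ℂ) ^ j)) * this

/-- The left side consists of rʲ for 0 ≤ j ≤ M and of -s rʲ for 1 ≤ j ≤ M + 1; the second geometric
sum is -rs times the first. -/
lemma geom_telescope (r s : ℂ) (M J : ℕ) (hJ : M + 1 ≤ J) :
    1 + ∑ j ∈ Finset.range J, r ^ (j + 1) *
      (if j + 1 ≤ M then 1 - s else if j + 1 = M + 1 then -s else 0) =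
      (1 - r * s) * ∑ i ∈ Finset.range (M + 1), r ^ i := by
  have h0 : ∑ j ∈ Finset.range (M + 1), r ^ (j + 1) *
      (if j + 1 ≤ M then 1 - s else if j + 1 = M + 1 then -s else 0) =
      ∑ j ∈ Finset.range J, r ^ (j + 1) *
      (if j + 1 ≤ M then 1 - s else if j + 1 = M + 1 then -s else 0) := by
    refine Finset.sum_subset (by simpa using hJ) fun j _ hj => ?_
    rw [Finset.mem_range] at hj
    rw [if_neg (by omega), if_neg (by omega), mul_zero]
  have h1 : ∑ j ∈ Finset.range M, r ^ (j + 1) *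
      (if j + 1 ≤ M then 1 - s else if j + 1 = M + 1 then -s else 0) =
      r * (1 - s) * ∑ j ∈ Finset.range M, r ^ j := by
    rw [Finset.mul_sum]
    refine Finset.sum_congr rfl fun j hj => ?_
    rw [Finset.mem_range] at hj
    rw [if_pos (by omega)]
    ring
  have h2 : (∑ j ∈ Finset.range M, r ^ j) * (r - 1) = r ^ M - 1 := geom_sum_mul r M
  rw [← h0, Finset.sum_range_succ, h1, if_neg (by omega), if_pos rfl, Finset.sum_range_succ]
  linear_combination h2

/-- The values of the Whittaker function of the newform on the torus. -/
lemma whittaker_newform_torus (hdx : dx (pPow F 0) = 1) (hϖ : IsUniformizer ϖ)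
    (hψ : Continuous ψ) (hψ' : IsUnramifiedAddChar ψ)
    (hμ₁ : IsUnramified μ₁) (hμ₃ : IsUnramified μ₃)
    (hμ₂ : c = conductor μ₂) (hc : 0 < c)
    (ha : val F (a : F) = exp (-m : ℤ)) (hb : val F (b : F) = exp (n : ℤ)) :
    whittaker dx ψ (newform μ₁ μ₂ μ₃ c) (torus a 1 b) =
      (μ₁ ϖ : ℂ) ^ ((c : ℤ) - n) * (μ₃ ϖ : ℂ) ^ ((m : ℤ) - c) *
        (resCard F : ℂ) ^ (-(c : ℤ) - m - n) *
        ((1 - (μ₁ ϖ : ℂ) / (μ₃ ϖ : ℂ) * (resCard F : ℂ)⁻¹) *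
          ∑ i ∈ Finset.range (m + n + 1), ((μ₁ ϖ : ℂ) / (μ₃ ϖ : ℂ)) ^ i) := by
  have htriv : ∀ x ∈ unitFiltration F c, μ₂ x = 1 := hμ₂ ▸ conductor_spec μ₂
  -- The bound k ≥ c + 1 makes the natural subtraction in `hJ` exact and provides at least m + n + 1
  -- shells, as `geom_telescope` needs.
  obtain ⟨k, hk, hk'⟩ := ((eventually_whittaker_newform (dx := dx) hψ hψ' hμ₁ hμ₃ htriv
    (torus a 1 b)).and (eventually_ge_atTop (c + 1))).exists
  have hJ : (-(2 * k) : ℤ) = (m + n - c : ℤ) - (2 * k + m + n - c : ℕ) := by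
    push_cast [show c ≤ 2 * k + m + n by omega]
    ring
  rw [hk, hJ, setIntegral_prod_shells (continuous_newform_integrand hψ hμ₁ hμ₃ htriv _)
    (isCompact_pPow _) (isCompact_pPow _), integral_newform_ball hdx hϖ hψ hψ' hμ₁ hμ₃ htriv hc
      ha hb]
  have h1 : ∀ j : ℕ, ((j : ℤ) + 1 - (m + n - c)) = c - m - n + (j + 1 : ℕ) := fun j => by
    push_cast; ring
  simp only [h1, integral_newform_shell hdx hϖ hψ hψ' hμ₁ hμ₃ hμ₂ hc ha hb
    (show 0 < k by omega) (Nat.succ_pos _)]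
  rw [← geom_telescope _ _ _ (2 * k + m + n - c) (by omega), mul_add, mul_one, Finset.mul_sum]
  congr 1
  refine Finset.sum_congr rfl fun j _ => ?_
  rw [mul_assoc]

end Formula

end GLThree

namespace GLThree

/-! ### The intertwining integral for the second simple reflection -/

section MidIntegral

open WithZero Topology

section

variable {F : Type*} [Field F]

/-- The permutation matrix of the second simple reflection. -/
def sMid (F : Type*) [Field F] : GL (Fin 3) F where
  val := !![1, 0, 0; 0, 0, 1; 0, 1, 0]
  inv := !![1, 0, 0; 0, 0, 1; 0, 1, 0]
  val_inv := by
    ext i j; fin_cases i <;> fin_cases j <;> simp [Matrix.mul_apply, Fin.sum_univ_three]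
  inv_val := by
    ext i j; fin_cases i <;> fin_cases j <;> simp [Matrix.mul_apply, Fin.sum_univ_three]

/-- The permutation matrix of the first simple reflection. -/
def sLeft (F : Type*) [Field F] : GL (Fin 3) F where
  val := !![0, 1, 0; 1, 0, 0; 0, 0, 1]
  inv := !![0, 1, 0; 1, 0, 0; 0, 0, 1]
  val_inv := by
    ext i j; fin_cases i <;> fin_cases j <;> simp [Matrix.mul_apply, Fin.sum_univ_three]
  inv_val := by
    ext i j; fin_cases i <;> fin_cases j <;> simp [Matrix.mul_apply, Fin.sum_univ_three]

lemma sMid_mul_val (x : F) (g : GL (Fin 3) F) : (sMid F * unip 0 x 0 * g).val =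
    !![g.val 0 0, g.val 0 1, g.val 0 2; g.val 2 0, g.val 2 1, g.val 2 2;
      g.val 1 0 + x * g.val 2 0, g.val 1 1 + x * g.val 2 1, g.val 1 2 + x * g.val 2 2] := by
  ext i j; fin_cases i <;> fin_cases j <;>
    simp [sMid, unip, Matrix.mul_apply, Fin.sum_univ_three]

lemma unip_mid_mul_val (y : F) (g : GL (Fin 3) F) : (unip 0 y 0 * g).val =
    !![g.val 0 0, g.val 0 1, g.val 0 2;
      g.val 1 0 + y * g.val 2 0, g.val 1 1 + y * g.val 2 1, g.val 1 2 + y * g.val 2 2;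
      g.val 2 0, g.val 2 1, g.val 2 2] := by
  ext i j; fin_cases i <;> fin_cases j <;>
    simp [unip, Matrix.mul_apply, Fin.sum_univ_three]

lemma sLeft_mul_val (g : GL (Fin 3) F) : (sLeft F * g).val =
    !![g.val 1 0, g.val 1 1, g.val 1 2; g.val 0 0, g.val 0 1, g.val 0 2;
      g.val 2 0, g.val 2 1, g.val 2 2] := by
  ext i j; fin_cases i <;> fin_cases j <;>
    simp [sLeft, Matrix.mul_apply, Fin.sum_univ_three]

end

variable {F : Type*} [Field F] [ValuativeRel F] [TopologicalSpace F] [IsNonarchimedeanLocalField F]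

variable {μ₁ μ₂ μ₃ : Fˣ →ₜ* ℂˣ} {c : ℕ} {x : F} {g : GL (Fin 3) F} {d ϖ : Fˣ}

/-- The parameter x adds a multiple of the third row of g to the second, so the bottom minors do not
involve it. -/
lemma inCell_mid_iff : InCell c (sMid F * unip 0 x 0 * g).val ↔
    g.val 1 2 + x * g.val 2 2 ≠ 0 ∧ g.val 2 1 * g.val 1 2 - g.val 2 2 * g.val 1 1 ≠ 0 ∧
    val F (g.val 1 0 + x * g.val 2 0) ≤ val F (g.val 1 2 + x * g.val 2 2) ∧
    val F (g.val 1 1 + x * g.val 2 1) ≤ exp (-c : ℤ) * val F (g.val 1 2 + x * g.val 2 2) ∧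
    val F (g.val 2 0 * g.val 1 2 - g.val 2 2 * g.val 1 0) ≤
      val F (g.val 2 1 * g.val 1 2 - g.val 2 2 * g.val 1 1) := by
  have e1 : g.val 2 1 * (g.val 1 2 + x * g.val 2 2) - g.val 2 2 * (g.val 1 1 + x * g.val 2 1) =
      g.val 2 1 * g.val 1 2 - g.val 2 2 * g.val 1 1 := by ring
  have e2 : g.val 2 0 * (g.val 1 2 + x * g.val 2 2) - g.val 2 2 * (g.val 1 0 + x * g.val 2 0) =
      g.val 2 0 * g.val 1 2 - g.val 2 2 * g.val 1 0 := by ring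
  rw [sMid_mul_val, ← e1, ← e2]
  exact ⟨fun ⟨h1, h2, h3, h4, h5⟩ => ⟨h1, h2, h3, h4, h5⟩,
    fun ⟨h1, h2, h3, h4, h5⟩ => ⟨h1, h2, h3, h4, h5⟩⟩

lemma borelWeight_congr_left (hμ₁ : IsUnramified μ₁) {a a' : Fˣ} (h : val F (a : F) = val F a')
    (b r : Fˣ) : borelWeight μ₁ μ₂ μ₃ a b r = borelWeight μ₁ μ₂ μ₃ a' b r := by
  have : absF (a / r) = absF (a' / r) := by
    simp [absF, h]
  rw [borelWeight, borelWeight, unramified_apply_eq hμ₁ h, this]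

lemma newform_mid_of_inCell (hμ₁ : IsUnramified μ₁) (hμ₃ : IsUnramified μ₃)
    (hμ₂ : ∀ x ∈ unitFiltration F c, μ₂ x = 1) (hd : val F (d : F) = exp (-c : ℤ))
    (h : InCell c (sMid F * unip 0 x 0 * g).val) {δ D r : Fˣ}
    (hδ : val F (δ : F) = val F g.val.det)
    (hD : (D : F) = g.val 2 1 * g.val 1 2 - g.val 2 2 * g.val 1 1)
    (hr : (r : F) = g.val 1 2 + x * g.val 2 2) :
    newform μ₁ μ₂ μ₃ c (sMid F * unip 0 x 0 * g * torus d 1 1) =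
      borelWeight μ₁ μ₂ μ₃ (δ * d / D) (D / r) r := by
  have hdet : (sMid F * unip 0 x 0 * g).val.det = -g.val.det := by
    rw [sMid_mul_val, Matrix.det_fin_three, Matrix.det_fin_three]
    simp
    ring
  have hne : g.val.det ≠ 0 := by
    intro h0
    rw [h0, map_zero] at hδ
    simp at hδ
  rw [newform_of_inCell hμ₁ hμ₃ hμ₂ hd h (δ := -Units.mk0 g.val.det hne) (D := D) (r := r)]
  · refine borelWeight_congr_left hμ₁ ?_ _ _
    simp [hδ]
  · rw [hdet]; simp
  · rw [hD, sMid_mul_val]; simp; ring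
  · rw [hr, sMid_mul_val]; simp

/-- The left side is a value of the newform times the volume of the ball of admissible x. It depends
on |e| = q^ke through (t₁/(q t₃))^ke, so `ht` is exactly what makes the middle row disappear from
the answer. -/
lemma borelWeight_mid (hϖ : IsUniformizer ϖ) (hμ₁ : IsUnramified μ₁) (hμ₃ : IsUnramified μ₃)
    (hμ₂ : ∀ x ∈ unitFiltration F c, μ₂ x = 1)
    (ht : (μ₁ ϖ : ℂ) = resCard F * (μ₃ ϖ : ℂ)) {δ β e r : Fˣ} {kβ ke : ℤ}
    (hβ : val F (β : F) = exp kβ) (hr : val F (r : F) = exp ke)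
    (hre : (e / r : Fˣ) ∈ unitFiltration F c) :
    borelWeight μ₁ μ₂ μ₃ (δ / (β * e)) (β * e / r) r * (resCard F : ℂ) ^ (-(c + kβ - ke)) =
      borelWeight μ₁ μ₂ μ₃ (δ / β) β 1 * ((absF β : ℂ)⁻¹ * (resCard F : ℂ) ^ (-c : ℤ)) := by
  have hq := resCard_ne_zero' (F := F)
  have t3 : (μ₃ ϖ : ℂ) ≠ 0 := Units.ne_zero _
  obtain ⟨kδ, hδ⟩ := exists_val_eq_exp δ.ne_zero
  have he : val F (e : F) = exp ke := by
    have := hre.1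
    rw [Units.val_div_eq_div_val, map_div₀, hr, div_eq_one_iff_eq (by simp)] at this
    exact this
  have v1 : val F ((δ / (β * e) : Fˣ) : F) = exp (kδ - (kβ + ke)) := by
    rw [Units.val_div_eq_div_val, map_div₀, Units.val_mul, map_mul, hδ, hβ, he, ← exp_add,
      ← exp_sub]
  have v2 : val F ((δ / (β * e) / r : Fˣ) : F) = exp (kδ - (kβ + ke) - ke) := by
    rw [Units.val_div_eq_div_val, map_div₀, v1, hr, ← exp_sub]
  have v3 : val F ((δ / β : Fˣ) : F) = exp (kδ - kβ) := by
    rw [Units.val_div_eq_div_val, map_div₀, hδ, hβ, ← exp_sub]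
  have v4 : val F ((δ / β / 1 : Fˣ) : F) = exp (kδ - kβ) := by
    rw [div_one, v3]
  rw [borelWeight, borelWeight, mul_div_assoc, map_mul, hμ₂ _ hre, absF_eq_zpow v2,
    absF_eq_zpow v4, absF_eq_zpow hβ, unramified_apply_exp hμ₁ hϖ v1,
    unramified_apply_exp hμ₁ hϖ v3, unramified_apply_exp hμ₃ hϖ hr]
  simp only [Units.val_zpow_eq_zpow_val, Complex.ofReal_zpow, Complex.ofReal_natCast, mul_one,
    map_one, Units.val_one, ht, mul_zpow]
  have e1 : (μ₃ ϖ : ℂ) ^ (-(kδ - (kβ + ke))) = (μ₃ ϖ : ℂ) ^ (-(kδ - kβ)) * (μ₃ ϖ : ℂ) ^ ke := by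
    rw [← zpow_add₀ t3]; congr 1; ring
  have e2 : (μ₃ ϖ : ℂ) ^ ke * (μ₃ ϖ : ℂ) ^ (-ke) = 1 := by
    rw [← zpow_add₀ t3]; simp
  have e3 : (resCard F : ℂ) ^ (-(kδ - (kβ + ke))) * (resCard F : ℂ) ^ (kδ - (kβ + ke) - ke) *
      (resCard F : ℂ) ^ (-(c + kβ - ke)) = (resCard F : ℂ) ^ (-(kδ - kβ)) *
        (resCard F : ℂ) ^ (kδ - kβ) * (((resCard F : ℂ) ^ kβ)⁻¹ * (resCard F : ℂ) ^ (-c : ℤ)) := by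
    simp only [← zpow_neg, ← zpow_add₀ hq]
    congr 1; ring
  rw [e1]
  linear_combination (μ₃ ϖ : ℂ) ^ (-(kδ - kβ)) * (μ₂ β : ℂ) * ((μ₃ ϖ : ℂ) ^ ke *
    (μ₃ ϖ : ℂ) ^ (-ke)) * e3 + (μ₃ ϖ : ℂ) ^ (-(kδ - kβ)) * (μ₂ β : ℂ) *
      (resCard F : ℂ) ^ (-(kδ - kβ)) * (resCard F : ℂ) ^ (kδ - kβ) *
        (((resCard F : ℂ) ^ kβ)⁻¹ * (resCard F : ℂ) ^ (-c : ℤ)) * e2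

/-- If w governed the sum, then |a| ≤ q⁻ᶜ|a|, which forces a = 0. -/
lemma val_le_of_le_add (hc : 0 < c) {a b u w : F}
    (h : val F a ≤ exp (-c : ℤ) * val F (u + w)) (hu : val F u ≤ val F b)
    (hw : val F w ≤ val F a) : val F a ≤ exp (-c : ℤ) * val F b := by
  rcases le_max_iff.mp ((val F).map_add u w) with h1 | h1
  · exact h.trans (by gcongr; exact h1.trans hu)
  · by_cases ha : a = 0
    · simp [ha]
    · exfalso
      have h2 : val F a ≤ exp (-c : ℤ) * val F a := h.trans (by gcongr; exact h1.trans hw)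
      obtain ⟨k, hk⟩ := exists_val_eq_exp ha
      rw [hk, ← exp_add, exp_le_exp] at h2
      omega

/-- Let a, b be the first two entries of the middle row and γ the last entry of the bottom row. The
minor condition of the swapped cell forces |a| ≤ |b|, its row conditions then force |b| ≤ |xγ|, and
the conditions of the unswapped cell follow. So only one cell has to be considered. -/
lemma inCell_of_inCell_swap (hc : 0 < c) (h12 : g.val 1 2 = 0)
    (h20 : val F (g.val 2 0) ≤ val F (g.val 2 2)) (h21 : val F (g.val 2 1) < val F (g.val 2 2))
    (h : InCell c (sMid F * unip 0 x 0 * g * wLong F).val) :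
    InCell c (sMid F * unip 0 x 0 * g).val := by
  have hw := mul_wLong_apply (sMid F * unip 0 x 0 * g)
  obtain ⟨-, h2, h3, h4, h5⟩ := h
  simp only [hw, sMid_mul_val] at h2 h3 h4 h5
  rw [inCell_mid_iff, h12, zero_add]
  simp only [Matrix.of_apply, Matrix.cons_val, h12, zero_add] at h2 h3 h4 h5
  generalize g.val 1 0 = a at *
  generalize g.val 1 1 = b at *
  generalize g.val 2 0 = α at *
  generalize g.val 2 1 = β at *
  generalize g.val 2 2 = γ at *
  have hexp : exp (-c : ℤ) < (1 : WithZero (Multiplicative ℤ)) := by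
    rw [← exp_zero, exp_lt_exp]; omega
  have hγ0 : 0 < val F γ := lt_of_le_of_lt zero_le h21
  have hγ : γ ≠ 0 := by rintro rfl; simp at hγ0
  have e1 : β * (a + x * α) - α * (b + x * β) = β * a - α * b := by ring
  have e2 : γ * (a + x * α) - α * (x * γ) = γ * a := by ring
  rw [e1] at h2
  rw [e1, e2] at h5
  have hxα : val F (x * α) ≤ val F (x * γ) := by rw [map_mul, map_mul]; gcongr
  have hab : val F a ≤ val F b := by
    by_cases ha : a = 0
    · simp [ha]
    have hβa : val F (β * a) < val F (γ * a) := by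
      rw [map_mul, map_mul]
      exact mul_lt_mul_of_pos_right h21 (by simpa [zero_lt_iff] using ha)
    have h6 : val F (γ * a) ≤ val F (α * b) := by
      rcases le_max_iff.mp (h5.trans ((val F).map_sub _ _)) with h | h
      · exact absurd h hβa.not_ge
      · exact h
    rw [map_mul, map_mul] at h6
    exact (mul_le_mul_iff_right₀ hγ0).mp (h6.trans (by gcongr))
  have hb : b ≠ 0 := by
    rintro rfl
    rw [map_zero, le_zero_iff, map_eq_zero] at hab
    exact h2 (by rw [hab]; ring)
  have hbx : val F b ≤ val F (x * β) ∨ val F b ≤ exp (-c : ℤ) * val F (x * γ) := by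
    have h6 := (val F).map_sub (b + x * β) (x * β)
    rw [add_sub_cancel_right] at h6
    rcases le_max_iff.mp h6 with h7 | h7
    · right
      rcases le_max_iff.mp ((val F).map_add a (x * α)) with h8 | h8
      · exfalso
        have h9 : val F b ≤ exp (-c : ℤ) * val F b :=
          h7.trans (h4.trans (by gcongr; exact h8.trans hab))
        exact h9.not_gt (mul_lt_of_lt_one_left (by simpa [zero_lt_iff] using hb) hexp)
      · exact h7.trans (h4.trans (by gcongr; exact h8.trans hxα))
    · exact Or.inl h7
  have hx : x ≠ 0 := by
    rintro rfl
    simp [hb] at hbx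
  have hx0 : 0 < val F x := by simpa [zero_lt_iff] using hx
  have hbγ : val F b ≤ val F (x * γ) := by
    rcases hbx with h | h
    · refine h.trans ?_
      rw [map_mul, map_mul]; gcongr
    · exact h.trans (mul_le_of_le_one_left' hexp.le)
  have hle : val F (a + x * α) ≤ val F (x * γ) :=
    ((val F).map_add _ _).trans (max_le (hab.trans hbγ) hxα)
  refine ⟨mul_ne_zero hx hγ, by simp [hγ, hb], hle, h4.trans (by gcongr), ?_⟩
  rw [mul_zero, mul_zero, zero_sub, zero_sub, (val F).map_neg, (val F).map_neg, map_mul, map_mul]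
  gcongr

lemma inCell_mul_unit {ε : Fˣ} (h12 : g.val 1 2 = 0) (hε : val F (ε : F) = 1)
    (hεβ : val F (((ε : F) - 1) * g.val 2 1) ≤ exp (-c : ℤ) * val F (g.val 2 2))
    (h20 : val F (g.val 2 0) ≤ val F (g.val 2 2))
    (h : InCell c (sMid F * unip 0 x 0 * g).val) :
    InCell c (sMid F * unip 0 (ε * x) 0 * g).val := by
  rw [inCell_mid_iff, h12, zero_add] at h ⊢
  obtain ⟨h1, h2, h3, h4, h5⟩ := h
  have hv : val F (ε * x * g.val 2 2) = val F (x * g.val 2 2) := by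
    rw [mul_assoc, map_mul, hε, one_mul]
  have hε' : val F ((ε : F) - 1) ≤ 1 := by
    refine ((val F).map_sub _ _).trans ?_
    rw [hε, map_one, max_self]
  refine ⟨?_, h2, ?_, ?_, h5⟩
  · rw [mul_assoc]; exact mul_ne_zero ε.ne_zero h1
  · rw [hv, show g.val 1 0 + ε * x * g.val 2 0 =
      (g.val 1 0 + x * g.val 2 0) + (ε - 1) * (x * g.val 2 0) by ring]
    refine ((val F).map_add _ _).trans (max_le h3 ?_)
    rw [map_mul]
    refine (mul_le_of_le_one_left' hε').trans ?_
    rw [map_mul, map_mul]; gcongr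
  · rw [hv, show g.val 1 1 + ε * x * g.val 2 1 =
      (g.val 1 1 + x * g.val 2 1) + x * ((ε - 1) * g.val 2 1) by ring]
    refine ((val F).map_add _ _).trans (max_le h4 ?_)
    rw [map_mul, map_mul (val F) x, mul_left_comm]
    gcongr

/-- The strict inequality |β| < |γ| gains one step: the closeness to 1 required of ε is strictly
below the conductor, where μ₂ is still nontrivial. -/
lemma exists_unit_ne_one (hμ₂ : c = conductor μ₂) (hc : 0 < c) {β γ : F}
    (h : val F β < val F γ) : ∃ ε : Fˣ, val F (ε : F) = 1 ∧ μ₂ ε ≠ 1 ∧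
      val F (((ε : F) - 1) * β) ≤ exp (-c : ℤ) * val F γ := by
  by_cases hβ : β = 0
  · obtain ⟨ε, hε, hne⟩ := exists_ne_one_of_lt_conductor (χ := μ₂) (n := 0) (hμ₂ ▸ hc)
    exact ⟨ε, hε.1, hne, by simp [hβ]⟩
  have hγ : γ ≠ 0 := by
    rintro rfl
    simp at h
  obtain ⟨i, hi⟩ := exists_val_eq_exp hβ
  obtain ⟨k, hk⟩ := exists_val_eq_exp hγ
  rw [hi, hk, exp_lt_exp] at h
  obtain ⟨ε, hε, hne⟩ := exists_ne_one_of_lt_conductor (χ := μ₂) (n := (c + i - k).toNat)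
    (by omega)
  refine ⟨ε, hε.1, hne, ?_⟩
  have h1 := hε.2
  rw [mem_pPow] at h1
  rw [map_mul, hi, hk, ← exp_add]
  calc val F ((ε : F) - 1) * exp i ≤ exp (-((c + i - k).toNat : ℤ)) * exp i := by gcongr
    _ ≤ exp (-c + k) := by rw [← exp_add, exp_le_exp]; omega

variable [MeasurableSpace F] [BorelSpace F] {dx : Measure F} [dx.IsAddHaarMeasure]

variable (dx) in
/-- The integral of `f (s₂ n₂₃(x) g)` over `x ∈ 𝔭⁻ᴺ` equals `v` for large `N`. -/
def HasMidIntegral (f : GL (Fin 3) F → ℂ) (g : GL (Fin 3) F) (v : ℂ) : Prop :=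
  ∀ᶠ N : ℕ in atTop, ∫ x in pPow F (-N), f (sMid F * unip 0 x 0 * g) ∂dx = v

lemma HasMidIntegral.unique {f : GL (Fin 3) F → ℂ} {v v' : ℂ} (h : HasMidIntegral dx f g v)
    (h' : HasMidIntegral dx f g v') : v = v' := by
  obtain ⟨N, h1, h2⟩ := (h.and h').exists
  exact h1.symm.trans h2

/-- The factor is absorbed by a translation of x. It is used to clear an entry of the middle row. -/
lemma HasMidIntegral.of_shift {f : GL (Fin 3) F → ℂ} {v : ℂ} (y : F)
    (h : HasMidIntegral dx f (unip 0 y 0 * g) v) : HasMidIntegral dx f g v := by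
  obtain ⟨n, hn⟩ := exists_mem_pPow y
  filter_upwards [h, eventually_ge_atTop n] with N hN hnN
  have hy : y ∈ pPow F (-N) := pPow_mono (by omega) hn
  rw [← hN, ← setIntegral_add_right dx y (fun x => add_mem_pPow_iff hy)]
  refine integral_congr_ae (ae_of_all _ fun x => ?_)
  simp only
  rw [← mul_assoc, mul_assoc _ (unip 0 x 0), unip_mul]
  simp

lemma HasMidIntegral.of_swap (hμ₁ : IsUnramified μ₁) (hμ₃ : IsUnramified μ₃)
    (hμ₂ : ∀ x ∈ unitFiltration F c, μ₂ x = 1) (hd : val F (d : F) = exp (-c : ℤ)) {v : ℂ}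
    (h : HasMidIntegral dx (fun h => newform μ₁ μ₂ μ₃ c (h * torus d 1 1)) (g * wLong F) v) :
    HasMidIntegral dx (fun h => newform μ₁ μ₂ μ₃ c (h * torus d 1 1)) g v := by
  filter_upwards [h] with N hN
  rw [← hN]
  refine integral_congr_ae (ae_of_all _ fun x => ?_)
  simp only
  rw [← mul_assoc, newform_swap hμ₁ hμ₃ hμ₂ hd]

open Classical in
-- When the middle entry β of the bottom row is the largest one, the newform is constant for x in a
-- ball and 0 outside. Both the constant and the ball depend on the middle row, but by
-- `borelWeight_mid` their product depends only on |det g| and β.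
lemma hasMidIntegral_of_pivot (hdx : dx (pPow F 0) = 1) (hϖ : IsUniformizer ϖ)
    (hμ₁ : IsUnramified μ₁) (hμ₃ : IsUnramified μ₃)
    (hμ₂ : ∀ x ∈ unitFiltration F c, μ₂ x = 1) (hc : 0 < c)
    (ht : (μ₁ ϖ : ℂ) = resCard F * (μ₃ ϖ : ℂ)) (hd : val F (d : F) = exp (-c : ℤ))
    (h11 : g.val 1 1 = 0) (h10 : val F (g.val 1 0) ≤ val F (g.val 1 2)) {δ β : Fˣ}
    (hβ : (β : F) = g.val 2 1) (hδ : val F (δ : F) = val F g.val.det)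
    (h20 : val F (g.val 2 0) ≤ val F (β : F)) (h22 : val F (g.val 2 2) ≤ val F (β : F)) :
    HasMidIntegral dx (fun h => newform μ₁ μ₂ μ₃ c (h * torus d 1 1)) g
      (borelWeight μ₁ μ₂ μ₃ (δ * d / β) β 1 * ((absF β : ℂ)⁻¹ * (resCard F : ℂ) ^ (-c : ℤ))) := by
  have he0 : g.val 1 2 ≠ 0 := by
    intro h12
    have h10' : g.val 1 0 = 0 := by simpa [h12] using h10
    have : g.val.det = 0 := by
      rw [Matrix.det_fin_three, h11, h12, h10']; ring
    rw [this, map_zero] at hδ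
    simp at hδ
  obtain ⟨e, he⟩ : ∃ e : Fˣ, (e : F) = g.val 1 2 := ⟨Units.mk0 _ he0, rfl⟩
  obtain ⟨ke, hke⟩ := exists_val_eq_exp e.ne_zero
  obtain ⟨kβ, hkβ⟩ := exists_val_eq_exp β.ne_zero
  have hmem : ∀ x : F, x ∈ pPow F (c + kβ - ke) ↔
      val F (x * (β : F)) ≤ exp (-c : ℤ) * val F (e : F) := by
    intro x
    rw [map_mul, hkβ, hke, ← exp_add, show (-c + ke : ℤ) = -(c + kβ - ke) + kβ by ring, exp_add,
      mul_le_mul_iff_left₀ (by simp [zero_lt_iff]), mem_pPow]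
  have hbound : ∀ {x w : F}, val F w ≤ val F (β : F) → val F (x * w) ≤ val F (x * (β : F)) := by
    intro x w hw
    rw [map_mul, map_mul]; gcongr
  have hlt : exp (-c : ℤ) * val F (e : F) < val F (e : F) := by
    rw [hke, ← exp_add, exp_lt_exp]; omega
  have key : ∀ x : F, newform μ₁ μ₂ μ₃ c (sMid F * unip 0 x 0 * g * torus d 1 1) =
      if x ∈ pPow F (c + kβ - ke) then borelWeight μ₁ μ₂ μ₃ (δ * d / β) β 1 *
        ((absF β : ℂ)⁻¹ * (resCard F : ℂ) ^ (-c : ℤ)) * (resCard F : ℂ) ^ ((c + kβ - ke) : ℤ)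
      else 0 := by
    intro x
    split_ifs with hx
    · rw [hmem] at hx
      have hv1 : val F (x * g.val 2 2) < val F (e : F) := ((hbound h22).trans hx).trans_lt hlt
      have hvr : val F (g.val 1 2 + x * g.val 2 2) = val F (e : F) := by
        rw [← he]; exact val_add_eq_left hv1
      have hr0 : g.val 1 2 + x * g.val 2 2 ≠ 0 := by
        intro h0
        rw [h0, map_zero] at hvr
        exact e.ne_zero ((val F).zero_iff.mp hvr.symm)
      obtain ⟨r, hr⟩ : ∃ r : Fˣ, (r : F) = g.val 1 2 + x * g.val 2 2 := ⟨Units.mk0 _ hr0, rfl⟩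
      have hrv : val F (r : F) = exp ke := by rw [hr, hvr, hke]
      have hcell : InCell c (sMid F * unip 0 x 0 * g).val := by
        rw [inCell_mid_iff, hvr, h11, zero_add, mul_zero, sub_zero, ← hβ, ← he]
        refine ⟨by rw [he]; exact hr0, by simp, ?_, hx, ?_⟩
        · refine ((val F).map_add _ _).trans (max_le (he ▸ h10) ?_)
          exact ((hbound h20).trans hx).trans hlt.le
        · refine ((val F).map_sub _ _).trans (max_le ?_ ?_)
          · rw [map_mul, map_mul]; gcongr
          · rw [map_mul, map_mul]; gcongr; exact he ▸ h10
      rw [newform_mid_of_inCell hμ₁ hμ₃ hμ₂ hd hcell hδ (D := β * e) (r := r)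
        (by rw [h11, Units.val_mul, hβ, he]; ring) hr, ← borelWeight_mid hϖ hμ₁ hμ₃ hμ₂ ht hkβ hrv
          (e := e) ?_, mul_assoc, ← zpow_add₀ resCard_ne_zero']
      · simp
      · refine ⟨by rw [Units.val_div_eq_div_val, map_div₀, hrv, hke, div_self (by simp)], ?_⟩
        have : ((e / r : Fˣ) : F) - 1 = -(x * g.val 2 2) / r := by
          rw [Units.val_div_eq_div_val, div_sub_one r.ne_zero, hr, he]
          ring
        rw [this, mem_pPow, map_div₀, (val F).map_neg, hrv, div_le_iff₀ (by simp [zero_lt_iff]),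
          ← hke]
        exact (hbound h22).trans hx
    · by_contra hne
      rw [hmem] at hx
      rcases inCell_or_of_newform_ne_zero hc hd hne with h | h
      · have h4 := (inCell_mid_iff.mp h).2.2.2.1
        rw [h11, zero_add, ← hβ] at h4
        exact hx (val_le_of_le_add hc h4 (by rw [he]) (hbound h22))
      · have h4 := h.row_mid
        rw [(mul_wLong_apply _ 2).2.1, (mul_wLong_apply _ 2).2.2, sMid_mul_val] at h4
        have h5 : val F (x * (β : F)) ≤ exp (-c : ℤ) * val F (g.val 1 0 + x * g.val 2 0) := by
          simpa [h11, hβ] using h4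
        exact hx (val_le_of_le_add hc h5 (he ▸ h10) (hbound h20))
  filter_upwards [eventually_ge_atTop (-(c + kβ - ke)).toNat] with N hN
  simp only [key]
  rw [setIntegral_pPow_ite, setIntegral_const, real_pPow hdx, max_eq_right (by omega)]
  simp only [Complex.real_smul, Complex.ofReal_zpow, Complex.ofReal_natCast]
  rw [mul_comm, mul_assoc, ← zpow_add₀ resCard_ne_zero']
  simp

/-- The substitution x ↦ εx preserves the ball and the cell. It multiplies r by ε and fixes D and δ,
so the newform is multiplied by μ₂(ε)⁻¹ ≠ 1 and its integral vanishes. -/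
lemma hasMidIntegral_zero (hμ₁ : IsUnramified μ₁) (hμ₃ : IsUnramified μ₃)
    (hμ₂ : c = conductor μ₂) (hc : 0 < c) (hd : val F (d : F) = exp (-c : ℤ))
    (h12 : g.val 1 2 = 0) (h20 : val F (g.val 2 0) ≤ val F (g.val 2 2))
    (h21 : val F (g.val 2 1) < val F (g.val 2 2)) :
    HasMidIntegral dx (fun h => newform μ₁ μ₂ μ₃ c (h * torus d 1 1)) g 0 := by
  have htriv : ∀ x ∈ unitFiltration F c, μ₂ x = 1 := hμ₂ ▸ conductor_spec μ₂
  obtain ⟨ε, hε, hne, hεβ⟩ := exists_unit_ne_one hμ₂ hc h21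
  have hdet : g.val.det ≠ 0 := (Matrix.isUnit_iff_isUnit_det _).mp g.isUnit |>.ne_zero
  have hzero : ∀ x : F, ¬ InCell c (sMid F * unip 0 x 0 * g).val →
      newform μ₁ μ₂ μ₃ c (sMid F * unip 0 x 0 * g * torus d 1 1) = 0 := by
    intro x hx
    by_contra h0
    rcases inCell_or_of_newform_ne_zero hc hd h0 with h | h
    · exact hx h
    · exact hx (inCell_of_inCell_swap hc h12 h20 h21 h)
  have hε' : val F ((ε⁻¹ : Fˣ) : F) = 1 := by simp [hε]
  have hεβ' : val F ((((ε⁻¹ : Fˣ) : F) - 1) * g.val 2 1) ≤ exp (-c : ℤ) * val F (g.val 2 2) := by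
    have : (((ε⁻¹ : Fˣ) : F) - 1) * g.val 2 1 =
        -(((ε⁻¹ : Fˣ) : F) * (((ε : F) - 1) * g.val 2 1)) := by
      rw [← mul_assoc, mul_sub, Units.inv_mul]; ring
    rw [this, (val F).map_neg, map_mul, hε', one_mul]
    exact hεβ
  filter_upwards with N
  refine setIntegral_eq_zero_of_eigen (T := fun x => (ε : F) * x) (c := ((μ₂ ε : ℂˣ) : ℂ)⁻¹)
    (measurePreserving_mul_left dx hε) (measurableEmbedding_mul_left ε) (measurableSet_pPow _)
    (fun x => ?_) ?_ fun x _ => ?_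
  · rw [mem_pPow, mem_pPow, map_mul, hε, one_mul]
  · rw [ne_eq, inv_eq_one, Units.val_eq_one]
    exact hne
  · by_cases hcell : InCell c (sMid F * unip 0 x 0 * g).val
    · have hcell' := inCell_mul_unit h12 hε hεβ h20 hcell
      obtain ⟨h1, h2, -⟩ := inCell_mid_iff.mp hcell
      have hr : ((ε * Units.mk0 _ h1 : Fˣ) : F) = g.val 1 2 + ε * x * g.val 2 2 := by
        simp [h12, mul_assoc]
      rw [newform_mid_of_inCell hμ₁ hμ₃ htriv hd hcell (δ := Units.mk0 _ hdet)
        (D := Units.mk0 _ h2) (r := Units.mk0 _ h1) rfl rfl rfl,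
        newform_mid_of_inCell hμ₁ hμ₃ htriv hd hcell' (δ := Units.mk0 _ hdet)
        (D := Units.mk0 _ h2) (r := ε * Units.mk0 _ h1) rfl rfl hr]
      generalize Units.mk0 _ h1 = r
      generalize Units.mk0 _ h2 = D
      generalize Units.mk0 _ hdet * d / D = A
      simp only [borelWeight, map_mul, div_eq_mul_inv, absF_mul, absF_inv, mul_inv,
        absF_eq_one hε, unramified_apply hμ₃ hε]
      simp
      ring
    · rw [hzero x hcell, hzero, mul_zero]
      intro h
      refine hcell ?_
      have := inCell_mul_unit h12 hε' hεβ' h20 h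
      rwa [← mul_assoc, Units.inv_mul, one_mul] at this

end MidIntegral

end GLThree

namespace GLThree

/-! ### Reducibility of the principal series when t₁ = q t₃ -/

section Reducibility

open WithZero Topology

variable {F : Type*} [Field F] [ValuativeRel F] [TopologicalSpace F] [IsNonarchimedeanLocalField F]

variable {μ₁ μ₂ μ₃ : Fˣ →ₜ* ℂˣ} {c : ℕ} {g : GL (Fin 3) F} {d ϖ : Fˣ}

lemma continuous_mid {f : GL (Fin 3) F → ℂ} (hf : f ∈ principalSeries μ₁ μ₂ μ₃)
    (g : GL (Fin 3) F) : Continuous fun x : F => f (sMid F * unip 0 x 0 * g) := by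
  obtain ⟨-, K, hK, hfK⟩ := hf
  refine (continuous_of_rightInvariant hK hfK).comp ?_
  have hp : Continuous fun x : F => ((0 : F), x, (0 : F)) := by fun_prop
  have h := continuous_subtype_val.comp ((continuous_unipCoord (F := F)).comp hp)
  exact (continuous_const.mul h).mul continuous_const

lemma borelWeight_congr (hμ₁ : IsUnramified μ₁) (hμ₃ : IsUnramified μ₃)
    (hμ₂ : ∀ x ∈ unitFiltration F c, μ₂ x = 1) {a a' b b' r r' : Fˣ}
    (ha : val F (a : F) = val F (a' : F)) (hb : b / b' ∈ unitFiltration F c)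
    (hr : val F (r : F) = val F (r' : F)) :
    borelWeight μ₁ μ₂ μ₃ a b r = borelWeight μ₁ μ₂ μ₃ a' b' r' := by
  have h1 : absF (a / r) = absF (a' / r') := by
    simp [absF, ha, hr]
  have h2 : μ₂ b = μ₂ b' := by
    have := hμ₂ _ hb
    rwa [map_div, div_eq_one] at this
  rw [borelWeight, borelWeight, unramified_apply_eq hμ₁ ha, unramified_apply_eq hμ₃ hr, h1, h2]

lemma lowerUnip_mid_val (a : F) :
    (lowerUnip 0 0 a : GL (Fin 3) F).val = !![1, 0, 0; 0, 1, 0; 0, a, 1] := rfl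

variable [MeasurableSpace F] [BorelSpace F] {dx : Measure F} [dx.IsAddHaarMeasure]

/-- A translation in x clears `g 1 1`, and an exchange of the outer columns, if necessary, makes `g
1 2` at least as large as `g 1 0`. -/
lemma hasMidIntegral_pivot (hdx : dx (pPow F 0) = 1) (hϖ : IsUniformizer ϖ)
    (hμ₁ : IsUnramified μ₁) (hμ₃ : IsUnramified μ₃)
    (hμ₂ : ∀ x ∈ unitFiltration F c, μ₂ x = 1) (hc : 0 < c)
    (ht : (μ₁ ϖ : ℂ) = resCard F * (μ₃ ϖ : ℂ)) (hd : val F (d : F) = exp (-c : ℤ)) {δ β : Fˣ}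
    (hβ : (β : F) = g.val 2 1) (hδ : val F (δ : F) = val F g.val.det)
    (h20 : val F (g.val 2 0) ≤ val F (β : F)) (h22 : val F (g.val 2 2) ≤ val F (β : F)) :
    HasMidIntegral dx (fun h => newform μ₁ μ₂ μ₃ c (h * torus d 1 1)) g
      (borelWeight μ₁ μ₂ μ₃ (δ * d / β) β 1 * ((absF β : ℂ)⁻¹ * (resCard F : ℂ) ^ (-c : ℤ))) := by
  refine HasMidIntegral.of_shift (-(g.val 1 1) / β) ?_
  set g' := unip 0 (-(g.val 1 1) / β) 0 * g with hg'
  have hval := unip_mid_mul_val (-(g.val 1 1) / β) g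
  have hrow : ∀ j, g'.val 2 j = g.val 2 j := fun j => by
    rw [hval]; fin_cases j <;> simp
  have h11 : g'.val 1 1 = 0 := by
    rw [hval]
    simp [← hβ]
  have hdet : g'.val.det = g.val.det := by
    rw [hval, Matrix.det_fin_three, Matrix.det_fin_three]
    simp
    ring
  by_cases h10 : val F (g'.val 1 0) ≤ val F (g'.val 1 2)
  · exact hasMidIntegral_of_pivot hdx hϖ hμ₁ hμ₃ hμ₂ hc ht hd h11 h10 (by rw [hrow, hβ])
      (by rw [hdet, hδ]) (by rwa [hrow]) (by rwa [hrow])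
  · refine HasMidIntegral.of_swap hμ₁ hμ₃ hμ₂ hd ?_
    have hw := mul_wLong_apply g'
    have hdet' : (g' * wLong F).val.det = -g'.val.det := by
      rw [Matrix.det_fin_three, Matrix.det_fin_three]
      simp only [hw]
      ring
    refine hasMidIntegral_of_pivot hdx hϖ hμ₁ hμ₃ hμ₂ hc ht hd ?_ ?_ ?_ ?_ ?_ ?_
    · rw [(hw 1).2.1, h11]
    · rw [(hw 1).1, (hw 1).2.2]; exact (not_le.mp h10).le
    · rw [(hw 2).2.1, hrow, hβ]
    · rw [hdet', (val F).map_neg, hdet, hδ]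
    · rwa [(hw 2).1, hrow]
    · rwa [(hw 2).2.2, hrow]

/-- After an exchange of the outer columns, if necessary, the last entry of the bottom row is a
maximal one and strictly exceeds the middle one; clearing `g 1 2` then leads to
`hasMidIntegral_zero`. -/
lemma hasMidIntegral_not_pivot (hμ₁ : IsUnramified μ₁) (hμ₃ : IsUnramified μ₃)
    (hμ₂ : c = conductor μ₂) (hc : 0 < c) (hd : val F (d : F) = exp (-c : ℤ))
    (h : ¬ (val F (g.val 2 0) ≤ val F (g.val 2 1) ∧ val F (g.val 2 2) ≤ val F (g.val 2 1))) :
    HasMidIntegral dx (fun h => newform μ₁ μ₂ μ₃ c (h * torus d 1 1)) g 0 := by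
  have htriv : ∀ x ∈ unitFiltration F c, μ₂ x = 1 := hμ₂ ▸ conductor_spec μ₂
  have key : ∀ g : GL (Fin 3) F, val F (g.val 2 0) ≤ val F (g.val 2 2) →
      val F (g.val 2 1) < val F (g.val 2 2) →
      HasMidIntegral dx (fun h => newform μ₁ μ₂ μ₃ c (h * torus d 1 1)) g 0 := by
    intro g h20 h21
    have h22 : g.val 2 2 ≠ 0 := by
      intro h0
      rw [h0, map_zero] at h21
      exact not_lt_zero h21
    refine HasMidIntegral.of_shift (-(g.val 1 2) / g.val 2 2) ?_
    have hval := unip_mid_mul_val (-(g.val 1 2) / g.val 2 2) g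
    refine hasMidIntegral_zero hμ₁ hμ₃ hμ₂ hc hd ?_ ?_ ?_
    · rw [hval]; simp [h22]
    · rw [hval]; simpa using h20
    · rw [hval]; simpa using h21
  by_cases h1 : val F (g.val 2 0) ≤ val F (g.val 2 2)
  · refine key g h1 ?_
    by_contra h2
    exact h ⟨h1.trans (not_lt.mp h2), not_lt.mp h2⟩
  · have hw := mul_wLong_apply g 2
    refine HasMidIntegral.of_swap hμ₁ hμ₃ htriv hd (key _ ?_ ?_)
    · rw [hw.1, hw.2.2]; exact (not_le.mp h1).le
    · rw [hw.2.1, hw.2.2]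
      by_contra h2
      exact h ⟨not_lt.mp h2, (not_le.mp h1).le.trans (not_lt.mp h2)⟩

/-- The integral depends only on the bottom row and on |det g|, and exchanging the first two rows
changes neither. -/
lemma exists_hasMidIntegral (hdx : dx (pPow F 0) = 1) (hϖ : IsUniformizer ϖ)
    (hμ₁ : IsUnramified μ₁) (hμ₃ : IsUnramified μ₃) (hμ₂ : c = conductor μ₂) (hc : 0 < c)
    (ht : (μ₁ ϖ : ℂ) = resCard F * (μ₃ ϖ : ℂ)) (hd : val F (d : F) = exp (-c : ℤ))
    (g : GL (Fin 3) F) :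
    ∃ v, HasMidIntegral dx (fun h => newform μ₁ μ₂ μ₃ c (h * torus d 1 1)) g v ∧
      HasMidIntegral dx (fun h => newform μ₁ μ₂ μ₃ c (h * torus d 1 1)) (sLeft F * g) v := by
  have htriv : ∀ x ∈ unitFiltration F c, μ₂ x = 1 := hμ₂ ▸ conductor_spec μ₂
  have hrow : ∀ j, (sLeft F * g).val 2 j = g.val 2 j := fun j => by
    rw [sLeft_mul_val]; fin_cases j <;> simp
  have hne : g.val.det ≠ 0 := (Matrix.isUnit_iff_isUnit_det _).mp g.isUnit |>.ne_zero
  have hdet : (sLeft F * g).val.det = -g.val.det := by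
    rw [sLeft_mul_val, Matrix.det_fin_three, Matrix.det_fin_three]
    simp
    ring
  by_cases hp : val F (g.val 2 0) ≤ val F (g.val 2 1) ∧ val F (g.val 2 2) ≤ val F (g.val 2 1)
  · have hβ : g.val 2 1 ≠ 0 := by
      intro h0
      rw [h0] at hp
      simp only [map_zero, le_zero_iff, map_eq_zero] at hp
      exact hne (by rw [Matrix.det_fin_three, hp.1, hp.2, h0]; ring)
    refine ⟨_, hasMidIntegral_pivot hdx hϖ hμ₁ hμ₃ htriv hc ht hd (δ := Units.mk0 _ hne)
      (β := Units.mk0 _ hβ) rfl rfl hp.1 hp.2,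
      hasMidIntegral_pivot hdx hϖ hμ₁ hμ₃ htriv hc ht hd ?_ ?_ ?_ ?_⟩
    · rw [hrow]; rfl
    · rw [hdet, (val F).map_neg]; rfl
    · rw [hrow]; exact hp.1
    · rw [hrow]; exact hp.2
  · refine ⟨0, hasMidIntegral_not_pivot hμ₁ hμ₃ hμ₂ hc hd hp,
      hasMidIntegral_not_pivot hμ₁ hμ₃ hμ₂ hc hd ?_⟩
    simpa only [hrow] using hp

lemma HasMidIntegral.mul_right {f : GL (Fin 3) F → ℂ} {h : GL (Fin 3) F} {v : ℂ} :
    HasMidIntegral dx (fun g => f (g * h)) g v ↔ HasMidIntegral dx f (g * h) v := by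
  simp only [HasMidIntegral, mul_assoc]

variable (dx μ₁ μ₂ μ₃) in
/-- The kernel of the difference of two intertwining integrals. -/
def midInvariants : Subrepresentation (principalSeriesRep μ₁ μ₂ μ₃) where
  toSubmodule :=
    -- Existence of the integrals is part of membership, so nothing about convergence is needed for
    -- a general f.
    { carrier := {f | ∀ g, ∃ v, HasMidIntegral dx f.1 g v ∧ HasMidIntegral dx f.1 (sLeft F * g) v}
      add_mem' := by
        intro f f' hf hf' g
        have := t2Space (F := F)
        have add : ∀ {g v v'}, HasMidIntegral dx f.1 g v → HasMidIntegral dx f'.1 g v' →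
            HasMidIntegral dx (f + f').1 g (v + v') := by
          intro g v v' h h'
          filter_upwards [h, h'] with N h1 h2
          rw [← h1, ← h2]
          exact integral_add
            ((continuous_mid f.2 g).continuousOn.integrableOn_compact (isCompact_pPow _))
            ((continuous_mid f'.2 g).continuousOn.integrableOn_compact (isCompact_pPow _))
        obtain ⟨v, h1, h2⟩ := hf g
        obtain ⟨v', h1', h2'⟩ := hf' g
        exact ⟨_, add h1 h1', add h2 h2'⟩
      zero_mem' := fun g => ⟨0, by simp [HasMidIntegral], by simp [HasMidIntegral]⟩
      smul_mem' := by
        intro a f hf g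
        have smul : ∀ {g v}, HasMidIntegral dx f.1 g v → HasMidIntegral dx (a • f).1 g (a * v) := by
          intro g v h
          filter_upwards [h] with N h1
          rw [← h1]
          exact integral_const_mul _ _
        obtain ⟨v, h1, h2⟩ := hf g
        exact ⟨_, smul h1, smul h2⟩ }
  apply_mem_toSubmodule h f hf g := by
    obtain ⟨v, h1, h2⟩ := hf (g * h)
    exact ⟨v, HasMidIntegral.mul_right.mpr h1,
      HasMidIntegral.mul_right.mpr (by rwa [← mul_assoc] at h2)⟩

lemma newform_mem_midInvariants (hdx : dx (pPow F 0) = 1) (hϖ : IsUniformizer ϖ)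
    (hμ₁ : IsUnramified μ₁) (hμ₃ : IsUnramified μ₃) (hμ₂ : c = conductor μ₂) (hc : 0 < c)
    (ht : (μ₁ ϖ : ℂ) = resCard F * (μ₃ ϖ : ℂ))
    (hmem : newform μ₁ μ₂ μ₃ c ∈ principalSeries μ₁ μ₂ μ₃) :
    (⟨newform μ₁ μ₂ μ₃ c, hmem⟩ : principalSeries μ₁ μ₂ μ₃) ∈ midInvariants μ₁ μ₂ μ₃ dx := by
  intro g
  obtain ⟨v, h1, h2⟩ := exists_hasMidIntegral hdx hϖ hμ₁ hμ₃ hμ₂ hc ht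
    (val_uniformizer_pow (c := c) hϖ) (g * (torus (ϖ ^ c) 1 1)⁻¹)
  rw [← mul_assoc] at h2
  have h1' := HasMidIntegral.mul_right.mp h1
  have h2' := HasMidIntegral.mul_right.mp h2
  rw [inv_mul_cancel_right] at h1' h2'
  exact ⟨v, h1', h2'⟩

/-- At level c + 1 the bottom row (0, ϖ, 1) restricts -xϖ to 1 + 𝔭ᶜ, where μ₂ is trivial, so nothing
cancels in the integral. At level c the corresponding integral vanishes by `hasMidIntegral_zero`;
this difference is why raising the level leaves `midInvariants`. -/
lemma inCell_raised_iff (hϖ : IsUniformizer ϖ) (hc : 0 < c) {x : F} :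
    InCell (c + 1) (sMid F * unip 0 x 0 * lowerUnip 0 0 (ϖ : F)).val ↔
      x + (ϖ : F)⁻¹ ∈ pPow F (c - 1) := by
  have hv := val_uniformizer hϖ
  have hϖ0 := ϖ.ne_zero
  have e1 : x + (ϖ : F)⁻¹ ∈ pPow F (c - 1) ↔ 1 + x * ϖ ∈ pPow F c := by
    rw [← smul_mem_pPow_iff (a := ϖ) (k := c - 1) hv, mul_add, mul_inv_cancel₀ hϖ0,
      show ((c : ℤ) - 1 - (-1)) = c by ring, add_comm, mul_comm]
  have e2 : exp (-(c + 1 : ℕ) : ℤ) * val F x = exp (-c : ℤ) * val F (x * ϖ) := by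
    rw [map_mul, hv, mul_comm (val F x), ← mul_assoc, ← exp_add]
    congr 2
    push_cast; ring
  rw [e1, inCell_mid_iff, lowerUnip_mid_val]
  simp only [Matrix.of_apply, Matrix.cons_val, zero_add, mul_zero, mul_one,
    map_zero, zero_le, and_true, sub_zero, true_and, zero_sub, ne_eq, neg_eq_zero, one_ne_zero,
    not_false_eq_true, add_zero, e2]
  constructor
  · rintro ⟨-, h⟩
    have h1 : val F (1 + x * ϖ) ≤ exp (-c : ℤ) * val F (-1 + (1 + x * ϖ)) := by
      rwa [neg_add_cancel_left]
    simpa [mem_pPow] using val_le_of_le_add hc h1 (b := 1) (by simp) le_rfl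
  · intro h
    have h1 : val F (1 + x * ϖ) < 1 := by
      refine lt_of_le_of_lt h ?_
      rw [← exp_zero, exp_lt_exp]; omega
    have h2 : val F (x * ϖ) = 1 := by
      have := val_add_eq_left (x := (-1 : F)) (y := 1 + x * ϖ) (by simpa using h1)
      rw [neg_add_cancel_left] at this
      simpa using this
    refine ⟨?_, by rw [h2, mul_one]; exact h⟩
    rintro rfl
    simp at h2

open Classical in
lemma newform_raised (hϖ : IsUniformizer ϖ) (hμ₁ : IsUnramified μ₁) (hμ₃ : IsUnramified μ₃)
    (hμ₂ : ∀ x ∈ unitFiltration F c, μ₂ x = 1) (hc : 0 < c)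
    (hd : val F (d : F) = exp (-(c + 1 : ℕ) : ℤ)) (x : F) :
    newform μ₁ μ₂ μ₃ (c + 1) (sMid F * unip 0 x 0 * lowerUnip 0 0 (ϖ : F) * torus d 1 1) =
      if x + (ϖ : F)⁻¹ ∈ pPow F (c - 1) then borelWeight μ₁ μ₂ μ₃ d ϖ ϖ⁻¹ else 0 := by
  have hμ₂' : ∀ x ∈ unitFiltration F (c + 1), μ₂ x = 1 :=
    fun x hx => hμ₂ x (unitFiltration_anti (Nat.le_succ c) hx)
  have hv := val_uniformizer hϖ
  have hϖ0 := ϖ.ne_zero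
  split_ifs with hx
  · have hcell := (inCell_raised_iff hϖ hc).mpr hx
    have hx0 : x ≠ 0 := by
      have := (inCell_mid_iff.mp hcell).1
      simpa [lowerUnip_mid_val] using this
    have hy : 1 - (-(x * ϖ)) ∈ pPow F c := by
      have := (smul_mem_pPow_iff (a := ϖ) (k := c - 1) hv).mpr hx
      rw [mul_add, mul_inv_cancel₀ hϖ0, show ((c : ℤ) - 1 - (-1)) = c by ring] at this
      rwa [sub_neg_eq_add, add_comm, mul_comm]
    have hy' : -(x * ϖ) - 1 ∈ pPow F c := by
      rw [← neg_sub]; exact pPow_neg_mem hy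
    have hvx : val F (-(x * ϖ)) = 1 := val_eq_one_of_sub_mem (by omega) hy'
    have hvx' : val F x = exp 1 := by
      rw [(val F).map_neg, map_mul, hv] at hvx
      have := congrArg (· * exp (1 : ℤ)) hvx
      simpa [mul_assoc, ← exp_add] using this
    rw [newform_mid_of_inCell hμ₁ hμ₃ hμ₂' hd hcell (δ := 1) (D := -1) (r := Units.mk0 x hx0)]
    · refine borelWeight_congr hμ₁ hμ₃ hμ₂ ?_ ?_ ?_
      · simp
      · have e : (((-1 : Fˣ) / Units.mk0 x hx0 / ϖ : Fˣ) : F) = (-(x * ϖ))⁻¹ := by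
          simp only [Units.val_div_eq_div_val, Units.val_mk0, Units.val_neg, Units.val_one]
          field_simp
        have e2 : (-(x * ϖ))⁻¹ - 1 = (-(x * ϖ))⁻¹ * (1 - (-(x * ϖ))) := by
          field_simp
          ring
        refine ⟨by rw [e, map_inv₀, hvx, inv_one], ?_⟩
        rw [e, e2, mem_pPow, map_mul, map_inv₀, hvx, inv_one, one_mul]
        exact hy
      · simp [hvx', hv]
    · rw [lowerUnip_mid_val, Matrix.det_fin_three]; simp
    · simp [lowerUnip_mid_val]
    · simp [lowerUnip_mid_val]
  · by_contra hne
    rcases inCell_or_of_newform_ne_zero (Nat.succ_pos c) hd hne with h | h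
    · exact hx ((inCell_raised_iff hϖ hc).mp h)
    · have hw := mul_wLong_apply (sMid F * unip 0 x 0 * lowerUnip 0 0 (ϖ : F)) 2
      have := h.corner_ne
      rw [hw.2.2, sMid_mul_val, lowerUnip_mid_val] at this
      simp at this

/-- Neither cell is met: the unswapped one would require |ϖ| ≤ q^(-c-1), the swapped one 1 ≤ |ϖ|. -/
lemma newform_raised_sLeft (hϖ : IsUniformizer ϖ) (hc : 0 < c)
    (hd : val F (d : F) = exp (-(c + 1 : ℕ) : ℤ)) (x : F) :
    newform μ₁ μ₂ μ₃ (c + 1)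
      (sMid F * unip 0 x 0 * (sLeft F * lowerUnip 0 0 (ϖ : F)) * torus d 1 1) = 0 := by
  have hv := val_uniformizer hϖ
  have hval : (sMid F * unip 0 x 0 * (sLeft F * lowerUnip 0 0 (ϖ : F))).val =
      !![0, 1, 0; 0, (ϖ : F), 1; 1, x * ϖ, x] := by
    rw [sMid_mul_val, sLeft_mul_val, lowerUnip_mid_val]
    simp
  by_contra hne
  rcases inCell_or_of_newform_ne_zero (Nat.succ_pos c) hd hne with ⟨h1, h2, h3, h4, h5⟩ | h
  · simp only [hval] at h1 h4
    have h4' : val F (x * ϖ) ≤ exp (-(c + 1 : ℕ) : ℤ) * val F x := h4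
    obtain ⟨k, hk⟩ := exists_val_eq_exp (show x ≠ 0 from h1)
    rw [map_mul, hv, hk, ← exp_add, ← exp_add, exp_le_exp] at h4'
    push_cast at h4'
    omega
  · have h5 := h.minor_le
    have hw := mul_wLong_apply (sMid F * unip 0 x 0 * (sLeft F * lowerUnip 0 0 (ϖ : F)))
    simp only [hw, hval] at h5
    simp [hv] at h5
    rw [← exp_zero, ← exp_neg, exp_le_exp] at h5
    omega

lemma newform_notMem_midInvariants (hdx : dx (pPow F 0) = 1) (hϖ : IsUniformizer ϖ)
    (hμ₁ : IsUnramified μ₁) (hμ₃ : IsUnramified μ₃)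
    (hμ₂ : ∀ x ∈ unitFiltration F c, μ₂ x = 1) (hc : 0 < c)
    (hmem : newform μ₁ μ₂ μ₃ (c + 1) ∈ principalSeries μ₁ μ₂ μ₃) :
    (⟨newform μ₁ μ₂ μ₃ (c + 1), hmem⟩ : principalSeries μ₁ μ₂ μ₃) ∉
      midInvariants μ₁ μ₂ μ₃ dx := by
  classical
  intro hm
  have hd := val_uniformizer_pow (c := c + 1) hϖ
  set d : Fˣ := ϖ ^ (c + 1)
  obtain ⟨v, h1, h2⟩ := hm (lowerUnip 0 0 (ϖ : F) * torus d 1 1)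
  rw [← mul_assoc, ← HasMidIntegral.mul_right] at h2
  rw [← HasMidIntegral.mul_right] at h1
  have h2' : HasMidIntegral dx (fun g => newform μ₁ μ₂ μ₃ (c + 1) (g * torus d 1 1))
      (sLeft F * lowerUnip 0 0 (ϖ : F)) 0 := by
    simp only [HasMidIntegral, newform_raised_sLeft hϖ hc hd, integral_zero]
    exact Eventually.of_forall fun _ => trivial
  have h1' : HasMidIntegral dx (fun g => newform μ₁ μ₂ μ₃ (c + 1) (g * torus d 1 1))
      (lowerUnip 0 0 (ϖ : F))
      (borelWeight μ₁ μ₂ μ₃ d ϖ ϖ⁻¹ * (resCard F : ℂ) ^ (-(c - 1) : ℤ)) := by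
    filter_upwards [eventually_ge_atTop 1] with N hN
    simp only [newform_raised hϖ hμ₁ hμ₃ hμ₂ hc hd]
    have hmem : ((ϖ⁻¹ : Fˣ) : F) ∈ pPow F (-N) := by
      rw [mem_pPow, Units.val_inv_eq_inv_val, map_inv₀, val_uniformizer hϖ, ← exp_neg, exp_le_exp]
      omega
    rw [Units.val_inv_eq_inv_val] at hmem
    rw [setIntegral_add_right dx (ϖ : F)⁻¹ (fun x => add_mem_pPow_iff hmem)
      (fun x => if x ∈ pPow F (c - 1) then borelWeight μ₁ μ₂ μ₃ d ϖ ϖ⁻¹ else 0),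
      setIntegral_pPow_ite, setIntegral_const, real_pPow hdx, max_eq_right (by omega)]
    simp [mul_comm]
  have e := (h1.unique h1').symm.trans (h2.unique h2')
  exact mul_ne_zero (borelWeight_ne_zero _ _ _) (zpow_ne_zero _ resCard_ne_zero') e

variable (dx) in
/-- At the parameters where the formula for `W(1)` vanishes, the principal series is reducible. -/
lemma not_isIrreducible_of_eq (hdx : dx (pPow F 0) = 1) (hϖ : IsUniformizer ϖ)
    (hμ₁ : IsUnramified μ₁) (hμ₃ : IsUnramified μ₃) (hμ₂ : c = conductor μ₂) (hc : 0 < c)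
    (h : (μ₁ ϖ : ℂ) = resCard F * (μ₃ ϖ : ℂ)) :
    ¬ (principalSeriesRep μ₁ μ₂ μ₃).IsIrreducible := by
  intro hirr
  have htriv : ∀ x ∈ unitFiltration F c, μ₂ x = 1 := hμ₂ ▸ conductor_spec μ₂
  have htriv' : ∀ x ∈ unitFiltration F (c + 1), μ₂ x = 1 :=
    fun x hx => htriv x (unitFiltration_anti (Nat.le_succ c) hx)
  have hm := newform_mem_principalSeries (n := c) hμ₁ hμ₃ htriv
  have hm' := newform_mem_principalSeries (n := c + 1) hμ₁ hμ₃ htriv'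
  have hin := newform_mem_midInvariants hdx hϖ hμ₁ hμ₃ hμ₂ hc h hm
  have hout := newform_notMem_midInvariants hdx hϖ hμ₁ hμ₃ htriv hc hm'
  -- The newform of level c, nonzero at the identity, excludes the zero subspace; the one of level c
  -- + 1 excludes the whole space.
  rcases hirr.eq_bot_or_eq_top (midInvariants μ₁ μ₂ μ₃ dx) with hb | ht
  · rw [hb] at hin
    have h0 : (⟨newform μ₁ μ₂ μ₃ c, hm⟩ : principalSeries μ₁ μ₂ μ₃) = 0 := hin
    have h1 : newform μ₁ μ₂ μ₃ c 1 = 0 := congrFun (congrArg Subtype.val h0) 1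
    have h2 := newform_apply hμ₁ hμ₃ htriv 1 1 1 (one_mem (unipGroup F))
      (one_mem (levelGroup F c))
    have hone : torus (1 : Fˣ) 1 1 = 1 := by
      ext i j; fin_cases i <;> fin_cases j <;> simp [torus]
    rw [hone, one_mul, one_mul, h1] at h2
    exact borelWeight_ne_zero _ _ _ h2.symm
  · rw [ht] at hout
    exact hout trivial

end Reducibility

end GLThree

/-! ### The theorem -/

theorem theorem3p3 {F : Type*} [Field F] [ValuativeRel F] [TopologicalSpace F]
    [IsNonarchimedeanLocalField F] [MeasurableSpace F] [BorelSpace F]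
    (dx : MeasureTheory.Measure F) [dx.IsAddHaarMeasure] (hdx : dx (GLThree.pPow F 0) = 1)
    (ϖ : Fˣ) (hϖ : GLThree.IsUniformizer ϖ)
    (ψ : AddChar F Circle) (hψ : Continuous ψ) (hψ' : GLThree.IsUnramifiedAddChar ψ)
    (μ₁ μ₂ μ₃ : Fˣ →ₜ* ℂˣ)
    (hirr : (GLThree.principalSeriesRep μ₁ μ₂ μ₃).IsIrreducible)
    (hμ₁ : GLThree.IsUnramified μ₁) (hμ₃ : GLThree.IsUnramified μ₃)
    (hμ₂ : ¬ GLThree.IsUnramified μ₂) (c : ℕ) (hc : c = GLThree.conductor μ₂)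
    (q t₁ t₃ : ℂ) (hq : q = (GLThree.resCard F : ℂ))
    (ht₁ : t₁ = (μ₁ ϖ : ℂ)) (ht₃ : t₃ = (μ₃ ϖ : ℂ))
    (W : GL (Fin 3) F → ℂ)
    (hW : W = GLThree.whittaker dx ψ (GLThree.newform μ₁ μ₂ μ₃ c)) :
    -- the stable integral that defines `W g` exists for every `g`
    (∀ g, GLThree.HasStableIntegral dx
      (GLThree.whittakerIntegrand ψ (GLThree.newform μ₁ μ₂ μ₃ c) g) (W g)) ∧
    W 1 ≠ 0 ∧
    ∀ (m n : ℕ) (a b : Fˣ),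
      (∃ u : Fˣ, GLThree.val F (u : F) = 1 ∧ a = ϖ ^ m * u) →
      (∃ u : Fˣ, GLThree.val F (u : F) = 1 ∧ b = ϖ ^ (-(n : ℤ)) * u) →
      (t₁ ≠ t₃ → W (GLThree.torus a 1 b) =
        q ^ (-((m : ℤ) + n)) * (t₁ * t₃) ^ (-(n : ℤ)) *
          ((t₁ ^ (m + n + 1) - t₃ ^ (m + n + 1)) / (t₁ - t₃)) * W 1) ∧
      -- the same with the quotient written as a polynomial, which also covers `t₁ = t₃`
      W (GLThree.torus a 1 b) =
        q ^ (-((m : ℤ) + n)) * (t₁ * t₃) ^ (-(n : ℤ)) *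
          (∑ i ∈ Finset.range (m + n + 1), t₁ ^ i * t₃ ^ (m + n - i)) * W 1 := by
  have hcond : 0 < c := hc ▸ GLThree.conductor_pos hμ₂
  have htriv : ∀ x ∈ GLThree.unitFiltration F c, μ₂ x = 1 := hc ▸ GLThree.conductor_spec μ₂
  have hone : GLThree.torus (1 : Fˣ) 1 1 = 1 := by
    ext i j; fin_cases i <;> fin_cases j <;> simp [GLThree.torus]
  have hq0 : q ≠ 0 := hq ▸ GLThree.resCard_ne_zero'
  have h1 : t₁ ≠ 0 := ht₁ ▸ Units.ne_zero _
  have h3 : t₃ ≠ 0 := ht₃ ▸ Units.ne_zero _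
  -- This is the torus formula at m = n = 0. Its last factor is the only one that can vanish, and it
  -- does so exactly when t₁ = q t₃.
  have hW1 : W 1 = t₁ ^ (c : ℤ) * t₃ ^ (-c : ℤ) * q ^ (-c : ℤ) * (1 - t₁ / t₃ * q⁻¹) := by
    rw [← hone, hW, GLThree.whittaker_newform_torus (m := 0) (n := 0) hdx hϖ hψ hψ' hμ₁ hμ₃ hc hcond
      (by simp) (by simp), ht₁, ht₃, hq]
    simp
  have hformula : ∀ (m n : ℕ) (a b : Fˣ),
      (∃ u : Fˣ, GLThree.val F (u : F) = 1 ∧ a = ϖ ^ m * u) →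
      (∃ u : Fˣ, GLThree.val F (u : F) = 1 ∧ b = ϖ ^ (-(n : ℤ)) * u) →
      W (GLThree.torus a 1 b) =
        q ^ (-((m : ℤ) + n)) * (t₁ * t₃) ^ (-(n : ℤ)) *
          (∑ i ∈ Finset.range (m + n + 1), t₁ ^ i * t₃ ^ (m + n - i)) * W 1 := by
    rintro m n a b ⟨u, hu, rfl⟩ ⟨v, hv, rfl⟩
    have ha : GLThree.val F ((ϖ ^ m * u : Fˣ) : F) = WithZero.exp (-m : ℤ) := by
      rw [Units.val_mul, map_mul, GLThree.val_uniformizer_pow hϖ, hu, mul_one]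
    have hb : GLThree.val F ((ϖ ^ (-(n : ℤ)) * v : Fˣ) : F) = WithZero.exp (n : ℤ) := by
      rw [Units.val_mul, map_mul, hv, mul_one, Units.val_zpow_eq_zpow_val, map_zpow₀,
        GLThree.val_uniformizer hϖ, ← WithZero.exp_zsmul]
      simp
    have hsum : ∑ i ∈ Finset.range (m + n + 1), t₁ ^ i * t₃ ^ (m + n - i) =
        t₃ ^ (m + n) * ∑ i ∈ Finset.range (m + n + 1), (t₁ / t₃) ^ i := by
      rw [Finset.mul_sum]
      refine Finset.sum_congr rfl fun i hi => ?_
      rw [Finset.mem_range] at hi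
      rw [pow_sub₀ _ h3 (by omega), div_pow]
      field_simp
    rw [hsum, hW1, hW, GLThree.whittaker_newform_torus hdx hϖ hψ hψ' hμ₁ hμ₃ hc hcond ha hb,
      ← ht₁, ← ht₃, ← hq, zpow_sub₀ h1, zpow_sub₀ h3, zpow_sub₀ hq0, zpow_sub₀ hq0, zpow_neg,
      zpow_neg, zpow_neg, zpow_add₀ hq0, zpow_neg, mul_zpow, pow_add]
    simp only [zpow_natCast]
    field_simp
  refine ⟨fun g => hW ▸ GLThree.hasStableIntegral_newform hψ hψ' hμ₁ hμ₃ htriv g, ?_,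
    fun m n a b ha hb => ⟨fun hne => ?_, hformula m n a b ha hb⟩⟩
  · rw [hW1]
    refine mul_ne_zero (mul_ne_zero (mul_ne_zero ?_ ?_) ?_) ?_
    · exact zpow_ne_zero _ h1
    · exact zpow_ne_zero _ h3
    · exact zpow_ne_zero _ hq0
    · intro h
      have h' : (μ₁ ϖ : ℂ) = GLThree.resCard F * (μ₃ ϖ : ℂ) := by
        rw [← ht₁, ← ht₃, ← hq]
        field_simp at h
        linear_combination -h
      exact GLThree.not_isIrreducible_of_eq dx hdx hϖ hμ₁ hμ₃ hc hcond h' hirr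
  · rw [hformula m n a b ha hb]
    congr 2
    rw [eq_div_iff (sub_ne_zero.mpr hne)]
    exact (Commute.all t₁ t₃).geom_sum₂_mul (m + n + 1)
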